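/- For $A>1$, $\delta_0>0$ and $\lambda\in\mathbb R$ consider the piecewise-smooth planar system $$\dot y=\mu-y-A|1-y|y,\qquad \dot\mu=\delta_0(\lambda-y),$$ whose critical manifold is the graph $\mu=F(y):=y+A|1-y|y$. It has a smooth fold at $y_F=\frac{1+A}{2A}<1$, $\mu_F=F(y_F)=\frac{(1+A)^2}{4A}$, and a corner at $(1,1)$; the branches $y<y_F$ and $y>1$ are attracting and the middle branch $y_F<y<1$ is repelling. A periodic orbit is the trace of a nonconstant periodic solution. A compact invariant set is attracting if it is asymptotically stable (Lyapunov stable, and all solutions starting in some neighbourhood of it exist for all forward time and converge to it). An equilibrium is repelling if it is asymptotically stable in reversed time. (1) There is $\delta^*>0$ such that the following holds for all $A>1$ and $0<\delta_0<\delta^*$. (a) For every $\lambda$ with $\frac{1+A}{2A}<\lambda<1$, the point $(\lambda,F(\lambda))$ is the unique equilibrium, it is repelling, and the system has an attracting periodic orbit. (b) (Canard cycles.) If $A<1+2\sqrt{\delta_0}$, then the equilibrium is an unstable focus (non-real eigenvalues with positive real part) for every $\lambda\in(\frac{1+A}{2A},1)$, and the periodic orbits near $\lambda=1$ are canard cycles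 born at the corner: for every $\varepsilon>0$ and all $\lambda<1$ sufficiently close to $1$ (depending on $A,\delta_0,\varepsilon$), every periodic orbit is contained in the $\varepsilon$-ball about $(1,1)$ and in $\{y>y_F\}$, and it contains a point of the attracting branch $y>1$ and afterwards a segment, of time length at least $1$, that lies in $\{y<1\}$ and within distance $\varepsilon$ of the repelling branch. (c) (Super-explosion.) If $A>1+2\sqrt{\delta_0}$, then there is $r>0$ (depending on $A,\delta_0$) such that for all $\lambda<1$ sufficiently close to $1$ the equilibrium is an unstable node (positive real eigenvalues), and every periodic orbit contains a point at distance at least $r$ from the equilibrium. (2) (Relaxation oscillations.) For all $A>1$, $\lambda_1\in(\frac{1+A}{2A},1)$ and $\varepsilon>0$ there is $\delta_1>0$ such that for all $0<\delta_0<\delta_1$ one has $A>1+2\sqrt{\delta_0}$ and, for every $\lambda\in[\lambda_1,1)$, every periodic orbit is within Hausdorff distance $\varepsilon$ of the singular relaxation cycle. This cycle is the union of the arc of the left branch $\{\mu=F(y),\,y\le y_F\}$ with $\mu\ge 1$, the horizontal segment at height $\mu=\mu_F$ from the fold to the right branch, the arc of the right branch $\{\mu=F(y),\,y\ge 1\}$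 with $\mu\le\mu_F$, and the horizontal segment at height $\mu=1$ from the corner to the left branch. -/

import Mathlib

open Set Filter Topology

noncomputable section

namespace PlanarODE

/-! ### Autonomous planar systems `γ' = X γ` -/

/-- `γ` solves `γ' = X γ` on `[0, ∞)` (one-sided derivative at `0`). -/
def IsForwardSolution (X : ℝ × ℝ → ℝ × ℝ) (γ : ℝ → ℝ × ℝ) : Prop :=
  IsIntegralCurveOn γ (fun _ => X) (Ici 0)

/-- The set `Γ` is asymptotically stable for `X`: it is Lyapunov stable, and all solutions that start
in some neighbourhood of `Γ` exist for all forward time and tend to `Γ`. -/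
structure IsAttracting (X : ℝ × ℝ → ℝ × ℝ) (Γ : Set (ℝ × ℝ)) : Prop where
  stable : ∀ U ∈ 𝓝ˢ Γ, ∃ V ∈ 𝓝ˢ Γ, ∀ γ, IsForwardSolution X γ → γ 0 ∈ V → ∀ t ≥ 0, γ t ∈ U
  attracts : ∃ W ∈ 𝓝ˢ Γ, ∀ p ∈ W,
    (∃ γ, IsForwardSolution X γ ∧ γ 0 = p) ∧
    ∀ γ, IsForwardSolution X γ → γ 0 = p →
      Tendsto (fun t => Metric.infDist (γ t) Γ) atTop (𝓝 0)

/-- A repelling equilibrium: asymptotically stable after reversal of time. -/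
def IsRepellingEquilibrium (X : ℝ × ℝ → ℝ × ℝ) (p : ℝ × ℝ) : Prop :=
  X p = 0 ∧ IsAttracting (fun q => -X q) {p}

/-- `Γ` is the trace of a nonconstant periodic solution. -/
def IsPeriodicOrbit (X : ℝ × ℝ → ℝ × ℝ) (Γ : Set (ℝ × ℝ)) : Prop :=
  ∃ γ : ℝ → ℝ × ℝ, IsIntegralCurve γ (fun _ => X) ∧
    (∃ T > 0, Function.Periodic γ T) ∧ (∃ t, γ t ≠ γ 0) ∧ range γ = Γ

/-- `z` is a (complex) eigenvalue of the derivative of `X` at `p`. -/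
def IsLinearizationEigenvalue (X : ℝ × ℝ → ℝ × ℝ) (p : ℝ × ℝ) (z : ℂ) : Prop :=
  ((LinearMap.charpoly (fderiv ℝ X p : (ℝ × ℝ) →ₗ[ℝ] (ℝ × ℝ))).map (algebraMap ℝ ℂ)).IsRoot z

/-- Unstable focus: non-real eigenvalues with positive real part. -/
def IsUnstableFocus (X : ℝ × ℝ → ℝ × ℝ) (p : ℝ × ℝ) : Prop :=
  X p = 0 ∧ DifferentiableAt ℝ X p ∧
    ∀ z, IsLinearizationEigenvalue X p z → 0 < z.re ∧ z.im ≠ 0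

/-- Unstable node: positive real eigenvalues. -/
def IsUnstableNode (X : ℝ × ℝ → ℝ × ℝ) (p : ℝ × ℝ) : Prop :=
  X p = 0 ∧ DifferentiableAt ℝ X p ∧
    ∀ z, IsLinearizationEigenvalue X p z → 0 < z.re ∧ z.im = 0

end PlanarODE

namespace Stommel

open PlanarODE

/-! ### The reduced system, in the variables `(y, μ)` -/

/-- The vector field `(μ - y - A |1 - y| y, δ₀ (l - y))`; the parameter `l` is usually called
lambda. -/
def field (A δ₀ l : ℝ) (p : ℝ × ℝ) : ℝ × ℝ :=
  (p.2 - p.1 - A * |1 - p.1| * p.1, δ₀ * (l - p.1))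

/-- The critical manifold is the graph `μ = F y`. -/
def F (A y : ℝ) : ℝ := y + A * |1 - y| * y

/-- The `y`-coordinate of the smooth fold of the critical manifold. -/
def yFold (A : ℝ) : ℝ := (1 + A) / (2 * A)

/-- The `μ`-coordinate of the smooth fold of the critical manifold. -/
def muFold (A : ℝ) : ℝ := (1 + A) ^ 2 / (4 * A)

/-- The corner of the critical manifold on the splitting line `y = 1`. -/
def corner : ℝ × ℝ := (1, 1)

/-- The left attracting branch of the critical manifold. -/
def leftBranch (A : ℝ) : Set (ℝ × ℝ) := {p | p.2 = F A p.1 ∧ p.1 < yFold A}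

/-- The repelling (middle) branch of the critical manifold, between the fold and the corner. -/
def repellingBranch (A : ℝ) : Set (ℝ × ℝ) := {p | p.2 = F A p.1 ∧ yFold A < p.1 ∧ p.1 < 1}

/-- The right attracting branch of the critical manifold. -/
def rightBranch (A : ℝ) : Set (ℝ × ℝ) := {p | p.2 = F A p.1 ∧ 1 < p.1}

/-- The singular relaxation cycle: the parts of the two attracting branches at heights
`1 ≤ μ ≤ muFold A`, the horizontal fast jump from the fold to the right branch, and the horizontal
fast jump from the corner to the left branch (end points of all four arcs included). -/
def singularCycle (A : ℝ) : Set (ℝ × ℝ) :=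
  {p ∈ closure (leftBranch A) | 1 ≤ p.2} ∪
  {p ∈ closure (rightBranch A) | p.2 ≤ muFold A} ∪
  {p | p.2 = muFold A ∧ yFold A ≤ p.1 ∧ F A p.1 ≤ muFold A} ∪
  {p | p.2 = 1 ∧ p.1 ≤ 1 ∧ 1 ≤ F A p.1}

/-- `Γ` is `ε`-close, in the Hausdorff sense, to the singular relaxation cycle. -/
def IsRelaxationOscillation (A ε : ℝ) (Γ : Set (ℝ × ℝ)) : Prop :=
  Γ ⊆ Metric.thickening ε (singularCycle A) ∧ singularCycle A ⊆ Metric.thickening ε Γ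

/-- `Γ` is the trace of a solution with a canard segment through the corner: it is on the right
attracting branch at some time, and later stays left of the corner and within `ε` of the repelling
branch during at least one unit of time. -/
def HasCanardSegment (X : ℝ × ℝ → ℝ × ℝ) (A ε : ℝ) (Γ : Set (ℝ × ℝ)) : Prop :=
  ∃ γ : ℝ → ℝ × ℝ, IsIntegralCurve γ (fun _ => X) ∧ range γ = Γ ∧
    ∃ t₀ t₁ : ℝ, t₀ < t₁ ∧ γ t₀ ∈ rightBranch A ∧
      ∀ t ∈ Icc t₁ (t₁ + 1), (γ t).1 < 1 ∧ γ t ∈ Metric.thickening ε (repellingBranch A)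

/-- A canard cycle born at the corner, of size at most `ε`: a periodic orbit in the `ε`-ball about
the corner that never enters the region left of the fold and contains a canard segment. -/
structure IsCanardCycle (X : ℝ × ℝ → ℝ × ℝ) (A ε : ℝ) (Γ : Set (ℝ × ℝ)) : Prop where
  periodic : IsPeriodicOrbit X Γ
  small : Γ ⊆ Metric.ball corner ε
  right_of_fold : ∀ p ∈ Γ, yFold A < p.1
  canard : HasCanardSegment X A ε Γ

end Stommel

end

/-!
Write `τ = 2 * A * l - 1 - A > 0`, `x = y - l` and `v = μ - F l`; on `y ≤ 1` the field is quadratic,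
with linear part `(τ x + v, -δ x)` at the equilibrium. Everything rests on the geometry of one turn
about the equilibrium, consisting of a passage through `y < 1` (`LeftTurn`) and one through `y > 1`
(`RightTurn`). Bounds on a passage come from barriers: a quadratic function of the state that is not
positive at the start stays so if its derivative along the field is negative where it vanishes
(`Sol.barrier'`), or nonincreasing where it is positive (`Sol.barrier`).
On the left, `ham` is a first integral of the system with `τ = 0` and increases along solutions when
`τ > 0`; hence a solution that enters `y < 1` comes back to `y = 1`, at a height above
`1 + τ (1 - l)` (`Sol.exists_leftTurn`). On the right, the parabola `μ = F y - √δ (y - l)` is a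
barrier, and the solution comes back to `y = 1` at a height in `[1 - √δ (1 - l), 1)`
(`Sol.exists_rightTurn`). Therefore every periodic orbit meets `exitSet` and is composed of turns
starting there (`exists_exit`, `subset_of_turn`), and the claims about all periodic orbits become
claims about one turn.

* Super-explosion: if `τ ^ 2 > 4 δ`, the line `v = -τ x / 2` shields the solution in `y < l` from
  the critical manifold as long as the quadratic term is small, so a turn has to reach a distance
  from the equilibrium that does not depend on `l` (`LeftTurn.exists_far`).
* Canard cycles: if `A < 1 + 2 √δ`, the direction of `(x, v)` turns at a rate bounded below near the
  equilibrium, which bounds the time spent in `y < l` (`Sol.time_le_of_focus`). In bounded time the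
  size of the solution grows by a bounded factor, so a turn starting in `exitSet` remains
  within `O(1 - l)` of the corner (`turn_near_corner`). On the other hand it spends
  more than one unit of time in `y < l` (`LeftTurn.one_lt_time`).
* Relaxation oscillations: for small `δ` a turn consists of two jumps and two slow passages, each of
  them held by barriers near the corresponding arc of the singular cycle (`exists_phases`).
* The equilibrium is repelling since a quadratic form (`lyap`) is a strict Lyapunov function in
  reversed time.

For an attracting periodic orbit, consider the return map `Q` of the half line `y = 1`, `μ > 1`
(`exists_returnMap`). Its values lie between `1 + τ (1 - l)` and a constant. It is the composition
of two half turns, each in a half plane where the field is polynomial. After rescaling time to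
`[0, 1]`, a half turn is a zero of a polynomial map on the Banach space `C([0,1])² × ℝ` whose
derivative is the identity minus a Volterra operator, bordered by one row and one column; this is
invertible because the orbit is transversal to `y = 1`. By the analytic inverse function theorem
the end point depends analytically on the starting point (`IsArc.exists_family`), and a Wronskian
gives the sign of its derivative (`IsArc.exists_endpoint_deriv`). So `Q` is analytic and increasing.
As `Q > id` near `1` and `Q < id` far out, `Q - id` has a zero; by analyticity its zeros are
isolated, so one of them has `Q > id` just to its left and `Q < id` just to its right
(`exists_attracting_fixedPoint`). The iterates of `Q` converge to it from both sides, and the orbit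
through it is attracting (`isAttracting_of_returnMap`).
-/

/-! ### Barrier and hitting-time lemmas -/

/-- A continuous function that is nonpositive at `a`, and decreasing whenever it vanishes, stays
nonpositive. -/
theorem nonpos_of_deriv_neg_of_eq_zero {g g' : ℝ → ℝ} {a b : ℝ} (hc : ContinuousOn g (Icc a b))
    (hd : ∀ t ∈ Ico a b, HasDerivWithinAt g (g' t) (Ici t) t) (h0 : g a ≤ 0)
    (hb : ∀ t ∈ Ico a b, g t = 0 → g' t < 0) : ∀ t ∈ Icc a b, g t ≤ 0 := fun _ ht =>
  image_le_of_deriv_right_lt_deriv_boundary (B := fun _ => 0) (B' := fun _ => 0) hc hd h0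
    (fun x => hasDerivAt_const x 0) hb ht

/-- A continuous function that is nonpositive at `a`, and nonincreasing whenever it is positive,
stays nonpositive. -/
theorem nonpos_of_deriv_nonpos_of_pos {g g' : ℝ → ℝ} {a b : ℝ} (hc : ContinuousOn g (Icc a b))
    (hd : ∀ t ∈ Ico a b, HasDerivWithinAt g (g' t) (Ici t) t) (h0 : g a ≤ 0)
    (hb : ∀ t ∈ Ico a b, 0 < g t → g' t ≤ 0) : ∀ t ∈ Icc a b, g t ≤ 0 := by
  intro t ht
  -- compare with the slowly growing positive function `ε (1 + t - a)`
  have key : ∀ ε : ℝ, 0 < ε → g t ≤ ε * (1 + t - a) := by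
    intro ε hε
    refine image_le_of_deriv_right_lt_deriv_boundary (B := fun t => ε * (1 + t - a))
      (B' := fun _ => ε) hc hd (by nlinarith) (fun x => ?_) ?_ ht
    · simpa using (((hasDerivAt_id x).const_add 1).sub_const a).const_mul ε
    · intro x hx hgx
      have : 0 < g x := by rw [hgx]; exact mul_pos hε (by linarith [hx.1])
      exact (hb x hx this).trans_lt hε
  refine le_of_forall_pos_le_add fun η hη => ?_
  have h1 : 0 < 1 + t - a := by linarith [ht.1]
  have := key (η / (1 + t - a)) (by positivity)
  rwa [div_mul_cancel₀ _ h1.ne', ← zero_add η] at this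

theorem le_left_of_deriv_nonpos {g g' : ℝ → ℝ} {a b : ℝ} (hc : ContinuousOn g (Icc a b))
    (hd : ∀ t ∈ Ico a b, HasDerivWithinAt g (g' t) (Ici t) t)
    (hb : ∀ t ∈ Ico a b, g' t ≤ 0) : ∀ t ∈ Icc a b, g t ≤ g a := by
  intro t ht
  have := nonpos_of_deriv_nonpos_of_pos (g := fun t => g t - g a) (g' := g') (by fun_prop)
    (fun t ht => (hd t ht).sub_const _) (by simp) (fun t ht _ => hb t ht) t ht
  linarith

theorem add_mul_le_of_le_deriv {g g' : ℝ → ℝ} {a b c : ℝ} (hc : ContinuousOn g (Icc a b))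
    (hd : ∀ t ∈ Ico a b, HasDerivWithinAt g (g' t) (Ici t) t)
    (hb : ∀ t ∈ Ico a b, c ≤ g' t) : ∀ t ∈ Icc a b, g a + c * (t - a) ≤ g t := by
  intro t ht
  have := le_left_of_deriv_nonpos (g := fun t => c * (t - a) - g t) (g' := fun t => c - g' t)
    (by fun_prop)
    (fun t ht => by
      simpa using ((((hasDerivAt_id t).sub_const a).const_mul c).hasDerivWithinAt).fun_sub (hd t ht))
    (fun t ht => by linarith [hb t ht]) t ht
  simp only [sub_self, mul_zero] at this
  linarith

theorem le_add_mul_of_deriv_le {g g' : ℝ → ℝ} {a b c : ℝ} (hc : ContinuousOn g (Icc a b))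
    (hd : ∀ t ∈ Ico a b, HasDerivWithinAt g (g' t) (Ici t) t)
    (hb : ∀ t ∈ Ico a b, g' t ≤ c) : ∀ t ∈ Icc a b, g t ≤ g a + c * (t - a) := by
  intro t ht
  have := add_mul_le_of_le_deriv (g := fun t => - g t) (c := -c) hc.neg
    (fun t ht => (hd t ht).fun_neg) (fun t ht => neg_le_neg (hb t ht)) t ht
  linarith

/-- The first time at which a continuous function comes down to the level `c`. -/
theorem exists_first_le {f : ℝ → ℝ} {a b c : ℝ} (hab : a ≤ b) (hf : ContinuousOn f (Icc a b))
    (ha : c < f a) (hb : f b ≤ c) : ∃ t ∈ Ioc a b, f t = c ∧ ∀ s ∈ Ico a t, c < f s := by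
  set S : Set ℝ := Icc a b ∩ f ⁻¹' Iic c with hS
  have hSc : IsClosed S := hf.preimage_isClosed_of_isClosed isClosed_Icc isClosed_Iic
  have hSn : S.Nonempty := ⟨b, ⟨hab, le_rfl⟩, hb⟩
  have hSb : BddBelow S := ⟨a, fun x hx => hx.1.1⟩
  obtain ⟨h1, h2⟩ := hSc.csInf_mem hSn hSb
  set t := sInf S
  have hlt : ∀ s ∈ Ico a t, c < f s := fun s hs => by
    by_contra h
    exact absurd (csInf_le hSb (show s ∈ S from ⟨⟨hs.1, hs.2.le.trans h1.2⟩, not_lt.1 h⟩))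
      (not_le.2 hs.2)
  have hat : a < t := lt_of_le_of_ne h1.1 fun h => by
    have : f t ≤ c := h2
    rw [← h] at this; linarith
  refine ⟨t, ⟨hat, h1.2⟩, le_antisymm h2 ?_, hlt⟩
  -- an intermediate value would be an earlier time at level `c`
  by_contra! hlt'
  obtain ⟨s, hs, hsc⟩ := intermediate_value_Icc' h1.1 (hf.mono (Icc_subset_Icc_right h1.2))
    ⟨hlt'.le, ha.le⟩
  rcases hs.2.lt_or_eq with h | h
  · exact (hlt s ⟨hs.1, h⟩).ne' hsc
  · rw [h] at hsc; exact hlt'.ne hsc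

theorem exists_first_ge {f : ℝ → ℝ} {a b c : ℝ} (hab : a ≤ b) (hf : ContinuousOn f (Icc a b))
    (ha : f a < c) (hb : c ≤ f b) : ∃ t ∈ Ioc a b, f t = c ∧ ∀ s ∈ Ico a t, f s < c := by
  obtain ⟨t, ht, h1, h2⟩ := exists_first_le (f := fun t => - f t) (c := -c) hab hf.neg
    (by linarith) (by linarith)
  exact ⟨t, ht, by linarith, fun s hs => by linarith [h2 s hs]⟩

/-! ### Solutions: uniqueness, continuous dependence, global existence -/

namespace PlanarODE

variable {X : ℝ × ℝ → ℝ × ℝ} {γ η : ℝ → ℝ × ℝ}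

theorem IsForwardSolution.continuousOn (h : IsForwardSolution X γ) : ContinuousOn γ (Ici 0) :=
  IsIntegralCurveOn.continuousOn h

theorem IsForwardSolution.hasDerivWithinAt (h : IsForwardSolution X γ) {t : ℝ} (ht : 0 ≤ t) :
    HasDerivWithinAt γ (X (γ t)) (Ici t) t :=
  (h t ht).mono (Ici_subset_Ici.2 ht)

theorem IsForwardSolution.shift (h : IsForwardSolution X γ) {a : ℝ} (ha : 0 ≤ a) :
    IsForwardSolution X (fun t => γ (t + a)) := by
  intro t ht
  have h1 := h (t + a) (by simp only [mem_Ici] at ht ⊢; linarith)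
  have h2 : HasDerivWithinAt (fun t : ℝ => t + a) 1 (Ici 0) t :=
    ((hasDerivAt_id t).add_const a).hasDerivWithinAt
  have := HasDerivWithinAt.scomp t h1 h2 (fun s hs => by simp only [mem_Ici] at hs ⊢; linarith)
  simpa using! this

theorem _root_.IsIntegralCurve.isForwardSolution (h : IsIntegralCurve γ (fun _ => X)) (a : ℝ) :
    IsForwardSolution X (fun t => γ (t + a)) :=
  (h.comp_add a).isIntegralCurveOn _

/-- Lipschitz on every ball about the origin. -/
def LipschitzOnBalls (X : ℝ × ℝ → ℝ × ℝ) : Prop :=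
  ∀ R : ℝ, ∃ K : NNReal, LipschitzOnWith K X (Metric.closedBall 0 R)

theorem LipschitzOnBalls.neg (hX : LipschitzOnBalls X) : LipschitzOnBalls (fun q => -X q) :=
  fun R => (hX R).imp fun _ hK => hK.neg

theorem IsForwardSolution.exists_bound (h : IsForwardSolution X γ) (T : ℝ) :
    ∃ R, ∀ t ∈ Icc 0 T, γ t ∈ Metric.closedBall 0 R := by
  have : IsCompact (γ '' Icc 0 T) :=
    isCompact_Icc.image_of_continuousOn (h.continuousOn.mono Icc_subset_Ici_self)
  obtain ⟨R, hR⟩ := this.isBounded.subset_closedBall 0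
  exact ⟨R, fun t ht => hR ⟨t, ht, rfl⟩⟩

theorem IsForwardSolution.eqOn (hX : LipschitzOnBalls X) (h : IsForwardSolution X γ)
    (h' : IsForwardSolution X η) (h0 : γ 0 = η 0) : EqOn γ η (Ici 0) := by
  intro T hT
  obtain ⟨R, hR⟩ := h.exists_bound T
  obtain ⟨R', hR'⟩ := h'.exists_bound T
  obtain ⟨K, hK⟩ := hX (max R R')
  refine ODE_solution_unique_of_mem_Icc_right (v := fun _ => X) (K := K)
    (s := fun _ => Metric.closedBall 0 (max R R')) (fun _ _ => hK)
    (h.continuousOn.mono Icc_subset_Ici_self) (fun t ht => h.hasDerivWithinAt ht.1)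
    (fun t ht => Metric.closedBall_subset_closedBall (le_max_left _ _) (hR t ⟨ht.1, ht.2.le⟩))
    (h'.continuousOn.mono Icc_subset_Ici_self) (fun t ht => h'.hasDerivWithinAt ht.1)
    (fun t ht => Metric.closedBall_subset_closedBall (le_max_right _ _) (hR' t ⟨ht.1, ht.2.le⟩))
    h0 ⟨hT, le_rfl⟩

/-- The field `X` composed with the projection onto the square of half-width `R` is bounded and
globally Lipschitz, so that it has solutions on every interval. -/
theorem exists_solution_of_clamp (hX : LipschitzOnBalls X) {R T : ℝ} (hR : 0 ≤ R) (hT : 0 ≤ T)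
    (p : ℝ × ℝ) : ∃ γ : ℝ → ℝ × ℝ, γ 0 = p ∧ ContinuousOn γ (Icc 0 T) ∧
      ∀ t ∈ Icc 0 T, γ t ∈ Metric.closedBall 0 R →
        HasDerivWithinAt γ (X (γ t)) (Icc 0 T) t := by
  set c : ℝ × ℝ → ℝ × ℝ := fun q =>
    ((projIcc (-R) R (by linarith) q.1 : ℝ), (projIcc (-R) R (by linarith) q.2 : ℝ)) with hc
  have hcl : LipschitzWith 1 c := by
    have h1 : LipschitzWith 1 (fun x : ℝ => (projIcc (-R) R (by linarith) x : ℝ)) :=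
      LipschitzWith.projIcc _
    simpa using (h1.comp LipschitzWith.prod_fst).prodMk (h1.comp LipschitzWith.prod_snd)
  have hcm : ∀ q, c q ∈ Metric.closedBall (0 : ℝ × ℝ) R := fun q => by
    rw [mem_closedBall_zero_iff, Prod.norm_def]
    have h1 := (projIcc (-R) R (by linarith) q.1).2
    have h2 := (projIcc (-R) R (by linarith) q.2).2
    exact max_le (abs_le.2 h1) (abs_le.2 h2)
  have hce : ∀ q ∈ Metric.closedBall (0 : ℝ × ℝ) R, c q = q := fun q hq => by
    rw [mem_closedBall_zero_iff, Prod.norm_def, max_le_iff] at hq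
    have h1 := abs_le.1 hq.1
    have h2 := abs_le.1 hq.2
    simp only [hc, projIcc_of_mem _ (show q.1 ∈ Icc (-R) R from h1),
      projIcc_of_mem _ (show q.2 ∈ Icc (-R) R from h2)]
  obtain ⟨K, hK⟩ := hX R
  have hLip : LipschitzWith K (X ∘ c) := by
    have := (hK.comp (hcl.lipschitzOnWith (s := univ)) (fun q _ => hcm q))
    simpa [lipschitzOnWith_univ] using this
  obtain ⟨B, hB⟩ : ∃ B : ℝ, ∀ q, ‖X (c q)‖ ≤ B := by
    obtain ⟨B, hB⟩ := ((ProperSpace.isCompact_closedBall (0 : ℝ × ℝ) R).image_of_continuousOn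
      hK.continuousOn).isBounded.exists_norm_le
    exact ⟨B, fun q => hB _ ⟨c q, hcm q, rfl⟩⟩
  have hB0 : 0 ≤ B := (norm_nonneg _).trans (hB p)
  lift B to NNReal using hB0
  lift T to NNReal using hT
  have hPL : IsPicardLindelof (fun _ => X ∘ c) (tmin := 0) (tmax := T)
      ⟨0, ⟨le_rfl, T.2⟩⟩ p (B * T) 0 B K :=
    IsPicardLindelof.of_time_independent (fun q _ => hB q) hLip.lipschitzOnWith (by simp)
  obtain ⟨γ, hγ0, hγ⟩ := hPL.exists_eq_forall_mem_Icc_hasDerivWithinAt₀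
  refine ⟨γ, hγ0, fun t ht => (hγ t ht).continuousWithinAt, fun t ht hR' => ?_⟩
  have := hγ t ht
  rwa [Function.comp_apply, hce _ hR'] at this

/-- Global existence from an a priori bound on every bounded time interval. -/
theorem exists_isForwardSolution (hX : LipschitzOnBalls X) (p : ℝ × ℝ)
    (hb : ∀ T : ℝ, 0 ≤ T → ∃ R : ℝ, ∀ (S : ℝ) (γ : ℝ → ℝ × ℝ), 0 ≤ S → S ≤ T → γ 0 = p →
      ContinuousOn γ (Icc 0 S) → (∀ t ∈ Ico 0 S, HasDerivWithinAt γ (X (γ t)) (Ici t) t) →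
      ‖γ S‖ < R) : ∃ γ, IsForwardSolution X γ ∧ γ 0 = p := by
  -- solutions on bounded intervals
  have hloc : ∀ T : ℝ, 0 ≤ T → ∃ γ : ℝ → ℝ × ℝ, γ 0 = p ∧
      ∀ t ∈ Icc 0 T, HasDerivWithinAt γ (X (γ t)) (Icc 0 T) t := by
    intro T hT
    obtain ⟨R, hR⟩ := hb T hT
    have hR0 : ‖p‖ < R := hR 0 (fun _ => p) le_rfl hT rfl continuousOn_const (by simp)
    obtain ⟨γ, h0, hc, hd⟩ := exists_solution_of_clamp hX ((norm_nonneg p).trans hR0.le) hT p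
    have hin : ∀ t ∈ Icc 0 T, γ t ∈ Metric.closedBall 0 R := by
      by_contra! hcon
      obtain ⟨t, ht, hout⟩ := hcon
      rw [mem_closedBall_zero_iff, not_le] at hout
      obtain ⟨s, hs, hs1, hs2⟩ := exists_first_ge (f := fun t => ‖γ t‖) ht.1
        ((hc.mono (Icc_subset_Icc_right ht.2)).norm) (by simpa [h0] using hR0) hout.le
      have := hR s γ hs.1.le (hs.2.trans ht.2) h0
        (hc.mono (Icc_subset_Icc_right (hs.2.trans ht.2))) (fun u hu => by
          have hu' : u ∈ Icc 0 T := ⟨hu.1, hu.2.le.trans (hs.2.trans ht.2)⟩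
          refine (hd u hu' ?_).mono_of_mem_nhdsWithin ?_
          · rw [mem_closedBall_zero_iff]; exact (hs2 u hu).le
          · exact mem_nhdsWithin.2 ⟨Iio T, isOpen_Iio, hu.2.trans_le (hs.2.trans ht.2),
              fun v hv => ⟨hu.1.trans hv.2, hv.1.le⟩⟩)
      exact this.ne hs1
    exact ⟨γ, h0, fun t ht => hd t ht (hin t ht)⟩
  choose! Γ hΓ0 hΓ using hloc
  have hagree : ∀ S T : ℝ, 0 ≤ S → S ≤ T → EqOn (Γ S) (Γ T) (Icc 0 S) := by
    intro S T hS hST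
    have hbd : ∀ U : ℝ, 0 ≤ U → ∃ R, ∀ t ∈ Icc 0 U, Γ U t ∈ Metric.closedBall 0 R := fun U hU => by
      have : IsCompact (Γ U '' Icc 0 U) :=
        isCompact_Icc.image_of_continuousOn (fun t ht => (hΓ U hU t ht).continuousWithinAt)
      obtain ⟨R, hR⟩ := this.isBounded.subset_closedBall 0
      exact ⟨R, fun t ht => hR ⟨t, ht, rfl⟩⟩
    have hder : ∀ U : ℝ, 0 ≤ U → ∀ t ∈ Ico 0 U,
        HasDerivWithinAt (Γ U) (X (Γ U t)) (Ici t) t := fun U hU t ht =>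
      (hΓ U hU t ⟨ht.1, ht.2.le⟩).mono_of_mem_nhdsWithin
        (mem_nhdsWithin.2 ⟨Iio U, isOpen_Iio, ht.2, fun v hv => ⟨ht.1.trans hv.2, hv.1.le⟩⟩)
    obtain ⟨R, hR⟩ := hbd S hS
    obtain ⟨R', hR'⟩ := hbd T (hS.trans hST)
    obtain ⟨K, hK⟩ := hX (max R R')
    have hI : Icc (0 : ℝ) S ⊆ Icc 0 T := Icc_subset_Icc_right hST
    have hI' : Ico (0 : ℝ) S ⊆ Ico 0 T := Ico_subset_Ico_right hST
    refine ODE_solution_unique_of_mem_Icc_right (v := fun _ => X) (K := K)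
      (s := fun _ => Metric.closedBall 0 (max R R')) (fun _ _ => hK)
      (fun t ht => (hΓ S hS t ht).continuousWithinAt) (fun t ht => hder S hS t ht)
      (fun t ht => Metric.closedBall_subset_closedBall (le_max_left _ _) (hR t ⟨ht.1, ht.2.le⟩))
      (fun t ht => (hΓ T (hS.trans hST) t (hI ht)).continuousWithinAt.mono hI)
      (fun t ht => hder T (hS.trans hST) t (hI' ht))
      (fun t ht => Metric.closedBall_subset_closedBall (le_max_right _ _)
        (hR' t (hI ⟨ht.1, ht.2.le⟩)))
      (by rw [hΓ0 S hS, hΓ0 T (hS.trans hST)])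
  refine ⟨fun t => Γ (t + 1) t, fun t ht => ?_, by simpa using hΓ0 (0 + 1) (by norm_num)⟩
  have ht0 : (0 : ℝ) ≤ t := ht
  have h1 : HasDerivWithinAt (Γ (t + 2)) (X (Γ (t + 2) t)) (Ici 0) t :=
    (hΓ (t + 2) (by linarith) t ⟨ht0, by linarith⟩).mono_of_mem_nhdsWithin
      (mem_nhdsWithin.2 ⟨Iio (t + 2), isOpen_Iio, by simp, fun v hv => ⟨hv.2, hv.1.le⟩⟩)
  have h2 : ∀ s : ℝ, 0 ≤ s → s ≤ t + 1 → Γ (s + 1) s = Γ (t + 2) s := fun s hs hst =>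
    hagree (s + 1) (t + 2) (by linarith) (by linarith) ⟨hs, by linarith⟩
  have h3 : (fun t => Γ (t + 1) t) =ᶠ[𝓝[Ici 0] t] Γ (t + 2) := by
    filter_upwards [self_mem_nhdsWithin, mem_nhdsWithin_of_mem_nhds (Iio_mem_nhds (lt_add_one t))]
      with s hs hs'
    exact h2 s hs (le_of_lt hs')
  have h4 := h2 t ht0 (by linarith)
  rw [← h4] at h1
  exact h1.congr_of_eventuallyEq h3 h4

end PlanarODE

namespace PlanarODE

variable {X : ℝ × ℝ → ℝ × ℝ} {γ η : ℝ → ℝ × ℝ}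

/-- Continuous dependence on the initial point, uniformly on bounded time intervals. -/
theorem IsForwardSolution.exists_dist_lt (hX : LipschitzOnBalls X) (h : IsForwardSolution X γ)
    (T : ℝ) {ε : ℝ} (hε : 0 < ε) : ∃ r > 0, ∀ η, IsForwardSolution X η → dist (η 0) (γ 0) < r →
      ∀ t ∈ Icc 0 T, dist (η t) (γ t) < ε := by
  obtain ⟨R, hR⟩ := h.exists_bound T
  obtain ⟨K, hK⟩ := hX (R + ε)
  refine ⟨ε * Real.exp (-(K * T)), by positivity, fun η hη h0 => ?_⟩
  by_contra! hcon
  obtain ⟨t, ht, hout⟩ := hcon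
  have hT : 0 ≤ T := ht.1.trans ht.2
  have hcη : ContinuousOn η (Icc 0 t) := hη.continuousOn.mono Icc_subset_Ici_self
  have hcγ : ContinuousOn γ (Icc 0 t) := h.continuousOn.mono Icc_subset_Ici_self
  have hexp : Real.exp (-(K * T)) ≤ 1 := Real.exp_le_one_iff.2 (by
    have := K.2
    have := mul_nonneg this hT
    simpa using this)
  obtain ⟨s, hs, hs1, hs2⟩ := exists_first_ge (f := fun t => dist (η t) (γ t)) (c := ε) ht.1
    (continuous_dist.comp_continuousOn (hcη.prodMk hcγ)) (h0.trans_le (by nlinarith)) hout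
  have hin1 : ∀ u ∈ Ico 0 s, γ u ∈ Metric.closedBall 0 (R + ε) := fun u hu =>
    Metric.closedBall_subset_closedBall (by linarith) (hR u ⟨hu.1, hu.2.le.trans (hs.2.trans ht.2)⟩)
  have hin2 : ∀ u ∈ Ico 0 s, η u ∈ Metric.closedBall 0 (R + ε) := fun u hu => by
    have h1 := hR u ⟨hu.1, hu.2.le.trans (hs.2.trans ht.2)⟩
    have h2 := hs2 u hu
    rw [Metric.mem_closedBall] at h1 ⊢
    linarith [dist_triangle (η u) (γ u) 0]
  have := dist_le_of_trajectories_ODE_of_mem (v := fun _ => X) (K := K)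
    (s := fun _ => Metric.closedBall 0 (R + ε)) (fun _ _ => hK)
    (hcη.mono (Icc_subset_Icc_right hs.2)) (fun u hu => hη.hasDerivWithinAt hu.1) hin2
    (hcγ.mono (Icc_subset_Icc_right hs.2)) (fun u hu => h.hasDerivWithinAt hu.1) hin1
    le_rfl s ⟨hs.1.le, le_rfl⟩
  simp only [sub_zero] at this
  have h3 : Real.exp (K * s) ≤ Real.exp (K * T) := Real.exp_le_exp.2
    (mul_le_mul_of_nonneg_left (hs.2.trans ht.2) K.2)
  have h4 : dist (η 0) (γ 0) * Real.exp (K * s) < ε * Real.exp (-(K * T)) * Real.exp (K * T) :=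
    mul_lt_mul h0 h3 (Real.exp_pos _) (by positivity)
  rw [mul_assoc, ← Real.exp_add, neg_add_cancel, Real.exp_zero, mul_one] at h4
  linarith

end PlanarODE

namespace Stommel
open PlanarODE

/-! ### Elementary facts about the field -/

/-- The parameters of the problem: `A > 1`, `δ > 0`, and the equilibrium lies on the repelling
branch, `(1 + A) / (2 A) < l < 1`. -/
structure Params (A δ l : ℝ) : Prop where
  hA : 1 < A
  hδ : 0 < δ
  hl : 1 + A < 2 * A * l
  hl1 : l < 1

theorem Params.l_pos {A δ l : ℝ} (P : Params A δ l) : 0 < l := by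
  have := P.hA; have := P.hl
  by_contra! h
  nlinarith

theorem Params.one_lt {A δ l : ℝ} (P : Params A δ l) : 1 < A * l := by
  linarith [P.hA, P.hl]

theorem F_left {A y : ℝ} (hy : y ≤ 1) : F A y = (1 + A) * y - A * y ^ 2 := by
  rw [F, abs_of_nonneg (by linarith)]; ring

theorem F_right {A y : ℝ} (hy : 1 ≤ y) : F A y = (1 - A) * y + A * y ^ 2 := by
  rw [F, abs_of_nonpos (by linarith)]; ring

theorem field_eq (A δ l : ℝ) (p : ℝ × ℝ) : field A δ l p = (p.2 - F A p.1, δ * (l - p.1)) := by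
  simp only [field, F]; congr 1; ring

theorem lipschitzOnBalls_field (A δ l : ℝ) : LipschitzOnBalls (field A δ l) := by
  intro R
  set R' := max R 0
  set K : ℝ := 2 + |A| * (1 + 2 * R') + |δ| with hK
  have hK0 : 0 ≤ K := by have : 0 ≤ R' := le_max_right _ _; positivity
  refine ⟨K.toNNReal, LipschitzOnWith.of_dist_le_mul fun p hp q hq => ?_⟩
  rw [Real.coe_toNNReal _ hK0]
  rw [mem_closedBall_zero_iff, Prod.norm_def, max_le_iff] at hp hq
  have hR : R ≤ R' := le_max_left _ _
  have hp1 : |p.1| ≤ R' := hp.1.trans hR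
  have hq1 : |q.1| ≤ R' := hq.1.trans hR
  have hR0 : 0 ≤ R' := le_max_right _ _
  simp only [Prod.dist_eq, Real.dist_eq, field]
  set D := max |p.1 - q.1| |p.2 - q.2|
  have hD1 : |p.1 - q.1| ≤ D := le_max_left _ _
  have hD2 : |p.2 - q.2| ≤ D := le_max_right _ _
  have hD0 : 0 ≤ D := (abs_nonneg _).trans hD1
  have e1 : |(|1 - p.1| * p.1 - |1 - q.1| * q.1)| ≤ (1 + 2 * R') * D := by
    have : |1 - p.1| * p.1 - |1 - q.1| * q.1
        = |1 - p.1| * (p.1 - q.1) + (|1 - p.1| - |1 - q.1|) * q.1 := by ring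
    rw [this]
    have h1 : |1 - p.1| ≤ 1 + R' := by
      have := abs_sub (1 : ℝ) p.1; simp only [abs_one] at this; linarith
    have h2 : |(|1 - p.1| - |1 - q.1|)| ≤ D := by
      refine (abs_abs_sub_abs_le _ _).trans ?_
      have : 1 - p.1 - (1 - q.1) = -(p.1 - q.1) := by ring
      rw [this, abs_neg]; exact hD1
    refine (abs_add_le _ _).trans ?_
    rw [abs_mul, abs_mul, abs_abs]
    have h3 := mul_le_mul h1 hD1 (abs_nonneg _) (by linarith)
    have h4 := mul_le_mul h2 hq1 (abs_nonneg _) hD0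
    linarith
  refine max_le ?_ ?_
  · have : p.2 - p.1 - A * |1 - p.1| * p.1 - (q.2 - q.1 - A * |1 - q.1| * q.1)
        = (p.2 - q.2) - (p.1 - q.1) - A * (|1 - p.1| * p.1 - |1 - q.1| * q.1) := by ring
    rw [this]
    have h1 := abs_sub (p.2 - q.2 - (p.1 - q.1)) (A * (|1 - p.1| * p.1 - |1 - q.1| * q.1))
    have h2 := abs_sub (p.2 - q.2) (p.1 - q.1)
    rw [abs_mul] at h1
    have h3 := mul_le_mul_of_nonneg_left e1 (abs_nonneg A)
    have h4 : 0 ≤ |δ| * D := by positivity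
    rw [hK]; linarith
  · have : δ * (l - p.1) - δ * (l - q.1) = -(δ * (p.1 - q.1)) := by ring
    rw [this, abs_neg, abs_mul]
    have h3 := mul_le_mul_of_nonneg_left hD1 (abs_nonneg δ)
    have h4 : 0 ≤ |A| * (1 + 2 * R') * D := by positivity
    rw [hK]; linarith

/-- A forward solution of the system, given by its two components. -/
abbrev Sol (A δ l : ℝ) (y m : ℝ → ℝ) : Prop :=
  IsForwardSolution (field A δ l) (fun t => (y t, m t))

variable {A δ l : ℝ} {y m : ℝ → ℝ}

theorem hasDerivWithinAt_of_prod {γ : ℝ → ℝ × ℝ} {s : Set ℝ} {t : ℝ}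
    (h : HasDerivWithinAt γ (field A δ l (γ t)) s t) :
    HasDerivWithinAt (fun t => (γ t).1) ((γ t).2 - F A (γ t).1) s t ∧
    HasDerivWithinAt (fun t => (γ t).2) (δ * (l - (γ t).1)) s t := by
  rw [field_eq] at h
  exact ⟨(hasFDerivWithinAt_iff_hasDerivWithinAt.1 h.hasFDerivWithinAt.fst).congr_deriv (by simp),
    (hasFDerivWithinAt_iff_hasDerivWithinAt.1 h.hasFDerivWithinAt.snd).congr_deriv (by simp)⟩

namespace Sol

theorem shift (h : Sol A δ l y m) {a : ℝ} (ha : 0 ≤ a) :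
    Sol A δ l (fun t => y (t + a)) (fun t => m (t + a)) := IsForwardSolution.shift h ha

theorem dy (h : Sol A δ l y m) {t : ℝ} (ht : 0 ≤ t) :
    HasDerivWithinAt y (m t - F A (y t)) (Ici t) t :=
  (hasDerivWithinAt_of_prod (IsForwardSolution.hasDerivWithinAt h ht)).1

theorem dm (h : Sol A δ l y m) {t : ℝ} (ht : 0 ≤ t) :
    HasDerivWithinAt m (δ * (l - y t)) (Ici t) t :=
  (hasDerivWithinAt_of_prod (IsForwardSolution.hasDerivWithinAt h ht)).2

theorem cy (h : Sol A δ l y m) {a b : ℝ} (ha : 0 ≤ a) : ContinuousOn y (Icc a b) :=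
  (continuous_fst.comp_continuousOn h.continuousOn).mono
    (Icc_subset_Ici_self.trans (Ici_subset_Ici.2 ha))

theorem cm (h : Sol A δ l y m) {a b : ℝ} (ha : 0 ≤ a) : ContinuousOn m (Icc a b) :=
  (continuous_snd.comp_continuousOn h.continuousOn).mono
    (Icc_subset_Ici_self.trans (Ici_subset_Ici.2 ha))

/-- The derivative of a quadratic function of the state along a solution. -/
theorem deriv_quad (h : Sol A δ l y m) {t : ℝ} (ht : 0 ≤ t) (a b c d e f : ℝ) :
    HasDerivWithinAt
      (fun t => a * y t ^ 2 + b * (y t * m t) + c * m t ^ 2 + d * y t + e * m t + f)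
      ((2 * a * y t + b * m t + d) * (m t - F A (y t))
        + (b * y t + 2 * c * m t + e) * (δ * (l - y t))) (Ici t) t := by
  have h1 := h.dy ht
  have h2 := h.dm ht
  have := ((((((h1.fun_pow 2).const_mul a).fun_add ((h1.fun_mul h2).const_mul b)).fun_add
    ((h2.fun_pow 2).const_mul c)).fun_add (h1.const_mul d)).fun_add (h2.const_mul e)).add_const f
  exact this.congr_deriv (by push_cast; ring)

theorem cont_quad (h : Sol A δ l y m) {t₀ t₁ : ℝ} (ht : 0 ≤ t₀) (a b c d e f : ℝ) :
    ContinuousOn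
      (fun t => a * y t ^ 2 + b * (y t * m t) + c * m t ^ 2 + d * y t + e * m t + f)
      (Icc t₀ t₁) := by
  have h1 := h.cy (b := t₁) ht
  have h2 := h.cm (b := t₁) ht
  fun_prop

/-- A quadratic function of the state that is nonincreasing wherever it is positive stays
nonpositive. -/
theorem barrier (h : Sol A δ l y m) (a b c d e f : ℝ) {t₀ t₁ : ℝ} (ht : 0 ≤ t₀)
    (h0 : a * y t₀ ^ 2 + b * (y t₀ * m t₀) + c * m t₀ ^ 2 + d * y t₀ + e * m t₀ + f ≤ 0)
    (hb : ∀ t ∈ Ico t₀ t₁,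
      0 < a * y t ^ 2 + b * (y t * m t) + c * m t ^ 2 + d * y t + e * m t + f →
      (2 * a * y t + b * m t + d) * (m t - F A (y t))
        + (b * y t + 2 * c * m t + e) * (δ * (l - y t)) ≤ 0) :
    ∀ t ∈ Icc t₀ t₁, a * y t ^ 2 + b * (y t * m t) + c * m t ^ 2 + d * y t + e * m t + f ≤ 0 :=
  nonpos_of_deriv_nonpos_of_pos (h.cont_quad ht a b c d e f)
    (fun _ ht' => h.deriv_quad (ht.trans ht'.1) a b c d e f) h0 hb

/-- A quadratic function of the state that is decreasing wherever it vanishes stays nonpositive. -/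
theorem barrier' (h : Sol A δ l y m) (a b c d e f : ℝ) {t₀ t₁ : ℝ} (ht : 0 ≤ t₀)
    (h0 : a * y t₀ ^ 2 + b * (y t₀ * m t₀) + c * m t₀ ^ 2 + d * y t₀ + e * m t₀ + f ≤ 0)
    (hb : ∀ t ∈ Ico t₀ t₁,
      a * y t ^ 2 + b * (y t * m t) + c * m t ^ 2 + d * y t + e * m t + f = 0 →
      (2 * a * y t + b * m t + d) * (m t - F A (y t))
        + (b * y t + 2 * c * m t + e) * (δ * (l - y t)) < 0) :
    ∀ t ∈ Icc t₀ t₁, a * y t ^ 2 + b * (y t * m t) + c * m t ^ 2 + d * y t + e * m t + f ≤ 0 :=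
  nonpos_of_deriv_neg_of_eq_zero (h.cont_quad ht a b c d e f)
    (fun _ ht' => h.deriv_quad (ht.trans ht'.1) a b c d e f) h0 hb

end Sol

theorem field_eq_zero_iff (P : Params A δ l) (p : ℝ × ℝ) :
    field A δ l p = 0 ↔ p = (l, F A l) := by
  rw [field_eq, Prod.ext_iff, Prod.ext_iff]
  simp only [Prod.fst_zero, Prod.snd_zero, mul_eq_zero, P.hδ.ne', false_or, sub_eq_zero]
  constructor
  · rintro ⟨h1, h2⟩; exact ⟨h2.symm, by rw [h1, ← h2]⟩
  · rintro ⟨h1, h2⟩; exact ⟨by rw [h2, h1], h1.symm⟩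

/-- The energy `δ (y - l)² + (μ - F l)²` grows at most exponentially, so that solutions exist for
all forward time. -/
theorem exists_sol (P : Params A δ l) (p : ℝ × ℝ) :
    ∃ γ, IsForwardSolution (field A δ l) γ ∧ γ 0 = p := by
  have hA := P.hA
  have hδ := P.hδ
  have hl1 := P.hl1
  have hAl := P.one_lt
  refine exists_isForwardSolution (lipschitzOnBalls_field A δ l) p fun T hT => ?_
  set E : ℝ × ℝ → ℝ := fun q => δ * (q.1 - l) ^ 2 + (q.2 - F A l) ^ 2 with hE
  set B : ℝ := E p * Real.exp (4 * A * T) with hB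
  have hE0 : 0 ≤ E p := by positivity
  refine ⟨1 + |l| + |F A l| + (B / δ + 1) + (B + 1), fun S γ hS hST h0 hc hd => ?_⟩
  have key : ∀ q : ℝ × ℝ, -2 * δ * (q.1 - l) * (F A q.1 - F A l) ≤ 4 * A * E q := by
    intro q
    have h1 : -(q.1 - l) * (F A q.1 - F A l) ≤ 2 * A * (q.1 - l) ^ 2 := by
      rw [F_left hl1.le]
      rcases le_total q.1 1 with hq | hq
      · rw [F_left hq]
        have : 0 ≤ (q.1 - l) ^ 2 * (1 + A + A * (2 - q.1 - l)) :=
          mul_nonneg (sq_nonneg _) (by nlinarith)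
        nlinarith
      · rw [F_right hq]
        have e : -(q.1 - l) * ((1 - A) * q.1 + A * q.1 ^ 2 - ((1 + A) * l - A * l ^ 2))
          = -((q.1 - l) * (q.1 - 1) * (1 + A * q.1)) + (q.1 - l) * (1 - l) * (A * l - 1) := by
          ring
        rw [e]
        have h1 : 0 ≤ (q.1 - l) * (q.1 - 1) * (1 + A * q.1) := by
          have : 0 ≤ 1 + A * q.1 := by nlinarith
          exact mul_nonneg (mul_nonneg (by linarith) (by linarith)) this
        have h2 : (q.1 - l) * (1 - l) * (A * l - 1) ≤ (q.1 - l) * (q.1 - l) * A :=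
          mul_le_mul (mul_le_mul_of_nonneg_left (by linarith) (by linarith)) (by nlinarith)
            (by linarith) (mul_nonneg (by linarith) (by linarith))
        nlinarith [sq_nonneg (q.1 - l)]
    have h2 : 0 ≤ (q.2 - F A l) ^ 2 := sq_nonneg _
    simp only [hE]
    nlinarith
  have hmono := le_left_of_deriv_nonpos (a := 0) (b := S)
    (g := fun t => E (γ t) * Real.exp (-(4 * A) * t))
    (g' := fun t => (-2 * δ * ((γ t).1 - l) * (F A (γ t).1 - F A l) - 4 * A * E (γ t))
      * Real.exp (-(4 * A) * t))
    (by
      have h1 : ContinuousOn (fun t => (γ t).1) (Icc 0 S) := continuous_fst.comp_continuousOn hc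
      have h2 : ContinuousOn (fun t => (γ t).2) (Icc 0 S) := continuous_snd.comp_continuousOn hc
      simp only [hE]
      fun_prop)
    (fun t ht => by
      obtain ⟨h1, h2⟩ := hasDerivWithinAt_of_prod (hd t ht)
      have h3 := (((h1.sub_const l).fun_pow 2).const_mul δ).fun_add ((h2.sub_const (F A l)).fun_pow 2)
      have h4 : HasDerivWithinAt (fun t => Real.exp (-(4 * A) * t))
          (Real.exp (-(4 * A) * t) * (-(4 * A) * 1)) (Ici t) t :=
        (((hasDerivAt_id t).const_mul (-(4 * A))).exp).hasDerivWithinAt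
      exact (h3.fun_mul h4).congr_deriv (by simp only [hE]; push_cast; ring))
    (fun t ht => mul_nonpos_of_nonpos_of_nonneg (by linarith [key (γ t)]) (Real.exp_pos _).le)
    S ⟨hS, le_rfl⟩
  simp only [h0, mul_zero, Real.exp_zero, mul_one] at hmono
  have hES : E (γ S) ≤ B := by
    have h1 : E (γ S) ≤ E p * Real.exp (4 * A * S) := by
      have h2 := mul_le_mul_of_nonneg_right hmono (Real.exp_pos (4 * A * S)).le
      rwa [mul_assoc, ← Real.exp_add, show -(4 * A) * S + 4 * A * S = 0 by ring, Real.exp_zero,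
        mul_one] at h2
    refine h1.trans (mul_le_mul_of_nonneg_left (Real.exp_le_exp.2 ?_) hE0)
    exact mul_le_mul_of_nonneg_left hST (by linarith)
  have hB0 : 0 ≤ B := by positivity
  have sq_bd : ∀ x b : ℝ, x ^ 2 ≤ b → |x| ≤ b + 1 := fun x b hx => by
    rw [abs_le]; constructor <;> nlinarith
  have h1 : |(γ S).1 - l| ≤ B / δ + 1 := sq_bd _ _ (by
    rw [le_div_iff₀ hδ]
    simp only [hE] at hES
    nlinarith [sq_nonneg ((γ S).2 - F A l)])
  have h2 : |(γ S).2 - F A l| ≤ B + 1 := sq_bd _ _ (by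
    simp only [hE] at hES
    nlinarith [sq_nonneg ((γ S).1 - l)])
  have h3 : |(γ S).1| ≤ |l| + |(γ S).1 - l| := by
    have := abs_add_le l ((γ S).1 - l); rwa [add_sub_cancel] at this
  have h4 : |(γ S).2| ≤ |F A l| + |(γ S).2 - F A l| := by
    have := abs_add_le (F A l) ((γ S).2 - F A l); rwa [add_sub_cancel] at this
  have h5 : 0 ≤ B / δ := by positivity
  rw [Prod.norm_def, max_lt_iff, Real.norm_eq_abs, Real.norm_eq_abs]
  constructor <;> linarith [abs_nonneg l, abs_nonneg (F A l)]

end Stommel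

namespace Stommel
open PlanarODE

variable {A δ l : ℝ} {y m : ℝ → ℝ}

/-! ### Monotonicity along solutions, and the way to the line `y = l` -/

theorem exists_lt_of_deriv_neg {f : ℝ → ℝ} {a c : ℝ} (hd : HasDerivWithinAt f c (Ici a) a)
    (hc : c < 0) : ∃ b > a, ∀ t ∈ Ioc a b, f t < f a := by
  have := hasDerivWithinAt_iff_tendsto_slope.1 hd
  rw [Ici_sdiff_left] at this
  have h1 := this.eventually (Iio_mem_nhds hc)
  obtain ⟨u, hu, hu'⟩ := (mem_nhdsGT_iff_exists_Ioc_subset).1 h1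
  refine ⟨u, hu, fun t ht => ?_⟩
  have h2 : slope f a t < 0 := hu' ht
  rw [slope_def_field, div_neg_iff] at h2
  rcases h2 with h2 | h2
  · linarith [ht.1]
  · linarith [h2.1]

theorem exists_gt_of_deriv_pos {f : ℝ → ℝ} {a c : ℝ} (hd : HasDerivWithinAt f c (Ici a) a)
    (hc : 0 < c) : ∃ b > a, ∀ t ∈ Ioc a b, f a < f t := by
  obtain ⟨b, hb, h⟩ := exists_lt_of_deriv_neg hd.fun_neg (by linarith)
  exact ⟨b, hb, fun t ht => by linarith [h t ht]⟩

theorem F_l (P : Params A δ l) : F A l = 1 + (1 - l) * (A * l - 1) := by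
  rw [F_left P.hl1.le]; ring

theorem F_eq_of_le {A y : ℝ} (hy : y ≤ 1) : F A y = 1 + (1 - y) * (A * y - 1) := by
  rw [F_left hy]; ring

theorem F_eq_of_ge {A y : ℝ} (hy : 1 ≤ y) : F A y = 1 + (y - 1) * (1 + A * y) := by
  rw [F_right hy]; ring

/-- Where `y ≥ l`, the variable `μ` does not increase. -/
theorem Sol.m_le (h : Sol A δ l y m) (P : Params A δ l) {a b : ℝ} (ha : 0 ≤ a)
    (hy : ∀ t ∈ Ico a b, l ≤ y t) : ∀ t ∈ Icc a b, m t ≤ m a :=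
  le_left_of_deriv_nonpos (h.cm ha) (fun _ ht => h.dm (ha.trans ht.1))
    (fun t ht => mul_nonpos_of_nonneg_of_nonpos P.hδ.le (by linarith [hy t ht]))

/-- Where `y ≤ l`, the variable `μ` does not decrease. -/
theorem Sol.le_m (h : Sol A δ l y m) (P : Params A δ l) {a b : ℝ} (ha : 0 ≤ a)
    (hy : ∀ t ∈ Ico a b, y t ≤ l) : ∀ t ∈ Icc a b, m a ≤ m t := fun t ht => by
  have := add_mul_le_of_le_deriv (c := 0) (h.cm ha) (fun _ ht => h.dm (ha.trans ht.1))
    (fun t ht => mul_nonneg P.hδ.le (by linarith [hy t ht])) t ht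
  linarith

/-- A solution that starts at `y = 1` at or below the corner stays in `y ≤ 1`, `μ ≤ 1` as long as
`y ≥ l`. -/
theorem Sol.le_one_of_exit (h : Sol A δ l y m) (P : Params A δ l) (h0 : y 0 = 1) (h0' : m 0 ≤ 1)
    {b : ℝ} (hy : ∀ t ∈ Ico 0 b, l ≤ y t) : ∀ t ∈ Icc 0 b, y t ≤ 1 ∧ m t ≤ 1 := by
  have hm : ∀ t ∈ Icc 0 b, m t ≤ 1 := fun t ht => (h.m_le P le_rfl hy t ht).trans h0'
  intro t ht
  refine ⟨?_, hm t ht⟩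
  have := h.barrier 0 0 0 1 0 (-1) (t₁ := b) le_rfl (by simp [h0]) (fun t ht hp => by
    have h1 : 1 ≤ y t := by linarith
    have h2 := hm t ⟨ht.1, ht.2.le⟩
    rw [F_eq_of_ge h1]
    have := P.hA
    have : 0 ≤ (y t - 1) * (1 + A * y t) := mul_nonneg (by linarith) (by nlinarith)
    linarith) t ht
  linarith

/-- In the strip `l ≤ y ≤ 1` the quantity `(1 - μ)² - 2 δ (1 - l) (1 - y)` does not increase. This
bounds the drop of `μ` during the jump from the corner. -/
theorem Sol.strip_bound (h : Sol A δ l y m) (P : Params A δ l) (h0 : y 0 = 1) (h0' : m 0 ≤ 1)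
    {b : ℝ} (hy : ∀ t ∈ Ico 0 b, l ≤ y t) :
    ∀ t ∈ Icc 0 b, (1 - m t) ^ 2 ≤ (1 - m 0) ^ 2 + 2 * δ * (1 - l) * (1 - y t) := by
  have h1 := h.le_one_of_exit P h0 h0' hy
  intro t ht
  have := h.barrier 0 0 1 (2 * δ * (1 - l)) (-2) (1 - (1 - m 0) ^ 2 - 2 * δ * (1 - l)) (t₁ := b)
    le_rfl (by rw [h0]; nlinarith) (fun t ht hp => by
      obtain ⟨h2, h3⟩ := h1 t ⟨ht.1, ht.2.le⟩
      have h4 := hy t ht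
      rw [F_eq_of_le h2]
      have hδ := P.hδ
      have h5 : 1 < A * y t := by nlinarith [P.one_lt, P.hA]
      have e1 : 0 ≤ δ * ((1 - m t) * (1 - y t)) :=
        mul_nonneg hδ.le (mul_nonneg (by linarith) (by linarith))
      have e2 : 0 ≤ δ * ((1 - l) * ((1 - y t) * (A * y t - 1))) :=
        mul_nonneg hδ.le (mul_nonneg (by linarith) (mul_nonneg (by linarith) (by linarith)))
      nlinarith) t ht
  nlinarith

/-- The jump from the corner reaches the line `y = l`. -/
theorem Sol.exists_reach_l (h : Sol A δ l y m) (P : Params A δ l) (h0 : y 0 = 1) (h0' : m 0 ≤ 1) :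
    ∃ t > 0, y t = l ∧ ∀ s ∈ Ico 0 t, l < y s := by
  have hl1 := P.hl1
  have hδ := P.hδ
  suffices hs : ∃ b ≥ 0, y b ≤ l by
    obtain ⟨b, hb0, hb⟩ := hs
    obtain ⟨t, ht, h1, h2⟩ := exists_first_le hb0 (h.cy le_rfl) (by rw [h0]; exact hl1) hb
    exact ⟨t, ht.1, h1, h2⟩
  by_contra! hcon
  have hy : ∀ t : ℝ, 0 ≤ t → l < y t := hcon
  have hle : ∀ t, 0 ≤ t → y t ≤ 1 ∧ m t ≤ 1 := fun t ht =>
    h.le_one_of_exit P h0 h0' (b := t) (fun s hs => (hy s hs.1).le) t ⟨ht, le_rfl⟩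
  -- `μ` decreases strictly
  have hm1 : m 1 < 1 := by
    by_contra! hm1
    have hmc : ∀ t ∈ Icc (0:ℝ) 1, m t = 1 := fun t ht => by
      have h1 := h.m_le P ht.1 (b := 1) (fun s hs => (hy s (ht.1.trans hs.1)).le) 1 ⟨ht.2, le_rfl⟩
      linarith [(hle t ht.1).2]
    have hd := h.dm (t := 0) le_rfl
    have hd' : HasDerivWithinAt m 0 (Ici 0) 0 := by
      refine (hasDerivWithinAt_const (0:ℝ) (Ici 0) (1:ℝ)).congr_of_eventuallyEq ?_ (hmc 0 (by simp))
      filter_upwards [Icc_mem_nhdsGE (show (0:ℝ) < 1 by norm_num)] with t ht using hmc t ht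
    have := (uniqueDiffOn_Ici (0:ℝ) 0 self_mem_Ici).eq_deriv _ hd hd'
    rw [h0] at this
    nlinarith
  set c := 1 - m 1 with hc
  have hcm : ∀ t, 1 ≤ t → m t ≤ 1 - c := fun t ht => by
    have := h.m_le P (a := 1) (b := t) zero_le_one (fun s hs => (hy s (zero_le_one.trans hs.1)).le)
      t ⟨ht, le_rfl⟩
    linarith
  have hbd := le_add_mul_of_deriv_le (c := -c) (a := 1) (b := 1 + 1 / c) (h.cy zero_le_one)
    (fun _ ht => h.dy (zero_le_one.trans ht.1)) (fun t ht => by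
      have h1 := hcm t ht.1
      have h2 := (hle t (zero_le_one.trans ht.1)).1
      have h3 := hy t (zero_le_one.trans ht.1)
      rw [F_eq_of_le h2]
      have h5 : 1 < A * y t := by nlinarith [P.one_lt, P.hA]
      have : 0 ≤ (1 - y t) * (A * y t - 1) := mul_nonneg (by linarith) (by linarith)
      linarith) (1 + 1 / c) ⟨by have : 0 < 1 / c := by rw [hc]; exact div_pos one_pos (by linarith)
                                linarith, le_rfl⟩
  have hc0 : 0 < c := by linarith
  have h6 : -c * (1 + 1 / c - 1) = -1 := by field_simp; ring
  rw [h6] at hbd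
  have h7 := hy (1 + 1 / c) (by positivity)
  have h8 := (hle 1 zero_le_one).1
  linarith [P.l_pos]

/-- The passage through `y < l` comes back to `y = l`. -/
theorem Sol.exists_return_l (h : Sol A δ l y m) (P : Params A δ l) (h0 : y 0 = l)
    (h0' : m 0 < F A l) : ∃ t > 0, y t = l ∧ ∀ s ∈ Ioo 0 t, y s < l := by
  have hl1 := P.hl1
  have hδ := P.hδ
  have hA := P.hA
  have hl := P.hl
  -- `y` decreases at first
  obtain ⟨a, ha, hay⟩ : ∃ a > 0, ∀ t ∈ Ioc 0 a, y t < l := by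
    have hd := h.dy (t := 0) le_rfl
    rw [h0] at hd
    simpa [h0] using exists_lt_of_deriv_neg hd (by linarith)
  suffices hs : ∃ b ≥ a, l ≤ y b by
    obtain ⟨b, hb0, hb⟩ := hs
    obtain ⟨t, ht, h1, h2⟩ := exists_first_ge hb0 (h.cy ha.le) (hay a ⟨ha, le_rfl⟩) hb
    refine ⟨t, ha.trans ht.1, h1, fun s hs => ?_⟩
    rcases le_total s a with hsa | hsa
    · exact hay s ⟨hs.1, hsa⟩
    · exact h2 s ⟨hsa, hs.2⟩
  by_contra! hcon
  have hF : ∀ y, y ≤ l → F A y - F A l = -(2 * A * l - 1 - A) * (y - l) - A * (y - l) ^ 2 :=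
    fun y hy => by rw [F_left (hy.trans hl1.le), F_left hl1.le]; ring
  set τ := 2 * A * l - 1 - A with hτ
  have hτ0 : 0 < τ := by linarith
  have hml : ∀ t, a ≤ t → ∀ u, t ≤ u → m t ≤ m u := fun t ht u hu =>
    h.le_m P (ha.le.trans ht) (fun s hs => (hcon s (ht.trans hs.1)).le) u ⟨hu, le_rfl⟩
  -- `μ` exceeds `F l` eventually
  obtain ⟨t₁, ht₁, hm₁⟩ : ∃ t₁ ≥ a, F A l < m t₁ := by
    by_contra! hle
    set c := min (l - y a) (τ / (2 * A)) with hc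
    have hc0 : 0 < c := lt_min (by linarith [hcon a le_rfl]) (by positivity)
    have hyc : ∀ b, a ≤ b → y b - l + c ≤ 0 := fun b hb => by
      have := h.barrier' 0 0 0 1 0 (-l + c) (t₀ := a) (t₁ := b) ha.le
        (by linarith [min_le_left (l - y a) (τ / (2 * A))]) (fun t ht hz => by
          have h1 := hcon t ht.1
          have h2 := hle t ht.1
          have h3 := hF (y t) h1.le
          have h4 : y t - l = -c := by linarith
          rw [h4] at h3
          have h5 : A * c ≤ τ / 2 := by
            have := min_le_right (l - y a) (τ / (2 * A))
            rw [← hc, le_div_iff₀ (by positivity)] at this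
            linarith
          nlinarith) b ⟨hb, le_rfl⟩
      linarith
    obtain ⟨n, hn⟩ := exists_nat_gt ((F A l - m a) / (δ * c))
    have hg := add_mul_le_of_le_deriv (c := δ * c) (a := a) (b := a + n) (h.cm ha.le)
      (fun _ ht => h.dm (ha.le.trans ht.1)) (fun t ht =>
        mul_le_mul_of_nonneg_left (by linarith [hyc t ht.1]) hδ.le) (a + n)
        ⟨by linarith [n.cast_nonneg (α := ℝ)], le_rfl⟩
    rw [div_lt_iff₀ (by positivity)] at hn
    have := hle (a + n) (by linarith [n.cast_nonneg (α := ℝ)])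
    nlinarith
  set c := m t₁ - F A l with hc
  have hc0 : 0 < c := by linarith
  -- if `y` is close to `l`, or `μ` is large, then `y` reaches `l`
  have hreach : ∀ t₂ ≥ t₁, ∀ k > 0, ¬ (∀ t ≥ t₂, k ≤ m t - F A (y t)) := fun t₂ ht₂ k hk hall => by
    have ht₂0 : 0 ≤ t₂ := ha.le.trans (ht₁.trans ht₂)
    obtain ⟨n, hn⟩ := exists_nat_gt ((l - y t₂) / k)
    have hg := add_mul_le_of_le_deriv (c := k) (a := t₂) (b := t₂ + n) (h.cy ht₂0)
      (fun _ ht => h.dy (ht₂0.trans ht.1)) (fun t ht => hall t ht.1) (t₂ + n)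
        ⟨by linarith [n.cast_nonneg (α := ℝ)], le_rfl⟩
    rw [div_lt_iff₀ hk] at hn
    have := hcon (t₂ + n) (by linarith [n.cast_nonneg (α := ℝ)])
    nlinarith
  set c₃ := c / (2 * τ) with hc₃
  have hc₃0 : 0 < c₃ := by positivity
  have hτc : τ * c₃ = c / 2 := by rw [hc₃]; field_simp
  have hNlow : ∀ t ≥ t₁, l - c₃ ≤ y t → c / 2 ≤ m t - F A (y t) := fun t ht hy => by
    have h1 := hcon t (ht₁.trans ht)
    have h2 := hF (y t) h1.le
    have h3 := hml t₁ ht₁ t ht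
    nlinarith [sq_nonneg (y t - l), mul_nonneg hτ0.le (show 0 ≤ y t - l + c₃ by linarith)]
  by_cases hnear : ∃ t₂ ≥ t₁, l - c₃ ≤ y t₂
  · obtain ⟨t₂, ht₂, hy₂⟩ := hnear
    refine hreach t₂ ht₂ (c / 2) (by positivity) fun t ht => hNlow t (ht₂.trans ht) ?_
    have := h.barrier' 0 0 0 (-1) 0 (l - c₃) (t₀ := t₂) (t₁ := t) (ha.le.trans (ht₁.trans ht₂))
      (by linarith) (fun t ht hz => by
        have := hNlow t (ht₂.trans ht.1) (by linarith)
        linarith) t ⟨ht, le_rfl⟩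
    linarith
  · push Not at hnear
    -- otherwise `μ` grows beyond any bound
    obtain ⟨t₂, ht₂, hm₂⟩ : ∃ t₂ ≥ t₁, F A l + τ ^ 2 / A + 1 ≤ m t₂ := by
      have ht₁0 : 0 ≤ t₁ := ha.le.trans ht₁
      obtain ⟨n, hn⟩ := exists_nat_gt ((F A l + τ ^ 2 / A + 1 - m t₁) / (δ * c₃))
      have hg := add_mul_le_of_le_deriv (c := δ * c₃) (a := t₁) (b := t₁ + n) (h.cm ht₁0)
        (fun _ ht => h.dm (ht₁0.trans ht.1)) (fun t ht =>
          mul_le_mul_of_nonneg_left (by linarith [hnear t ht.1]) hδ.le) (t₁ + n)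
          ⟨by linarith [n.cast_nonneg (α := ℝ)], le_rfl⟩
      rw [div_lt_iff₀ (by positivity)] at hn
      exact ⟨t₁ + n, by linarith [n.cast_nonneg (α := ℝ)], by nlinarith⟩
    refine hreach t₂ ht₂ 1 one_pos fun t ht => ?_
    have h1 := hcon t (ht₁.trans (ht₂.trans ht))
    have h2 := hF (y t) h1.le
    have h3 := hml t₂ (ht₁.trans ht₂) t ht
    have h4 : -(τ ^ 2 / A) ≤ τ * (y t - l) + A * (y t - l) ^ 2 := by
      have : τ * (y t - l) + A * (y t - l) ^ 2 + τ ^ 2 / A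
        = A * ((y t - l) + τ / (2 * A)) ^ 2 + 3 * τ ^ 2 / (4 * A) := by field_simp; ring
      have h5 : 0 ≤ A * ((y t - l) + τ / (2 * A)) ^ 2 + 3 * τ ^ 2 / (4 * A) := by positivity
      linarith
    linarith

end Stommel

namespace Stommel
open PlanarODE

variable {A δ l : ℝ} {y m : ℝ → ℝ}

theorem exists_forall_Icc_lt {f : ℝ → ℝ} {a b c : ℝ} (hab : a < b) (hf : ContinuousOn f (Icc a b))
    (hb : f b < c) : ∃ d ∈ Ioo a b, ∀ t ∈ Icc d b, f t < c := by
  have hev := (hf b ⟨hab.le, le_rfl⟩).eventually_lt_const hb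
  rw [nhdsWithin_Icc_eq_nhdsLE hab] at hev
  obtain ⟨d, hd, hd'⟩ := mem_nhdsLE_iff_exists_Icc_subset.1 hev
  refine ⟨max d ((a + b) / 2), ⟨lt_of_lt_of_le (by linarith) (le_max_right _ _),
    max_lt hd (by linarith)⟩, fun t ht => hd' ⟨(le_max_left _ _).trans ht.1, ht.2⟩⟩

theorem exists_forall_Icc_gt {f : ℝ → ℝ} {a b c : ℝ} (hab : a < b) (hf : ContinuousOn f (Icc a b))
    (hb : c < f b) : ∃ d ∈ Ioo a b, ∀ t ∈ Icc d b, c < f t := by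
  obtain ⟨d, hd, h⟩ := exists_forall_Icc_lt hab hf.neg (neg_lt_neg hb)
  exact ⟨d, hd, fun t ht => neg_lt_neg_iff.1 (h t ht)⟩

theorem Sol.cN (h : Sol A δ l y m) {a b : ℝ} (ha : 0 ≤ a) :
    ContinuousOn (fun t => m t - F A (y t)) (Icc a b) := by
  have h1 := h.cy (b := b) ha
  have h2 := h.cm (b := b) ha
  unfold F
  fun_prop

/-! ### The first integral of the degenerate left system -/

/-- For `2 A l = 1 + A` this is a first integral of the quadratic system that governs `y ≤ 1`; for
`2 A l > 1 + A` it increases along solutions. -/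
noncomputable def ham (A δ l : ℝ) (y m : ℝ) : ℝ :=
  Real.exp (2 * A / δ * (m - F A l)) * ((y - l) ^ 2 + (m - F A l) / A - δ / (2 * A ^ 2))

theorem Sol.deriv_ham (h : Sol A δ l y m) (P : Params A δ l) {t : ℝ} (ht : 0 ≤ t) (hy : y t ≤ 1) :
    HasDerivWithinAt (fun t => ham A δ l (y t) (m t))
      (2 * (2 * A * l - 1 - A) * (y t - l) ^ 2 * Real.exp (2 * A / δ * (m t - F A l)))
      (Ici t) t := by
  have hA : A ≠ 0 := by linarith [P.hA]
  have hδ := P.hδ.ne'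
  have h1 := h.dy ht
  have h2 := (h.dm ht).sub_const (F A l)
  have h3 := (((h1.sub_const l).fun_pow 2).fun_add (h2.div_const A)).sub_const (δ / (2 * A ^ 2))
  have h4 := ((h2.const_mul (2 * A / δ)).exp).fun_mul h3
  refine h4.congr_deriv ?_
  rw [F_left hy, F_left P.hl1.le]
  field_simp
  ring

theorem Sol.cont_ham (h : Sol A δ l y m) {a b : ℝ} (ha : 0 ≤ a) :
    ContinuousOn (fun t => ham A δ l (y t) (m t)) (Icc a b) := by
  have h1 := h.cy (b := b) ha
  have h2 := h.cm (b := b) ha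
  unfold ham
  fun_prop

theorem Sol.ham_le (h : Sol A δ l y m) (P : Params A δ l) {a b : ℝ} (ha : 0 ≤ a) (hab : a ≤ b)
    (hy : ∀ t ∈ Ico a b, y t ≤ 1) : ham A δ l (y a) (m a) ≤ ham A δ l (y b) (m b) := by
  have := add_mul_le_of_le_deriv (c := 0) (h.cont_ham ha (b := b))
    (fun t ht => h.deriv_ham P (ha.trans ht.1) (hy t ht)) (fun t ht => by
      have := P.hl
      have : 0 ≤ 2 * A * l - 1 - A := by linarith
      positivity) b ⟨hab, le_rfl⟩
  linarith

theorem Sol.ham_lt (h : Sol A δ l y m) (P : Params A δ l) {a b : ℝ} (ha : 0 ≤ a) (hab : a < b)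
    (hy : ∀ t ∈ Ico a b, y t ≤ 1) (hne : y a ≠ l) :
    ham A δ l (y a) (m a) < ham A δ l (y b) (m b) := by
  have h1 := h.deriv_ham P ha (hy a ⟨le_rfl, hab⟩)
  have hp : 0 < 2 * (2 * A * l - 1 - A) * (y a - l) ^ 2 * Real.exp (2 * A / δ * (m a - F A l)) := by
    have := P.hl
    have h2 : 0 < 2 * A * l - 1 - A := by linarith
    have h3 : y a - l ≠ 0 := sub_ne_zero.2 hne
    positivity
  obtain ⟨c, hc, hlt⟩ := exists_gt_of_deriv_pos h1 hp
  have h2 := hlt (min c b) ⟨lt_min hc hab, min_le_left _ _⟩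
  refine h2.trans_le ?_
  have hac : a ≤ min c b := (lt_min hc hab).le
  exact h.ham_le P (ha.trans hac) (min_le_right _ _) (fun t ht => hy t ⟨hac.trans ht.1, ht.2⟩)

/-- `e ^ x (1 - x)` is increasing for `x ≤ 0`. -/
theorem exp_mul_one_sub_le {a b : ℝ} (hab : a ≤ b) (hb : b ≤ 0) :
    Real.exp a * (1 - a) ≤ Real.exp b * (1 - b) := by
  have h1 : Real.exp a = Real.exp b * Real.exp (a - b) := by rw [← Real.exp_add]; ring_nf
  have h2 : Real.exp (a - b) * (1 + (b - a)) ≤ 1 := by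
    have h3 := Real.add_one_le_exp (b - a)
    have h4 : Real.exp (a - b) * Real.exp (b - a) = 1 := by rw [← Real.exp_add]; simp
    nlinarith [Real.exp_pos (a - b)]
  have h3 : Real.exp (a - b) * (1 - a) ≤ 1 - b := by
    have h5 : 0 ≤ Real.exp (a - b) := (Real.exp_pos _).le
    have h4 : (1 - a) ≤ (1 - b) * (1 + (b - a)) := by nlinarith [mul_nonneg (neg_nonneg.2 hb) (sub_nonneg.2 hab)]
    calc Real.exp (a - b) * (1 - a) ≤ Real.exp (a - b) * ((1 - b) * (1 + (b - a))) :=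
          mul_le_mul_of_nonneg_left h4 h5
      _ = (1 - b) * (Real.exp (a - b) * (1 + (b - a))) := by ring
      _ ≤ (1 - b) * 1 := mul_le_mul_of_nonneg_left h2 (by linarith)
      _ = 1 - b := mul_one _
  rw [h1, mul_assoc]
  exact mul_le_mul_of_nonneg_left h3 (Real.exp_pos _).le

/-- On a vertical line, `ham` decreases below the parabola `μ = F l - A (y - l)²`. -/
theorem ham_anti (P : Params A δ l) {y m m' : ℝ} (hm : m ≤ m')
    (hm' : m' ≤ F A l - A * (y - l) ^ 2) : ham A δ l y m' ≤ ham A δ l y m := by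
  have hA : 0 < A := by linarith [P.hA]
  have hδ := P.hδ
  have key : ∀ v, ham A δ l y v = -(δ / (2 * A ^ 2)) * Real.exp (-(2 * A ^ 2 / δ) * (y - l) ^ 2) *
      (Real.exp (2 * A / δ * (v - F A l + A * (y - l) ^ 2)) *
        (1 - 2 * A / δ * (v - F A l + A * (y - l) ^ 2))) := fun v => by
    have h1 : Real.exp (2 * A / δ * (v - F A l))
        = Real.exp (-(2 * A ^ 2 / δ) * (y - l) ^ 2) *
          Real.exp (2 * A / δ * (v - F A l + A * (y - l) ^ 2)) := by
      rw [← Real.exp_add]; congr 1; field_simp; ring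
    rw [ham, h1]; field_simp; ring
  have h2 := exp_mul_one_sub_le
    (a := 2 * A / δ * (m - F A l + A * (y - l) ^ 2)) (b := 2 * A / δ * (m' - F A l + A * (y - l) ^ 2))
    (mul_le_mul_of_nonneg_left (by linarith) (by positivity))
    (mul_nonpos_of_nonneg_of_nonpos (by positivity) (by linarith))
  rw [key, key]
  simp only [neg_mul, mul_assoc, neg_le_neg_iff]
  gcongr

/-- `ham` increases along the repelling branch. -/
theorem ham_F_le (P : Params A δ l) {y : ℝ} (hy : l ≤ y) (hy1 : y ≤ 1) :
    ham A δ l y (F A y) ≤ ham A δ l 1 1 := by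
  have hA : 0 < A := by linarith [P.hA]
  have hδ := P.hδ
  have hl := P.hl
  set τ := 2 * A * l - 1 - A with hτ
  have hτ0 : 0 < τ := by linarith
  set D := (1 - y) * (τ + A * ((y - l) + (1 - l))) with hD
  have hDτ : τ * (1 - y) ≤ D := by
    have : 0 ≤ (1 - y) * (A * ((y - l) + (1 - l))) :=
      mul_nonneg (by linarith) (mul_nonneg hA.le (by linarith))
    rw [hD]; linarith
  have hD0 : 0 ≤ D := le_trans (mul_nonneg hτ0.le (by linarith)) hDτ
  have hFy : F A y - F A l = (1 - F A l) + D := by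
    rw [F_left hy1, hD, hτ]; ring
  have e1 : (y - l) ^ 2 + (F A y - F A l) / A - δ / (2 * A ^ 2)
      = -(τ * (y - l) / A + δ / (2 * A ^ 2)) := by
    rw [F_left hy1, F_left P.hl1.le, hτ]; field_simp; ring
  have e2 : (1 - l) ^ 2 + (1 - F A l) / A - δ / (2 * A ^ 2)
      = -(τ * (1 - l) / A + δ / (2 * A ^ 2)) := by
    rw [F_left P.hl1.le, hτ]; field_simp; ring
  rw [ham, ham, e1, e2, hFy, mul_add, Real.exp_add, mul_assoc]
  refine mul_le_mul_of_nonneg_left ?_ (Real.exp_pos _).le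
  rw [mul_neg, neg_le_neg_iff]
  have h1 : 2 * A / δ * D + 1 ≤ Real.exp (2 * A / δ * D) := Real.add_one_le_exp _
  have h2 : 0 ≤ τ * (y - l) / A + δ / (2 * A ^ 2) := by
    have : 0 ≤ τ * (y - l) := mul_nonneg hτ0.le (by linarith)
    positivity
  refine le_trans ?_ (mul_le_mul_of_nonneg_right h1 h2)
  have h3 : (2 * A / δ * D + 1) * (τ * (y - l) / A + δ / (2 * A ^ 2))
      - (τ * (1 - l) / A + δ / (2 * A ^ 2))
      = (D - τ * (1 - y)) / A + 2 / δ * D * (τ * (y - l)) := by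
    field_simp; ring
  have h4 : 0 ≤ (D - τ * (1 - y)) / A := div_nonneg (by linarith) hA.le
  have h5 : 0 ≤ 2 / δ * D * (τ * (y - l)) :=
    mul_nonneg (mul_nonneg (by positivity) hD0) (mul_nonneg hτ0.le (by linarith))
  linarith

theorem one_lt_F_l (P : Params A δ l) : 1 < F A l := by
  rw [F_l P]; nlinarith [mul_pos (sub_pos.2 P.hl1) (sub_pos.2 P.one_lt)]

/-- The passage of a solution through `y < 1`, from `y = 1` at time `0` until its return to `y = 1`
at time `t₃`. It crosses the line `y = l` of vanishing `μ'` at time `t₁` on the way down and at time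
`t₂` on the way up; `pos` says that `y' > 0` on the way up, `high` that the return happens above
the height gained by the growth of `ham`. -/
structure LeftTurn (A l : ℝ) (y m : ℝ → ℝ) (t₁ t₂ t₃ : ℝ) : Prop where
  h01 : 0 < t₁
  h12 : t₁ < t₂
  h23 : t₂ < t₃
  eq₁ : y t₁ = l
  eq₂ : y t₂ = l
  eq₃ : y t₃ = 1
  le_m : ∀ t ∈ Icc 0 t₁, m t ≤ 1
  down : ∀ t ∈ Icc 0 t₁, l ≤ y t ∧ y t ≤ 1
  left : ∀ t ∈ Ioo t₁ t₂, y t < l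
  up : ∀ t ∈ Icc t₂ t₃, l ≤ y t ∧ y t ≤ 1
  pos : ∀ t ∈ Icc t₂ t₃, F A (y t) < m t
  lt_one : ∀ t ∈ Ioo 0 t₃, y t < 1
  high : 1 + (2 * A * l - 1 - A) * (1 - l) < m t₃

theorem Sol.exists_leftTurn (h : Sol A δ l y m) (P : Params A δ l) (h0 : y 0 = 1) (h0' : m 0 ≤ 1) :
    ∃ t₁ t₂ t₃, LeftTurn A l y m t₁ t₂ t₃ := by
  have hl1 := P.hl1
  have hδ := P.hδ
  have hA : 0 < A := by linarith [P.hA]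
  have hl := P.hl
  have hF := one_lt_F_l P
  obtain ⟨t₁, ht₁, hy₁, hlt₁⟩ := h.exists_reach_l P h0 h0'
  have hdown := h.le_one_of_exit P h0 h0' (b := t₁) (fun s hs => (hlt₁ s hs).le)
  have hm₁ : m t₁ ≤ 1 := (hdown t₁ ⟨ht₁.le, le_rfl⟩).2
  obtain ⟨a, ha, hya, hlta⟩ := (h.shift ht₁.le).exists_return_l P (by simpa using hy₁)
    (by simpa using hm₁.trans_lt hF)
  set t₂ := a + t₁ with ht₂
  have hya : y t₂ = l := hya
  have h12 : t₁ < t₂ := by linarith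
  have hlt₂ : ∀ t ∈ Ioo t₁ t₂, y t < l := fun t ht => by
    have := hlta (t - t₁) ⟨by linarith [ht.1], by linarith [ht.2]⟩
    simpa using this
  have hle2 : ∀ t ∈ Icc 0 t₂, y t ≤ 1 := fun t ht => by
    rcases le_or_gt t t₁ with h1 | h1
    · exact (hdown t ⟨ht.1, h1⟩).1
    · rcases eq_or_lt_of_le ht.2 with h2 | h2
      · rw [h2, hya]; exact hl1.le
      · exact (hlt₂ t ⟨h1, h2⟩).le.trans hl1.le
  have ht₂0 : 0 < t₂ := ht₁.trans h12
  have h0l : y 0 ≠ l := by rw [h0]; exact hl1.ne'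
  -- the initial value of `ham`
  have hst : ham A δ l 1 1 ≤ ham A δ l (y 0) (m 0) := by
    rw [h0]
    refine ham_anti P h0' ?_
    rw [F_l P]; nlinarith [mul_pos (sub_pos.2 hl1) (show 0 < 2 * A * l - 1 - A by linarith)]
  -- the value of `ham` rises above that at the equilibrium, hence the top crossing is transversal
  have hm₂ : F A l < m t₂ := by
    have hH := h.ham_lt P le_rfl ht₂0 (fun t ht => hle2 t ⟨ht.1, ht.2.le⟩) h0l
    have hE : ham A δ l l (F A l) ≤ ham A δ l 1 1 := ham_F_le P le_rfl hl1.le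
    rw [hya] at hH
    have hne : m t₂ ≠ F A l := fun h1 => by rw [h1] at hH; linarith
    refine lt_of_le_of_ne ?_ hne.symm
    by_contra! hcon
    have hanti := h.dy ht₂0.le
    rw [hya] at hanti
    -- `y < l` before `t₂` prevents a crossing from right to left
    obtain ⟨d, ⟨hd1, hd2⟩, hd'⟩ := exists_forall_Icc_lt h12 (h.cN ht₁.le) (c := 0)
      (by rw [hya]; linarith)
    have := le_left_of_deriv_nonpos (a := d) (b := t₂) (h.cy (ht₁.le.trans hd1.le))
      (fun t ht => h.dy (ht₁.le.trans (hd1.le.trans ht.1)))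
      (fun t ht => (hd' t ⟨ht.1, ht.2.le⟩).le)
      t₂ ⟨hd2.le, le_rfl⟩
    rw [hya] at this
    linarith [hlt₂ d ⟨hd1, hd2⟩]
  -- on the way up, `y' > 0` while `y ≤ 1`
  have hpos : ∀ b ≥ t₂, (∀ t ∈ Ico t₂ b, y t ≤ 1) → ∀ t ∈ Icc t₂ b, 0 < m t - F A (y t) := by
    intro b hb hyb
    by_contra! hcon
    obtain ⟨t, ht, hNt⟩ := hcon
    obtain ⟨u, hu, hu1, hu2⟩ := exists_first_le ht.1 (h.cN ht₂0.le)
      (show 0 < m t₂ - F A (y t₂) by rw [hya]; linarith) hNt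
    have hub : ∀ v ∈ Ico t₂ u, y v ≤ 1 := fun v hv => hyb v ⟨hv.1, hv.2.trans_le (hu.2.trans ht.2)⟩
    have huy : y u ≤ 1 := by
      by_contra! h1
      obtain ⟨d, hd, hd'⟩ := exists_forall_Icc_gt hu.1 (h.cy ht₂0.le) h1
      linarith [hd' d ⟨le_rfl, hd.2.le⟩, hub d ⟨hd.1.le, hd.2⟩]
    have hlu : l ≤ y u := by
      have := add_mul_le_of_le_deriv (c := 0) (h.cy (b := u) ht₂0.le)
        (fun t ht => h.dy (ht₂0.le.trans ht.1)) (fun t ht => (hu2 t ht).le) u ⟨hu.1.le, le_rfl⟩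
      linarith
    have hH := h.ham_lt P le_rfl (ht₂0.trans hu.1) (fun t ht => by
      rcases le_or_gt t t₂ with h1 | h1
      · exact hle2 t ⟨ht.1, h1⟩
      · exact hub t ⟨h1.le, ht.2⟩) h0l
    have h5 : m u = F A (y u) := by linarith
    rw [h5] at hH
    linarith [ham_F_le P hlu huy]
  -- it reaches `y = 1`
  obtain ⟨t₃, ht₃, hy₃, hlt₃⟩ : ∃ t₃ > t₂, y t₃ = 1 ∧ ∀ t ∈ Ico t₂ t₃, y t < 1 := by
    suffices hs : ∃ b ≥ t₂, 1 ≤ y b by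
      obtain ⟨b, hb, hb1⟩ := hs
      obtain ⟨t, ht, h1, h2⟩ := exists_first_ge hb (h.cy ht₂0.le) (by rw [hya]; exact hl1) hb1
      exact ⟨t, ht.1, h1, h2⟩
    by_contra! hcon
    have hN : ∀ t ≥ t₂, 0 < m t - F A (y t) := fun t ht =>
      hpos t ht (fun s hs => (hcon s hs.1).le) t ⟨ht, le_rfl⟩
    have hmono : ∀ a ≥ t₂, ∀ b ≥ a, y a ≤ y b := fun a ha b hb => by
      have := add_mul_le_of_le_deriv (c := 0) (h.cy (b := b) (ht₂0.le.trans ha))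
        (fun t ht => h.dy (ht₂0.le.trans (ha.trans ht.1))) (fun t ht => (hN t (ha.trans ht.1)).le)
        b ⟨hb, le_rfl⟩
      linarith
    obtain ⟨c, hc, hc'⟩ := exists_gt_of_deriv_pos (h.dy ht₂0.le) (hN t₂ le_rfl)
    have hyc := hc' c ⟨hc, le_rfl⟩
    rw [hya] at hyc
    have hc0 : 0 ≤ c := ht₂0.le.trans hc.le
    have hk : 0 < δ * (y c - l) := mul_pos hδ (by linarith)
    obtain ⟨n, hn⟩ := exists_nat_gt ((m c - 1) / (δ * (y c - l)))
    have hg := le_add_mul_of_deriv_le (c := -(δ * (y c - l))) (a := c) (b := c + n) (h.cm hc0)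
      (fun _ ht => h.dm (hc0.trans ht.1)) (fun t ht => by
        have := hmono c hc.le t ht.1
        nlinarith) (c + n) ⟨by linarith [n.cast_nonneg (α := ℝ)], le_rfl⟩
    rw [div_lt_iff₀ hk] at hn
    have hcn : t₂ ≤ c + n := by linarith [n.cast_nonneg (α := ℝ)]
    have h1 := hN (c + n) hcn
    have h2 := hcon (c + n) hcn
    have h3 := hmono c hc.le (c + n) (by linarith [n.cast_nonneg (α := ℝ)])
    rw [F_eq_of_le h2.le] at h1
    have h4 : 0 ≤ (1 - y (c + n)) * (A * y (c + n) - 1) :=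
      mul_nonneg (by linarith) (by nlinarith [P.one_lt])
    nlinarith
  have hpos' := hpos t₃ ht₃.le (fun t ht => (hlt₃ t ht).le)
  have hup : ∀ t ∈ Icc t₂ t₃, l ≤ y t ∧ y t ≤ 1 := fun t ht => by
    constructor
    · have := add_mul_le_of_le_deriv (c := 0) (h.cy (b := t₃) ht₂0.le)
        (fun t ht => h.dy (ht₂0.le.trans ht.1)) (fun t ht => (hpos' t ⟨ht.1, ht.2.le⟩).le) t ht
      linarith
    · rcases eq_or_lt_of_le ht.2 with h2 | h2
      · rw [h2, hy₃]
      · exact (hlt₃ t ⟨ht.1, h2⟩).le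
  have hle3 : ∀ t ∈ Icc 0 t₃, y t ≤ 1 := fun t ht => by
    rcases le_total t t₂ with h1 | h1
    · exact hle2 t ⟨ht.1, h1⟩
    · exact (hup t ⟨h1, ht.2⟩).2
  have hhigh : 1 + (2 * A * l - 1 - A) * (1 - l) < m t₃ := by
    by_contra! hcon
    have hH := h.ham_lt P le_rfl (ht₂0.trans ht₃) (fun t ht => hle3 t ⟨ht.1, ht.2.le⟩) h0l
    rw [h0, hy₃] at hH
    have h1 := hpos' t₃ ⟨ht₃.le, le_rfl⟩
    rw [hy₃, F_left le_rfl] at h1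
    have := ham_anti P (y := 1) (m := m 0) (m' := m t₃) (by linarith)
      (by rw [F_l P]; nlinarith)
    linarith
  refine ⟨t₁, t₂, t₃, ht₁, h12, ht₃, hy₁, hya, hy₃, fun t ht => (hdown t ht).2, fun t ht =>
    ⟨?_, (hdown t ht).1⟩, hlt₂, hup, fun t ht => by linarith [hpos' t ht], fun t ht => ?_, hhigh⟩
  · rcases eq_or_lt_of_le ht.2 with h2 | h2
    · rw [h2, hy₁]
    · exact (hlt₁ t ⟨ht.1, h2⟩).le
  · rcases le_or_gt t t₁ with h1 | h1
    · -- `μ` drops below `1` immediately, hence so does `y`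
      obtain ⟨b, hb, hb'⟩ := exists_lt_of_deriv_neg (h.dm le_rfl) (by
        rw [h0]; exact mul_neg_of_pos_of_neg hδ (by linarith))
      set d := min b (t / 2) with hd
      have hd0 : 0 < d := lt_min hb (by linarith [ht.1])
      have hdt : d < t := (min_le_right _ _).trans_lt (by linarith [ht.1])
      have hmd := hb' d ⟨hd0, min_le_left _ _⟩
      have h5 := le_add_mul_of_deriv_le (c := m d - 1) (a := d) (b := t) (h.cy hd0.le)
        (fun _ hs => h.dy (hd0.le.trans hs.1)) (fun s hs => by
          have h6 := h.m_le P hd0.le (b := t) (fun u hu =>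
            (hlt₁ u ⟨hd0.le.trans hu.1, hu.2.trans_le h1⟩).le) s ⟨hs.1, hs.2.le⟩
          have h7 := hlt₁ s ⟨hd0.le.trans hs.1, hs.2.trans_le h1⟩
          have h8 := (hdown s ⟨hd0.le.trans hs.1, hs.2.le.trans h1⟩).1
          rw [F_eq_of_le h8]
          have h9 : 0 ≤ (1 - y s) * (A * y s - 1) :=
            mul_nonneg (by linarith) (by nlinarith [P.one_lt])
          linarith) t ⟨hdt.le, le_rfl⟩
      have h10 := (hdown d ⟨hd0.le, hdt.le.trans h1⟩).1
      nlinarith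
    · rcases lt_or_ge t t₂ with h2 | h2
      · exact (hlt₂ t ⟨h1, h2⟩).trans hl1
      · exact hlt₃ t ⟨h2, ht.2⟩

end Stommel

namespace Stommel
open PlanarODE

variable {A δ l : ℝ} {y m : ℝ → ℝ}

/-! ### The passage through `y > 1` -/

/-- The passage of a solution through `y > 1`, from `y = 1` at time `a` until its return to `y = 1`
at time `b`. The solution stays above the parabola `above`, which ends at height less than `1` but
within `√δ (1 - l)` of it. -/
structure RightTurn (A δ l : ℝ) (y m : ℝ → ℝ) (a b : ℝ) : Prop where
  hab : a < b
  eq_a : y a = 1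
  eq_b : y b = 1
  gt : ∀ t ∈ Ioo a b, 1 < y t
  above : ∀ t ∈ Icc a b, F A (y t) - √δ * (y t - l) ≤ m t
  lt_one : m b < 1

theorem RightTurn.le {a b : ℝ} (h : RightTurn A δ l y m a b) : ∀ t ∈ Icc a b, 1 ≤ y t := by
  intro t ht
  rcases eq_or_lt_of_le ht.1 with h1 | h1
  · rw [← h1, h.eq_a]
  · rcases eq_or_lt_of_le ht.2 with h2 | h2
    · rw [h2, h.eq_b]
    · exact (h.gt t ⟨h1, h2⟩).le

theorem RightTurn.le_m {a b : ℝ} (h : RightTurn A δ l y m a b) : 1 - √δ * (1 - l) ≤ m b := by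
  have := h.above b ⟨h.hab.le, le_rfl⟩
  rw [h.eq_b, F_left le_rfl] at this
  linarith

theorem sqrt_facts (P : Params A δ l) (hδ1 : δ < 1) : 0 < √δ ∧ √δ < 1 ∧ √δ * √δ = δ :=
  ⟨Real.sqrt_pos.2 P.hδ, by rw [Real.sqrt_lt' one_pos]; linarith, Real.mul_self_sqrt P.hδ.le⟩

/-- While `y ≥ 1`, the solution stays above the parabola `μ = F y - √δ (y - l)`. -/
theorem Sol.above_right (h : Sol A δ l y m) (P : Params A δ l) (hδ1 : δ < 1) {a b : ℝ} (ha : 0 ≤ a)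
    (hya : y a = 1) (hma : 1 ≤ m a) (hy : ∀ t ∈ Ico a b, 1 ≤ y t) (hyb : 1 ≤ y b) :
    ∀ t ∈ Icc a b, F A (y t) - √δ * (y t - l) ≤ m t := by
  obtain ⟨h1, h2, h3⟩ := sqrt_facts P hδ1
  have hl1 := P.hl1
  have hA := P.hA
  intro t ht
  have hyt : 1 ≤ y t := by
    rcases eq_or_lt_of_le ht.2 with h4 | h4
    · rw [h4]; exact hyb
    · exact hy t ⟨ht.1, h4⟩
  have := h.barrier' A 0 0 (1 - A - √δ) (-1) (√δ * l) (t₀ := a) (t₁ := b) ha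
    (by rw [hya]; nlinarith) (fun t ht hz => by
      have hyt := hy t ht
      rw [F_right hyt]
      have e1 : m t - ((1 - A) * y t + A * y t ^ 2) = -(√δ * (y t - l)) := by linarith
      rw [e1]
      have e2 : 0 < √δ * (y t - l) := mul_pos h1 (by linarith)
      have e3 : 0 < 2 * A * y t + (1 - A) - 2 * √δ := by nlinarith
      have e4 := mul_pos e2 e3
      have e5 : √δ * √δ * (y t - l) = δ * (y t - l) := by rw [h3]
      nlinarith) t ht
  rw [F_right hyt]
  linarith

theorem Sol.exists_rightTurn (h : Sol A δ l y m) (P : Params A δ l) (hδ1 : δ < 1) {a : ℝ}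
    (ha : 0 ≤ a) (hya : y a = 1) (hma : 1 < m a) : ∃ b, RightTurn A δ l y m a b := by
  obtain ⟨h1, h2, h3⟩ := sqrt_facts P hδ1
  have hl1 := P.hl1
  have hA := P.hA
  have hδ := P.hδ
  obtain ⟨c, hc, hyc⟩ : ∃ c > a, ∀ t ∈ Ioc a c, 1 < y t := by
    have := exists_gt_of_deriv_pos (h.dy ha) (by rw [hya, F_left le_rfl]; linarith)
    rwa [hya] at this
  have hc0 : 0 ≤ c := ha.trans hc.le
  obtain ⟨b, hb, hyb, hlt⟩ : ∃ b > c, y b = 1 ∧ ∀ t ∈ Ico c b, 1 < y t := by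
    suffices hs : ∃ b ≥ c, y b ≤ 1 by
      obtain ⟨b, hb, hb1⟩ := hs
      obtain ⟨t, ht, h1, h2⟩ := exists_first_le hb (h.cy hc0) (hyc c ⟨hc, le_rfl⟩) hb1
      exact ⟨t, ht.1, h1, h2⟩
    by_contra! hcon
    have hall : ∀ t ≥ a, 1 ≤ y t := fun t ht => by
      rcases eq_or_lt_of_le ht with h4 | h4
      · rw [← h4, hya]
      · rcases le_total t c with h5 | h5
        · exact (hyc t ⟨h4, h5⟩).le
        · exact (hcon t h5).le
    have hk : 0 < δ * (1 - l) := mul_pos hδ (by linarith)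
    obtain ⟨n, hn⟩ := exists_nat_gt (m a / (δ * (1 - l)))
    have hg := le_add_mul_of_deriv_le (c := -(δ * (1 - l))) (a := a) (b := a + n) (h.cm ha)
      (fun _ ht => h.dm (ha.trans ht.1)) (fun t ht => by
        have := hall t ht.1
        nlinarith) (a + n) ⟨by linarith [n.cast_nonneg (α := ℝ)], le_rfl⟩
    rw [div_lt_iff₀ hk] at hn
    have hn0 : a ≤ a + n := by linarith [n.cast_nonneg (α := ℝ)]
    have hy := hall _ hn0
    have := h.above_right P hδ1 ha hya hma.le (b := a + n) (fun t ht => hall t ht.1) hy (a + n)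
      ⟨hn0, le_rfl⟩
    rw [F_eq_of_ge hy] at this
    have h6 : 0 ≤ (y (a + n) - 1) * (1 + A * y (a + n) - √δ) :=
      mul_nonneg (by linarith) (by nlinarith)
    have h7 : √δ * (1 - l) < 1 := by nlinarith [P.l_pos]
    nlinarith
  have hgt : ∀ t ∈ Ioo a b, 1 < y t := fun t ht => by
    rcases le_or_gt t c with h4 | h4
    · exact hyc t ⟨ht.1, h4⟩
    · exact hlt t ⟨h4.le, ht.2⟩
  have hab : a < b := hc.trans hb
  have hge : ∀ t ∈ Ico a b, 1 ≤ y t := fun t ht => by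
    rcases eq_or_lt_of_le ht.1 with h4 | h4
    · rw [← h4, hya]
    · exact (hgt t ⟨h4, ht.2⟩).le
  refine ⟨b, hab, hya, hyb, hgt, h.above_right P hδ1 ha hya hma.le hge hyb.ge, ?_⟩
  -- otherwise `y' ≥ 0` just before time `b`, since `y'' < 0` near this point
  by_contra! hcon
  have hcy := h.cy (b := b) ha
  have hcm := h.cm (b := b) ha
  obtain ⟨d, hd, hd'⟩ := exists_forall_Icc_lt hab (c := 0)
    (f := fun t => (2 * A * y t + (1 - A)) * (F A (y t) - m t) - δ * (y t - l))
    (by unfold F; fun_prop) (by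
      simp only [hyb, F_left le_rfl]
      nlinarith)
  have hd0 : 0 ≤ d := ha.trans hd.1.le
  have hN : ∀ t ∈ Icc d b, 0 ≤ m t - F A (y t) := by
    intro t ht
    have ht0 : 0 ≤ t := hd0.trans ht.1
    have := le_add_mul_of_deriv_le (c := 0) (h.cont_quad ht0 (t₁ := b) (-A) 0 0 (-(1 - A)) 1 0)
      (fun s hs => h.deriv_quad (ht0.trans hs.1) _ _ _ _ _ _) (fun s hs => by
        have h4 := hd' s ⟨ht.1.trans hs.1, hs.2.le⟩
        nlinarith) b ⟨ht.2, le_rfl⟩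
    rw [F_right (by
      rcases eq_or_lt_of_le ht.2 with h4 | h4
      · rw [h4, hyb]
      · exact hge t ⟨hd.1.le.trans ht.1, h4⟩)]
    rw [hyb] at this
    linarith
  have := add_mul_le_of_le_deriv (c := 0) (h.cy (b := b) hd0) (fun t ht => h.dy (hd0.trans ht.1))
    (fun t ht => hN t ⟨ht.1, ht.2.le⟩) b ⟨hd.2.le, le_rfl⟩
  linarith [hgt d hd]

/-- A full turn of a solution from `y = 1`, `μ ≤ 1` back to this half-line. -/
theorem Sol.exists_turn (h : Sol A δ l y m) (P : Params A δ l) (hδ1 : δ < 1) (h0 : y 0 = 1)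
    (h0' : m 0 ≤ 1) : ∃ t₁ t₂ t₃ t₄, LeftTurn A l y m t₁ t₂ t₃ ∧ RightTurn A δ l y m t₃ t₄ := by
  obtain ⟨t₁, t₂, t₃, hL⟩ := h.exists_leftTurn P h0 h0'
  have h3 : 0 ≤ t₃ := (hL.h01.trans (hL.h12.trans hL.h23)).le
  obtain ⟨t₄, hR⟩ := h.exists_rightTurn P hδ1 h3 hL.eq₃ (by
    have := hL.high
    have : 0 ≤ (2 * A * l - 1 - A) * (1 - l) :=
      mul_nonneg (by linarith [P.hl]) (by linarith [P.hl1])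
    linarith)
  exact ⟨t₁, t₂, t₃, t₄, hL, hR⟩

end Stommel

namespace Stommel
open PlanarODE

variable {A δ l : ℝ}

/-! ### Periodic orbits -/

/-- If a periodic curve starts in a closed set `K`, and after each visit to `K` there is a later
one up to which the curve stays in `G`, then it stays in `G`. -/
theorem forall_mem_of_return {α : Type*} [TopologicalSpace α] {γ : ℝ → α} (hc : Continuous γ)
    {T : ℝ} (hT : 0 < T) (hp : Function.Periodic γ T) {K G : Set α} (hK : IsClosed K) {t₀ : ℝ}
    (h0 : γ t₀ ∈ K)
    (hr : ∀ t, γ t ∈ K → ∃ t' > t, γ t' ∈ K ∧ ∀ u ∈ Icc t t', γ u ∈ G) : ∀ t, γ t ∈ G := by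
  set S : Set ℝ := {t | t₀ ≤ t ∧ γ t ∈ K ∧ ∀ u ∈ Ico t₀ t, γ u ∈ G} with hS
  have hS0 : t₀ ∈ S := ⟨le_rfl, h0, fun u hu => absurd hu.1 (not_le.2 hu.2)⟩
  have hub : ¬ BddAbove S := by
    intro hb
    set σ := sSup S with hσ
    have hσS : σ ∈ S := by
      refine ⟨le_csSup hb hS0, ?_, fun u hu => ?_⟩
      · exact (hK.preimage hc).closure_subset_iff.2 (fun t ht => ht.2.1)
          (csSup_mem_closure ⟨t₀, hS0⟩ hb)
      · obtain ⟨t, ht, hut⟩ := exists_lt_of_lt_csSup ⟨t₀, hS0⟩ hu.2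
        exact ht.2.2 u ⟨hu.1, hut⟩
    obtain ⟨t', ht', hK', hG'⟩ := hr σ hσS.2.1
    have : t' ∈ S := by
      refine ⟨hσS.1.trans ht'.le, hK', fun u hu => ?_⟩
      rcases lt_or_ge u σ with h1 | h1
      · exact hσS.2.2 u ⟨hu.1, h1⟩
      · exact hG' u ⟨h1, hu.2.le⟩
    exact absurd (le_csSup hb this) (not_le.2 ht')
  have hall : ∀ t ≥ t₀, γ t ∈ G := fun t ht => by
    obtain ⟨b, hb, htb⟩ := (not_bddAbove_iff.1 hub) t
    exact hb.2.2 t ⟨ht, htb⟩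
  intro t
  obtain ⟨n, hn⟩ := exists_nat_gt ((t₀ - t) / T)
  rw [div_lt_iff₀ hT] at hn
  have := hall (t + n * T) (by linarith)
  rwa [hp.nat_mul n t] at this

/-- The segment of the line `y = 1` through which periodic orbits leave the half plane
`y > 1`. -/
def exitSet (δ l : ℝ) : Set (ℝ × ℝ) := {p | p.1 = 1 ∧ 1 - √δ * (1 - l) ≤ p.2 ∧ p.2 ≤ 1}

theorem isClosed_exitSet (δ l : ℝ) : IsClosed (exitSet δ l) :=
  (isClosed_eq continuous_fst continuous_const).inter
    ((isClosed_le continuous_const continuous_snd).inter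
      (isClosed_le continuous_snd continuous_const))

theorem _root_.IsIntegralCurve.sol {γ : ℝ → ℝ × ℝ} (h : IsIntegralCurve γ (fun _ => field A δ l))
    (a : ℝ) : Sol A δ l (fun t => (γ (t + a)).1) (fun t => (γ (t + a)).2) :=
  h.isForwardSolution a

theorem exists_exit {γ : ℝ → ℝ × ℝ} (P : Params A δ l) (hδ1 : δ < 1)
    (h : IsIntegralCurve γ (fun _ => field A δ l)) {T : ℝ} (hT : 0 < T)
    (hp : Function.Periodic γ T) (hne : ∃ t, γ t ≠ γ 0) : ∃ t, γ t ∈ exitSet δ l := by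
  -- the orbit does not contain the equilibrium
  have hneq : ∀ a, γ a ≠ (l, F A l) := by
    intro a ha
    have hconst : IsForwardSolution (field A δ l) (fun _ => (l, F A l)) := fun t _ => by
      have := (field_eq_zero_iff P (l, F A l)).2 rfl
      show HasDerivWithinAt _ (field A δ l (l, F A l)) _ _
      rw [this]
      exact hasDerivWithinAt_const _ _ _
    have heq := (h.isForwardSolution a).eqOn (lipschitzOnBalls_field A δ l) hconst
      (by simpa using ha)
    have hall : ∀ t, γ t = (l, F A l) := fun t => by
      obtain ⟨n, hn⟩ := exists_nat_gt ((a - t) / T)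
      rw [div_lt_iff₀ hT] at hn
      have := heq (show t + n * T - a ∈ Ici 0 by simp only [mem_Ici]; linarith)
      simp only [sub_add_cancel] at this
      rwa [hp.nat_mul n t] at this
    obtain ⟨t, ht⟩ := hne
    exact ht (by rw [hall, hall])
  have hper : ∀ a, γ (T + a) = γ (0 + a) := fun a => by rw [add_comm, hp, zero_add]
  -- it does not stay in `y ≤ 1`
  obtain ⟨a, ha⟩ : ∃ a, 1 < (γ a).1 := by
    by_contra! hcon
    have hyl : ∀ a, (γ a).1 = l := by
      intro a
      by_contra hal
      have := (h.sol a).ham_lt P le_rfl hT (fun t _ => hcon _) (by simpa using hal)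
      simp only [hper] at this
      exact lt_irrefl _ this
    have hd := (h.sol 0).dy (t := 0) le_rfl
    have hd' : HasDerivWithinAt (fun t => (γ (t + 0)).1) 0 (Ici 0) 0 :=
      (hasDerivWithinAt_const (0:ℝ) (Ici 0) l).congr (fun t _ => hyl _) (hyl _)
    have := (uniqueDiffOn_Ici (0:ℝ) 0 self_mem_Ici).eq_deriv _ hd hd'
    refine hneq 0 (Prod.ext (hyl 0) ?_)
    rw [hyl] at this
    simp only [add_zero] at this
    show (γ 0).2 = F A l
    linarith
  have hs := h.sol a
  obtain ⟨b, hb0, hb⟩ : ∃ b ≥ 0, (γ (b + a)).1 ≤ 1 := by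
    by_contra! hcon
    have := le_add_mul_of_deriv_le (c := -(δ * (1 - l))) (a := 0) (b := T) (hs.cm le_rfl)
      (fun _ ht => hs.dm ht.1) (fun t ht => by
        have h1 := hcon t ht.1
        nlinarith [P.hδ]) T ⟨hT.le, le_rfl⟩
    rw [hper] at this
    have h2 : 0 < δ * (1 - l) := mul_pos P.hδ (by linarith [P.hl1])
    nlinarith
  obtain ⟨c, hc, hyc, hlt⟩ := exists_first_le hb0 (hs.cy le_rfl) (by simpa using ha) hb
  have hmc : (γ (c + a)).2 ≤ 1 := by
    by_contra! hcon
    obtain ⟨d, hd, hd'⟩ := exists_forall_Icc_gt hc.1 (hs.cN le_rfl) (c := 0) (by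
      simp only [hyc, F_left le_rfl]; linarith)
    have := add_mul_le_of_le_deriv (c := 0) (a := d) (b := c) (hs.cy hd.1.le)
      (fun t ht => hs.dy (hd.1.le.trans ht.1)) (fun t ht => (hd' t ⟨ht.1, ht.2.le⟩).le) c
      ⟨hd.2.le, le_rfl⟩
    linarith [hlt d ⟨hd.1.le, hd.2⟩]
  obtain ⟨t₁, t₂, t₃, t₄, -, hR⟩ := (h.sol (c + a)).exists_turn P hδ1 (by simpa using hyc)
    (by simpa using hmc)
  exact ⟨t₄ + (c + a), hR.eq_b, hR.le_m, hR.lt_one.le⟩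

theorem subset_of_turn (P : Params A δ l) (hδ1 : δ < 1) {Γ G : Set (ℝ × ℝ)}
    (hΓ : IsPeriodicOrbit (field A δ l) Γ)
    (hG : ∀ (y m : ℝ → ℝ) (t₁ t₂ t₃ t₄ : ℝ), Sol A δ l y m → y 0 = 1 → 1 - √δ * (1 - l) ≤ m 0 →
      m 0 ≤ 1 → LeftTurn A l y m t₁ t₂ t₃ → RightTurn A δ l y m t₃ t₄ →
      ∀ t ∈ Icc 0 t₄, (y t, m t) ∈ G) : Γ ⊆ G := by
  obtain ⟨γ, h, ⟨T, hT, hp⟩, hne, rfl⟩ := hΓ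
  obtain ⟨t₀, ht₀⟩ := exists_exit P hδ1 h hT hp hne
  rintro _ ⟨t, rfl⟩
  refine forall_mem_of_return h.continuous hT hp (isClosed_exitSet δ l) ht₀ (fun t ht => ?_) t
  have hs := h.sol t
  obtain ⟨t₁, t₂, t₃, t₄, hL, hR⟩ := hs.exists_turn P hδ1 (by simpa using ht.1)
    (by simpa using ht.2.2)
  have h4 : 0 < t₄ := hL.h01.trans (hL.h12.trans (hL.h23.trans hR.hab))
  refine ⟨t₄ + t, by linarith, ⟨hR.eq_b, hR.le_m, hR.lt_one.le⟩, fun u hu => ?_⟩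
  have := hG _ _ t₁ t₂ t₃ t₄ hs (by simpa using ht.1) (by simpa using ht.2.1)
    (by simpa using ht.2.2) hL hR (u - t) ⟨by linarith [hu.1], by linarith [hu.2]⟩
  simpa using this

theorem exists_turn_of_periodic (P : Params A δ l) (hδ1 : δ < 1) {Γ : Set (ℝ × ℝ)}
    (hΓ : IsPeriodicOrbit (field A δ l) Γ) :
    ∃ γ : ℝ → ℝ × ℝ, IsIntegralCurve γ (fun _ => field A δ l) ∧ range γ = Γ ∧
      (∃ T > 0, Function.Periodic γ T) ∧ γ 0 ∈ exitSet δ l := by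
  obtain ⟨γ, h, ⟨T, hT, hp⟩, hne, rfl⟩ := hΓ
  obtain ⟨t₀, ht₀⟩ := exists_exit P hδ1 h hT hp hne
  refine ⟨fun t => γ (t + t₀), h.comp_add t₀, ?_, ⟨T, hT, fun t => ?_⟩, by simpa using ht₀⟩
  · exact (add_right_surjective t₀).range_comp γ
  · show γ (t + T + t₀) = γ (t + t₀)
    rw [add_right_comm, hp]

end Stommel

namespace Stommel
open PlanarODE

variable {A δ l : ℝ}

/-! ### The linearization at the equilibrium -/

/-- The linear map `(x, v) ↦ (τ x + v, -δ x)`. -/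
noncomputable def linPart (τ δ : ℝ) : (ℝ × ℝ) →L[ℝ] (ℝ × ℝ) :=
  ((τ • ContinuousLinearMap.fst ℝ ℝ ℝ) + ContinuousLinearMap.snd ℝ ℝ ℝ).prod
    ((-δ) • ContinuousLinearMap.fst ℝ ℝ ℝ)

theorem hasFDerivAt_field (P : Params A δ l) :
    HasFDerivAt (field A δ l) (linPart (2 * A * l - 1 - A) δ) (l, F A l) := by
  have h1 : HasFDerivAt (fun p : ℝ × ℝ => (p.2 - ((1 + A) * p.1 - A * p.1 ^ 2), δ * (l - p.1)))
      (linPart (2 * A * l - 1 - A) δ) (l, F A l) := by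
    have hf : HasFDerivAt (fun p : ℝ × ℝ => p.1) (ContinuousLinearMap.fst ℝ ℝ ℝ) (l, F A l) :=
      hasFDerivAt_fst
    have hs : HasFDerivAt (fun p : ℝ × ℝ => p.2) (ContinuousLinearMap.snd ℝ ℝ ℝ) (l, F A l) :=
      hasFDerivAt_snd
    have := (hs.fun_sub ((hf.const_mul (1 + A)).fun_sub ((hf.pow 2).const_mul A))).prodMk
      ((hf.const_sub l).const_mul δ)
    refine this.congr_fderiv ?_
    ext <;> simp [linPart] <;> ring
  refine h1.congr_of_eventuallyEq ?_
  have : ∀ᶠ p : ℝ × ℝ in 𝓝 (l, F A l), p.1 < 1 :=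
    (continuous_fst.tendsto (l, F A l)).eventually (Iio_mem_nhds P.hl1)
  filter_upwards [this] with p hp
  rw [field_eq, F_left hp.le]

theorem isLinearizationEigenvalue_iff (P : Params A δ l) (z : ℂ) :
    IsLinearizationEigenvalue (field A δ l) (l, F A l) z ↔
      z ^ 2 - ((2 * A * l - 1 - A : ℝ) : ℂ) * z + (δ : ℂ) = 0 := by
  set τ := 2 * A * l - 1 - A
  have hcp : LinearMap.charpoly (linPart τ δ : (ℝ × ℝ) →ₗ[ℝ] (ℝ × ℝ))
      = Polynomial.X ^ 2 - Polynomial.C τ * Polynomial.X + Polynomial.C δ := by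
    rw [← LinearMap.charpoly_toMatrix _ (Module.Basis.finTwoProd ℝ), Matrix.charpoly_fin_two,
      Matrix.trace_fin_two, Matrix.det_fin_two]
    simp [LinearMap.toMatrix_apply, linPart]
  rw [IsLinearizationEigenvalue, (hasFDerivAt_field P).fderiv, hcp]
  simp

theorem re_im_of_root {τ δ : ℝ} {z : ℂ} (h : z ^ 2 - (τ : ℂ) * z + (δ : ℂ) = 0) :
    z.re ^ 2 - z.im ^ 2 - τ * z.re + δ = 0 ∧ z.im * (2 * z.re - τ) = 0 := by
  have h1 := congrArg Complex.re h
  have h2 := congrArg Complex.im h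
  simp [pow_two] at h1 h2
  exact ⟨by linarith, by linarith⟩

theorem isUnstableFocus (P : Params A δ l) (h : (2 * A * l - 1 - A) ^ 2 < 4 * δ) :
    IsUnstableFocus (field A δ l) (l, F A l) := by
  refine ⟨(field_eq_zero_iff P _).2 rfl, (hasFDerivAt_field P).differentiableAt, fun z hz => ?_⟩
  obtain ⟨h1, h2⟩ := re_im_of_root ((isLinearizationEigenvalue_iff P z).1 hz)
  have hl := P.hl
  have him : z.im ≠ 0 := fun h0 => by
    rw [h0] at h1
    nlinarith [sq_nonneg (2 * z.re - (2 * A * l - 1 - A))]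
  refine ⟨?_, him⟩
  have := (mul_eq_zero.1 h2).resolve_left him
  linarith

theorem isUnstableNode (P : Params A δ l) (h : 4 * δ < (2 * A * l - 1 - A) ^ 2) :
    IsUnstableNode (field A δ l) (l, F A l) := by
  refine ⟨(field_eq_zero_iff P _).2 rfl, (hasFDerivAt_field P).differentiableAt, fun z hz => ?_⟩
  obtain ⟨h1, h2⟩ := re_im_of_root ((isLinearizationEigenvalue_iff P z).1 hz)
  have hl := P.hl
  have hδ := P.hδ
  have him : z.im = 0 := by
    by_contra h0
    have := (mul_eq_zero.1 h2).resolve_left h0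
    nlinarith [sq_nonneg z.im]
  refine ⟨?_, him⟩
  by_contra! h3
  rw [him] at h1
  nlinarith [sq_nonneg z.re]

/-! ### Super-explosion -/

theorem LeftTurn.m_t₁_lt {y m : ℝ → ℝ} {t₁ t₂ t₃ : ℝ} (P : Params A δ l)
    (hL : LeftTurn A l y m t₁ t₂ t₃) : m t₁ < F A l :=
  (hL.le_m t₁ ⟨hL.h01.le, le_rfl⟩).trans_lt (one_lt_F_l P)

/-- In the node case the line `μ - F l = -τ (y - l) / 2` shields the passage through `y < l`: it
cannot turn back before it has gone a distance `r`. -/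
theorem LeftTurn.exists_far {y m : ℝ → ℝ} {t₁ t₂ t₃ r : ℝ} (P : Params A δ l)
    (hL : LeftTurn A l y m t₁ t₂ t₃) (h : Sol A δ l y m)
    (hr1 : A * r ≤ (2 * A * l - 1 - A) / 2)
    (hr2 : A * (2 * A * l - 1 - A) * r / 2 < (2 * A * l - 1 - A) ^ 2 / 4 - δ) :
    ∃ t ∈ Icc t₁ t₂, y t < l - r := by
  by_contra! hcon
  have hl := P.hl
  have hA := P.hA
  have hl1 := P.hl1
  have h1 := hL.h01.le
  have hv := hL.m_t₁_lt P
  set τ := 2 * A * l - 1 - A with hτ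
  have hτ0 : 0 < τ := by linarith
  have hF : ∀ y, y ≤ l → F A y = F A l - τ * (y - l) - A * (y - l) ^ 2 := fun y hy => by
    rw [F_left (hy.trans hl1.le), F_left hl1.le]; ring
  have hle : ∀ t ∈ Icc t₁ t₂, y t ≤ l := fun t ht => by
    rcases eq_or_lt_of_le ht.1 with h4 | h4
    · rw [← h4, hL.eq₁]
    · rcases eq_or_lt_of_le ht.2 with h5 | h5
      · rw [h5, hL.eq₂]
      · exact (hL.left t ⟨h4, h5⟩).le
  have hw := h.barrier' 0 0 0 (τ / 2) 1 (-(F A l) - τ / 2 * l) (t₀ := t₁) (t₁ := t₂) h1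
    (by rw [hL.eq₁]; linarith) (fun t ht hz => by
      have hy := hle t ⟨ht.1, ht.2.le⟩
      have hy' := hcon t ⟨ht.1, ht.2.le⟩
      have hlt : y t < l := lt_of_le_of_ne hy fun h0 => by
        rcases eq_or_lt_of_le ht.1 with h4 | h4
        · rw [← h4, hL.eq₁] at hz; linarith
        · exact (hL.left t ⟨h4, ht.2⟩).ne h0
      rw [hF _ hy]
      have e1 : m t - F A l = -(τ / 2) * (y t - l) := by linarith
      have e2 : 0 < τ ^ 2 / 4 - δ + A * τ * (y t - l) / 2 := by
        have : A * τ * (-r) ≤ A * τ * (y t - l) :=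
          mul_le_mul_of_nonneg_left (by linarith) (by positivity)
        linarith
      have e3 := mul_neg_of_neg_of_pos (show y t - l < 0 by linarith) e2
      have e4 : (2 * 0 * y t + 0 * m t + τ / 2) * (m t - (F A l - τ * (y t - l) - A * (y t - l) ^ 2))
          + (0 * y t + 2 * 0 * m t + 1) * (δ * (l - y t))
          = (y t - l) * (τ ^ 2 / 4 - δ + A * τ * (y t - l) / 2) := by
        have : m t = F A l + -(τ / 2) * (y t - l) := by linarith
        rw [this]; ring
      rw [e4]; exact e3)
  have hc : t₁ < (t₁ + t₂) / 2 ∧ (t₁ + t₂) / 2 < t₂ := ⟨by linarith [hL.h12], by linarith [hL.h12]⟩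
  have := le_left_of_deriv_nonpos (a := (t₁ + t₂) / 2) (b := t₂) (h.cy (h1.trans hc.1.le))
    (fun t ht => h.dy (h1.trans (hc.1.le.trans ht.1))) (fun t ht => by
      have ht' : t ∈ Icc t₁ t₂ := ⟨hc.1.le.trans ht.1, ht.2.le⟩
      have hy := hle t ht'
      have hy' := hcon t ht'
      have hwt := hw t ht'
      rw [hF _ hy]
      have : 0 ≤ (l - y t) * (τ / 2 + A * (y t - l)) :=
        mul_nonneg (by linarith) (by nlinarith)
      nlinarith) t₂ ⟨hc.2.le, le_rfl⟩
  rw [hL.eq₂] at this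
  linarith [hL.left _ hc]

theorem superExplosion (hA : 1 < A) (hδ : 0 < δ) (hδ1 : δ < 1) (h : 1 + 2 * √δ < A) :
    ∃ r : ℝ, 0 < r ∧ ∀ᶠ l in 𝓝[<] (1 : ℝ), IsUnstableNode (field A δ l) (l, F A l) ∧
      ∀ Γ : Set (ℝ × ℝ), IsPeriodicOrbit (field A δ l) Γ → ∃ p ∈ Γ, r ≤ dist p (l, F A l) := by
  have hs : 0 < √δ := Real.sqrt_pos.2 hδ
  have hss : √δ * √δ = δ := Real.mul_self_sqrt hδ.le
  -- at `l = 1` the trace is `A - 1 > 2 √δ`; for `l` near `1` it stays above the midpoint `τ₀`,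
  -- so that both conditions on `r` in `LeftTurn.exists_far` can be met uniformly in `l`
  set τ₀ := ((A - 1) + 2 * √δ) / 2 with hτ₀
  have h1 : 2 * √δ < τ₀ := by linarith
  have h2 : τ₀ < A - 1 := by linarith
  have h3 : δ < τ₀ ^ 2 / 4 := by nlinarith
  set r := min ((τ₀ ^ 2 / 4 - δ) / (A * (A - 1))) (τ₀ / (2 * A)) with hr
  have hA0 : 0 < A * (A - 1) := mul_pos (by linarith) (by linarith)
  have hr0 : 0 < r := lt_min (div_pos (by linarith) hA0) (div_pos (by linarith) (by linarith))
  have hr1 : A * (A - 1) * r ≤ τ₀ ^ 2 / 4 - δ := by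
    have := min_le_left ((τ₀ ^ 2 / 4 - δ) / (A * (A - 1))) (τ₀ / (2 * A))
    rw [← hr, le_div_iff₀ hA0] at this
    linarith
  have hr2 : A * r ≤ τ₀ / 2 := by
    have := min_le_right ((τ₀ ^ 2 / 4 - δ) / (A * (A - 1))) (τ₀ / (2 * A))
    rw [← hr, le_div_iff₀ (by linarith)] at this
    linarith
  refine ⟨r, hr0, ?_⟩
  have hl0 : (1 + A + τ₀) / (2 * A) < 1 := by rw [div_lt_one (by linarith)]; linarith
  filter_upwards [Ioo_mem_nhdsLT hl0] with l hl
  have hl' : 1 + A + τ₀ < 2 * A * l := by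
    have := hl.1; rw [div_lt_iff₀ (by linarith)] at this; linarith
  have P : Params A δ l := ⟨hA, hδ, by linarith, hl.2⟩
  set τ := 2 * A * l - 1 - A with hτ
  have hτ1 : τ₀ < τ := by linarith
  have hτ2 : τ < A - 1 := by nlinarith [hl.2]
  have hsq : τ₀ ^ 2 < τ ^ 2 := by nlinarith
  refine ⟨isUnstableNode P (by rw [← hτ]; linarith), fun Γ hΓ => ?_⟩
  obtain ⟨γ, hγ, rfl, -, h0⟩ := exists_turn_of_periodic P hδ1 hΓ
  have hsol := hγ.sol 0
  simp only [add_zero] at hsol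
  obtain ⟨t₁, t₂, t₃, hL⟩ := hsol.exists_leftTurn P h0.1 h0.2.2
  obtain ⟨t, -, ht⟩ := hL.exists_far (r := r) P hsol (by rw [← hτ]; linarith) (by
    rw [← hτ]
    have : A * τ * r ≤ A * (A - 1) * r := by gcongr
    linarith)
  refine ⟨γ t, mem_range_self t, ?_⟩
  rw [Prod.dist_eq]
  refine le_max_of_le_left ?_
  rw [Real.dist_eq, abs_of_nonpos] <;> linarith

end Stommel

namespace Stommel
open PlanarODE

variable {A δ l : ℝ} {y m : ℝ → ℝ} {t₁ t₂ t₃ t₄ : ℝ}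

/-! ### Canard cycles born at the corner -/

theorem LeftTurn.le_l (hL : LeftTurn A l y m t₁ t₂ t₃) : ∀ t ∈ Icc t₁ t₂, y t ≤ l := fun t ht => by
  rcases eq_or_lt_of_le ht.1 with h4 | h4
  · rw [← h4, hL.eq₁]
  · rcases eq_or_lt_of_le ht.2 with h5 | h5
    · rw [h5, hL.eq₂]
    · exact (hL.left t ⟨h4, h5⟩).le

/-- The energy `δ (y - l)² + (μ - F l)²` grows at a bounded rate in `y ≤ l`. -/
theorem LeftTurn.energy_le (P : Params A δ l) (hL : LeftTurn A l y m t₁ t₂ t₃)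
    (h : Sol A δ l y m) : ∀ t ∈ Icc t₁ t₂,
      δ * (y t - l) ^ 2 + (m t - F A l) ^ 2
        ≤ (m t₁ - F A l) ^ 2 * Real.exp (2 * A * (t - t₁)) := by
  have hl := P.hl
  have hA := P.hA
  have hδ := P.hδ
  have hl1 := P.hl1
  intro t ht
  have hmono := le_left_of_deriv_nonpos (a := t₁) (b := t₂)
    (g := fun t => (δ * (y t - l) ^ 2 + (m t - F A l) ^ 2) * Real.exp (-(2 * A) * (t - t₁)))
    (g' := fun t => (2 * δ * (y t - l) * (m t - F A (y t)) + 2 * (m t - F A l) * (δ * (l - y t))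
      - 2 * A * (δ * (y t - l) ^ 2 + (m t - F A l) ^ 2)) * Real.exp (-(2 * A) * (t - t₁)))
    (by
      have h1 := h.cy (b := t₂) hL.h01.le
      have h2 := h.cm (b := t₂) hL.h01.le
      fun_prop)
    (fun t ht => by
      have h1 := h.dy (hL.h01.le.trans ht.1)
      have h2 := h.dm (hL.h01.le.trans ht.1)
      have h3 := (((h1.sub_const l).fun_pow 2).const_mul δ).fun_add ((h2.sub_const (F A l)).fun_pow 2)
      have h4 : HasDerivWithinAt (fun t => Real.exp (-(2 * A) * (t - t₁)))
          (Real.exp (-(2 * A) * (t - t₁)) * (-(2 * A) * 1)) (Ici t) t :=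
        ((((hasDerivAt_id t).sub_const t₁).const_mul (-(2 * A))).exp).hasDerivWithinAt
      exact (h3.fun_mul h4).congr_deriv (by push_cast; ring))
    (fun t ht => by
      refine mul_nonpos_of_nonpos_of_nonneg ?_ (Real.exp_pos _).le
      have hy := hL.le_l t ⟨ht.1, ht.2.le⟩
      rw [F_left (hy.trans hl1.le), F_left hl1.le]
      have e1 : 0 ≤ δ * ((y t - l) ^ 2 * (l - y t)) :=
        mul_nonneg hδ.le (mul_nonneg (sq_nonneg _) (by linarith))
      have e2 : 0 ≤ δ * (y t - l) ^ 2 * (1 + 2 * A - 2 * A * l) :=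
        mul_nonneg (by positivity) (by nlinarith)
      have e3 : 0 ≤ A * (m t - ((1 + A) * l - A * l ^ 2)) ^ 2 := by positivity
      nlinarith) t ht
  simp only [sub_self, mul_zero, Real.exp_zero, mul_one] at hmono
  rw [hL.eq₁, sub_self] at hmono
  have h2 := mul_le_mul_of_nonneg_right hmono (Real.exp_pos (2 * A * (t - t₁))).le
  rw [mul_assoc, ← Real.exp_add,
    show -(2 * A) * (t - t₁) + 2 * A * (t - t₁) = 0 by ring, Real.exp_zero, mul_one] at h2
  linarith

/-- As long as it stays close to the equilibrium in the focus case, a solution can stay in `y < l`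
only for a bounded time, since its slope angle as seen from the equilibrium turns at a speed bounded
below. -/
theorem Sol.time_le_of_focus (P : Params A δ l) (h : Sol A δ l y m) {k a b : ℝ} (hk : 0 < k)
    (hk1 : k < 1) (hkδ : (2 * A * l - 1 - A) ^ 2 ≤ 4 * (1 - k) * (δ - k)) (ha : 0 ≤ a)
    (hab : a ≤ b) (hy : ∀ t ∈ Icc a b, y t < l) (hx : ∀ t ∈ Icc a b, A * (l - y t) ≤ k) :
    b - a ≤ 2 * Real.pi / k := by
  have hl := P.hl
  have hA := P.hA
  have hδ := P.hδ
  have hl1 := P.hl1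
  set τ := 2 * A * l - 1 - A with hτ
  have hτ0 : 0 < τ := by linarith
  have hg := add_mul_le_of_le_deriv (c := k / 2) (a := a) (b := b)
    (g := fun t => Real.arctan ((m t - F A l) / (l - y t)))
    (g' := fun t => 1 / (1 + ((m t - F A l) / (l - y t)) ^ 2) *
      ((δ * (l - y t) * (l - y t) - (m t - F A l) * (-(m t - F A (y t)))) / (l - y t) ^ 2))
    (by
      have h1 := h.cy (b := b) ha
      have h2 := h.cm (b := b) ha
      have h3 : ∀ t ∈ Icc a b, l - y t ≠ 0 := fun t ht => by linarith [hy t ht]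
      exact Real.continuous_arctan.comp_continuousOn
        (ContinuousOn.div (by fun_prop) (by fun_prop) h3))
    (fun t ht => by
      have h1 := (h.dy (ha.trans ht.1)).const_sub l
      have h2 := (h.dm (ha.trans ht.1)).sub_const (F A l)
      have h3 : l - y t ≠ 0 := by linarith [hy t ⟨ht.1, ht.2.le⟩]
      exact (h2.fun_div h1 h3).arctan)
    (fun t ht => by
      have hyt := hy t ⟨ht.1, ht.2.le⟩
      have hxt := hx t ⟨ht.1, ht.2.le⟩
      set ξ := l - y t with hξ
      have hξ0 : 0 < ξ := by linarith
      set v := m t - F A l with hv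
      have hN : m t - F A (y t) = v - τ * ξ + A * ξ ^ 2 := by
        rw [hv, F_left (hyt.le.trans hl1.le), F_left hl1.le, hξ, hτ]; ring
      rw [hN]
      set σ := v / ξ with hσ
      have hvσ : v = σ * ξ := by rw [hσ]; field_simp
      have e1 : (δ * ξ * ξ - v * (-(v - τ * ξ + A * ξ ^ 2))) / ξ ^ 2
          = δ + σ ^ 2 - τ * σ + A * ξ * σ := by
        rw [hvσ]; field_simp; ring
      rw [e1, one_div_mul_eq_div, le_div_iff₀ (by positivity)]
      have e2 : k * (1 + σ ^ 2) ≤ δ + σ ^ 2 - τ * σ := by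
        have h1 : 0 < 1 - k := by linarith
        have : 0 ≤ (1 - k) * (δ + σ ^ 2 - τ * σ - k * (1 + σ ^ 2)) := by
          nlinarith [sq_nonneg (2 * (1 - k) * σ - τ)]
        have := nonneg_of_mul_nonneg_right this h1
        linarith
      have e3 : -(k * (1 + σ ^ 2) / 2) ≤ A * ξ * σ := by
        have h1 : 0 ≤ A * ξ := by positivity
        nlinarith [sq_nonneg (1 + σ), mul_nonneg h1 (sq_nonneg (1 + σ)), sq_nonneg σ]
      linarith) b ⟨hab, le_rfl⟩
  have h1 := Real.arctan_lt_pi_div_two ((m b - F A l) / (l - y b))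
  have h2 := Real.neg_pi_div_two_lt_arctan ((m a - F A l) / (l - y a))
  rw [le_div_iff₀ hk]
  nlinarith

/-- The time spent in `y < l` is more than `1` if `δ` and `τ` are small. -/
theorem LeftTurn.one_lt_time (P : Params A δ l) (hL : LeftTurn A l y m t₁ t₂ t₃) (h : Sol A δ l y m)
    (hδ1 : δ < 1 / 2) (hτ : 2 * A * l - 1 - A < 1 / 2) : t₁ + 1 < t₂ := by
  by_contra! hcon
  have hl := P.hl
  have hA := P.hA
  have hδ := P.hδ
  have hl1 := P.hl1
  have hv0 := hL.m_t₁_lt P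
  set v₀ := F A l - m t₁ with hv
  have hv0 : 0 < v₀ := by linarith
  have h01 := hL.h01.le
  have hx : ∀ t ∈ Icc t₁ t₂, l - y t - 2 * v₀ * (t - t₁) ≤ 0 := by
    refine nonpos_of_deriv_neg_of_eq_zero (g' := fun t => -(m t - F A (y t)) - 2 * v₀) ?_ ?_ ?_ ?_
    · have h1 := h.cy (b := t₂) h01
      fun_prop
    · intro t ht
      have h1 := (h.dy (h01.trans ht.1)).const_sub l
      have h2 := ((((hasDerivAt_id t).sub_const t₁).const_mul (2 * v₀)).hasDerivWithinAt (s := Ici t))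
      simpa using! h1.fun_sub h2
    · rw [hL.eq₁]; simp
    · intro t ht hz
      have hy := hL.le_l t ⟨ht.1, ht.2.le⟩
      have hm := h.le_m P h01 (b := t₂) (fun s hs => hL.le_l s ⟨hs.1, hs.2.le⟩) t ⟨ht.1, ht.2.le⟩
      have hξ : l - y t ≤ 2 * v₀ := by
        have : t - t₁ ≤ 1 := by linarith [ht.2]
        nlinarith
      have hN : m t - F A (y t) = (m t - F A l) - (2 * A * l - 1 - A) * (l - y t)
          + A * (l - y t) ^ 2 := by
        rw [F_left (hy.trans hl1.le), F_left hl1.le]; ring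
      rw [hN]
      have e1 : (2 * A * l - 1 - A) * (l - y t) ≤ 1 / 2 * (l - y t) :=
        mul_le_mul_of_nonneg_right hτ.le (by linarith)
      have e2 : 0 ≤ A * (l - y t) ^ 2 := by positivity
      have e3 : v₀ + 1 / 2 * (l - y t) - 2 * v₀ ≤ 0 := by linarith
      rcases eq_or_lt_of_le hy with h3 | h3
      · rw [h3] at *; simp at *; linarith
      · have : 0 < A * (l - y t) ^ 2 := by
          have : 0 < l - y t := by linarith
          positivity
        linarith
  have hvt := le_add_mul_of_deriv_le (c := δ * (2 * v₀)) (h.cm (a := t₁) (b := t₂) h01)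
    (fun t ht => h.dm (h01.trans ht.1)) (fun t ht => by
      refine mul_le_mul_of_nonneg_left ?_ hδ.le
      have := hx t ⟨ht.1, ht.2.le⟩
      have h3 : t - t₁ ≤ 1 := by linarith [ht.2]
      nlinarith) t₂ ⟨hL.h12.le, le_rfl⟩
  have h2 := hL.pos t₂ ⟨le_rfl, hL.h23.le⟩
  rw [hL.eq₂] at h2
  have h3 : t₂ - t₁ ≤ 1 := by linarith
  have h4 : δ * (2 * v₀) * (t₂ - t₁) ≤ δ * (2 * v₀) * 1 :=
    mul_le_mul_of_nonneg_left h3 (by positivity)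
  nlinarith

set_option maxHeartbeats 1000000 in
/-- In the focus case, a turn that starts at a distance `O(1 - l)` from the corner stays at such a
distance. -/
theorem turn_near_corner (P : Params A δ l) (hA2 : A < 2) (hδ1 : δ < 1 / 16) {k C : ℝ} (hk : 0 < k)
    (hk1 : k < 1) (hkδ : (2 * A * l - 1 - A) ^ 2 ≤ 4 * (1 - k) * (δ - k))
    (hC : C = (1 + A) * Real.exp (A * (2 * Real.pi / k + 1)) / √δ)
    (hs : A * (C * (1 - l)) ≤ k) (h : Sol A δ l y m) (h0 : y 0 = 1)
    (h0' : 1 - √δ * (1 - l) ≤ m 0) (hm0 : m 0 ≤ 1) (hL : LeftTurn A l y m t₁ t₂ t₃)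
    (hR : RightTurn A δ l y m t₃ t₄) :
    ∀ t ∈ Icc 0 t₄, |y t - 1| ≤ (C + 4) * (1 - l) ∧ |m t - 1| ≤ (C + 4) * (1 - l) := by
  have hl := P.hl
  have hA := P.hA
  have hδ := P.hδ
  have hl1 := P.hl1
  have hA0 : 0 < A := by linarith
  obtain ⟨q1, q2, q3⟩ := sqrt_facts P (by linarith)
  set s := 1 - l with hs'
  have hs0 : 0 < s := by linarith
  have hFl : F A l = 1 + s * (A * l - 1) := F_l P
  have hFl1 := one_lt_F_l P
  have hFl2 : F A l ≤ 1 + s := by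
    have : A * l ≤ A := by nlinarith
    rw [hFl]; nlinarith
  have hE0 : 0 < Real.exp (A * (2 * Real.pi / k + 1)) := Real.exp_pos _
  have hC0 : 0 < C := by rw [hC]; positivity
  have hCs : 0 < C * s := mul_pos hC0 hs0
  have expand : (C + 4) * s = C * s + 4 * s := by ring
  rw [expand]
  -- the jump from the corner
  have p1 : ∀ t ∈ Icc 0 t₁, 1 - s ≤ m t := fun t ht => by
    have h1 := h.strip_bound P h0 hm0 (b := t₁) (fun t ht => (hL.down t ⟨ht.1, ht.2.le⟩).1) t ht
    have h2 : (1 - m 0) ^ 2 ≤ δ * s ^ 2 := by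
      have h3 : 0 ≤ 1 - m 0 := by linarith
      have h4 : 1 - m 0 ≤ √δ * s := by linarith
      calc (1 - m 0) ^ 2 ≤ (√δ * s) ^ 2 := pow_le_pow_left₀ h3 h4 2
        _ = √δ * √δ * s ^ 2 := by ring
        _ = δ * s ^ 2 := by rw [q3]
    have h3 : 2 * δ * (1 - l) * (1 - y t) ≤ 2 * δ * s * s := by
      refine mul_le_mul_of_nonneg_left ?_ (by positivity)
      linarith [(hL.down t ht).1]
    have h4 : (1 - m t) ^ 2 ≤ s ^ 2 := by nlinarith [sq_nonneg s]
    linarith [(abs_le.1 (abs_le_of_sq_le_sq h4 hs0.le)).2]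
  -- the passage through `y < l`
  set T := 2 * Real.pi / k + 1 with hT
  have hv₁ : (m t₁ - F A l) ^ 2 ≤ ((1 + A) * s) ^ 2 := by
    have h1 := p1 t₁ ⟨hL.h01.le, le_rfl⟩
    have h2 := hL.le_m t₁ ⟨hL.h01.le, le_rfl⟩
    have h3 : 1 * s < A * s := mul_lt_mul_of_pos_right hA hs0
    exact sq_le_sq' (by linarith) (by linarith)
  have hEn : ∀ t ∈ Icc t₁ t₂, t ≤ t₁ + T → |y t - l| ≤ C * s ∧ |m t - F A l| ≤ C * s := by
    intro t ht htT
    have h1 := hL.energy_le P h t ht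
    have h2 : Real.exp (2 * A * (t - t₁)) ≤ Real.exp (A * T) ^ 2 := by
      rw [← Real.exp_nat_mul]
      exact Real.exp_le_exp.2 (by push_cast; nlinarith)
    have h3 : δ * (y t - l) ^ 2 + (m t - F A l) ^ 2 ≤ δ * (C * s) ^ 2 := by
      have e : δ * (C * s) ^ 2 = ((1 + A) * s) ^ 2 * Real.exp (A * T) ^ 2 := by
        rw [hC]
        have : √δ ^ 2 = δ := by rw [pow_two, q3]
        rw [mul_pow, div_pow, this]
        field_simp
      rw [e]
      exact h1.trans (mul_le_mul hv₁ h2 (Real.exp_pos _).le (sq_nonneg _))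
    constructor
    · refine abs_le_of_sq_le_sq ?_ hCs.le
      exact le_of_mul_le_mul_left (by linarith [sq_nonneg (m t - F A l)]) hδ
    · refine abs_le_of_sq_le_sq ?_ hCs.le
      have e1 : 0 ≤ δ * (y t - l) ^ 2 := by positivity
      have e2 : δ * (C * s) ^ 2 ≤ 1 * (C * s) ^ 2 :=
        mul_le_mul_of_nonneg_right (by linarith) (sq_nonneg _)
      linarith
  have htime : t₂ ≤ t₁ + T := by
    by_contra! hcon
    have hT0 : 0 < 2 * Real.pi / k := by positivity
    have := h.time_le_of_focus P (a := t₁ + 1 / 2) (b := t₁ + T) hk hk1 hkδ (by linarith [hL.h01])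
      (by linarith) (fun t ht => hL.left t ⟨by linarith [ht.1], by linarith [ht.2]⟩)
      (fun t ht => by
        have h1 := (hEn t ⟨by linarith [ht.1], by linarith [ht.2]⟩ ht.2).1
        have h2 := (abs_le.1 h1).1
        nlinarith)
    linarith
  -- heights on the way back
  have hm3 : ∀ t ∈ Icc t₂ t₄, m t ≤ 1 + s + C * s := fun t ht => by
    have h1 := h.m_le P (a := t₂) (b := t₄) (hL.h01.trans hL.h12).le (fun t ht => by
      rcases le_total t t₃ with h2 | h2
      · exact (hL.up t ⟨ht.1, h2⟩).1
      · exact hl1.le.trans (hR.le t ⟨h2, ht.2.le⟩)) t ht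
    have h2 := (abs_le.1 (hEn t₂ ⟨hL.h12.le, le_rfl⟩ htime).2).2
    linarith
  intro t ht
  rw [abs_le, abs_le]
  rcases le_total t t₁ with c1 | c1
  · have h1 := p1 t ⟨ht.1, c1⟩
    have h2 := hL.le_m t ⟨ht.1, c1⟩
    have h3 := hL.down t ⟨ht.1, c1⟩
    refine ⟨⟨?_, ?_⟩, ⟨?_, ?_⟩⟩ <;> linarith
  · rcases le_total t t₂ with c2 | c2
    · obtain ⟨h1, h2⟩ := hEn t ⟨c1, c2⟩ (c2.trans htime)
      rw [abs_le] at h1 h2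
      have h3 := hL.le_l t ⟨c1, c2⟩
      refine ⟨⟨?_, ?_⟩, ⟨?_, ?_⟩⟩ <;> linarith
    · rcases le_total t t₃ with c3 | c3
      · have h1 := hL.up t ⟨c2, c3⟩
        have h2 := hL.pos t ⟨c2, c3⟩
        have h3 := hm3 t ⟨c2, ht.2⟩
        rw [F_eq_of_le h1.2] at h2
        have h4 : 0 ≤ (1 - y t) * (A * y t - 1) :=
          mul_nonneg (by linarith) (by nlinarith [P.one_lt])
        refine ⟨⟨?_, ?_⟩, ⟨?_, ?_⟩⟩ <;> linarith
      · have h1 := hR.le t ⟨c3, ht.2⟩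
        have h2 := hR.above t ⟨c3, ht.2⟩
        have h3 := hm3 t ⟨c2, ht.2⟩
        rw [F_eq_of_ge h1] at h2
        have h4 : 0 ≤ (y t - 1) * (A * y t - √δ) := by
          have : 1 ≤ A * y t := one_le_mul_of_one_le_of_one_le hA.le h1
          exact mul_nonneg (by linarith) (by linarith)
        have h5 : √δ * s ≤ s := mul_le_of_le_one_left hs0.le q2.le
        have h6 : y t - 1 ≤ m t - 1 + s := by
          have e1 : √δ * (y t - l) = √δ * (y t - 1) + √δ * s := by rw [hs']; ring
          have e2 : (y t - 1) * (1 + A * y t) - √δ * (y t - 1)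
            = (y t - 1) + (y t - 1) * (A * y t - √δ) := by ring
          linarith
        refine ⟨⟨?_, ?_⟩, ⟨?_, ?_⟩⟩ <;> linarith

end Stommel

namespace Stommel
open PlanarODE

variable {A δ l : ℝ}

theorem yFold_lt_one (hA : 1 < A) : yFold A < 1 := by
  rw [yFold, div_lt_one (by linarith)]; linarith

/-- The repelling branch comes arbitrarily close to the corner. -/
theorem exists_repellingBranch_near (hA : 1 < A) {ε : ℝ} (hε : 0 < ε) :
    ∃ q ∈ repellingBranch A, dist q corner < ε := by
  have hy := yFold_lt_one hA
  set η := min (ε / (2 * A)) ((1 - yFold A) / 2) with hη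
  have h1 : 0 < η := lt_min (by positivity) (by linarith)
  have h2 : η ≤ (1 - yFold A) / 2 := min_le_right _ _
  have h3 : A * η ≤ ε / 2 := by
    have := min_le_left (ε / (2 * A)) ((1 - yFold A) / 2)
    rw [← hη, le_div_iff₀ (by linarith)] at this
    linarith
  have h5 : yFold A * (2 * A) = 1 + A := by rw [yFold]; field_simp
  have h4 : 1 ≤ A * (1 - η) := by nlinarith
  refine ⟨(1 - η, F A (1 - η)), ⟨rfl, by simp only; linarith, by simp only; linarith⟩, ?_⟩
  rw [Prod.dist_eq, max_lt_iff, Real.dist_eq, Real.dist_eq, abs_lt, abs_lt,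
    F_eq_of_le (by linarith)]
  simp only [corner]
  have h6 : 0 ≤ η * (A * (1 - η) - 1) := mul_nonneg h1.le (by linarith)
  have h7 : η * (A * (1 - η) - 1) ≤ A * η := by nlinarith [mul_pos h1 h1]
  have h8 : η ≤ A * η := by nlinarith
  refine ⟨⟨?_, ?_⟩, ⟨?_, ?_⟩⟩ <;> ring_nf at * <;> linarith

theorem isCanardCycle (hA : 1 < A) (hδ : 0 < δ) (hδ1 : δ < 1 / 16) (h : A < 1 + 2 * √δ) {ε : ℝ}
    (hε : 0 < ε) : ∀ᶠ l in 𝓝[<] (1 : ℝ), ∀ Γ : Set (ℝ × ℝ),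
      IsPeriodicOrbit (field A δ l) Γ → IsCanardCycle (field A δ l) A ε Γ := by
  have hs : 0 < √δ := Real.sqrt_pos.2 hδ
  have hss : √δ * √δ = δ := Real.mul_self_sqrt hδ.le
  have hs4 : √δ < 1 / 4 := by rw [Real.sqrt_lt' (by norm_num)]; linarith
  have hfold := yFold_lt_one hA
  -- `k` is chosen with `(A - 1) ^ 2 ≤ 4 * (1 - k) * (δ - k)`: this keeps the solution turning about
  -- the equilibrium at a positive rate, also in the presence of the quadratic term
  set k := (4 * δ - (A - 1) ^ 2) / (4 * (1 + δ)) with hk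
  have hk4 : k * (4 * (1 + δ)) = 4 * δ - (A - 1) ^ 2 := by rw [hk]; field_simp
  have hk0 : 0 < k := div_pos (by nlinarith) (by linarith)
  have hk1 : k < 1 := by
    rw [hk, div_lt_one (by linarith)]; nlinarith [sq_nonneg (A - 1)]
  set C := (1 + A) * Real.exp (A * (2 * Real.pi / k + 1)) / √δ with hC
  have hC0 : 0 < C := by have := Real.exp_pos (A * (2 * Real.pi / k + 1)); positivity
  obtain ⟨q, hq, hqc⟩ := exists_repellingBranch_near hA (half_pos hε)
  -- a turn has size at most `(C + 4) * (1 - l)`, where the first bound on `1 - l` makes the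
  -- quadratic term harmless and the second one makes the size small
  set s₀ := min (k / (A * C)) (min (ε / 2) (1 - yFold A) / (C + 4)) with hs₀
  have hs₀0 : 0 < s₀ := lt_min (by positivity)
    (div_pos (lt_min (by linarith) (by linarith)) (by linarith))
  have hl0 : max (1 - s₀) (yFold A) < 1 := max_lt (by linarith) hfold
  filter_upwards [Ioo_mem_nhdsLT hl0] with l hl Γ hΓ
  have hls : 1 - l < s₀ := by linarith [(le_max_left _ _).trans_lt hl.1]
  have hl' : 1 + A < 2 * A * l := by
    have := (le_max_right (1 - s₀) (yFold A)).trans_lt hl.1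
    rw [yFold, div_lt_iff₀ (by linarith)] at this; linarith
  have P : Params A δ l := ⟨hA, hδ, hl', hl.2⟩
  have hl1 := P.hl1
  have hb1 : A * (C * (1 - l)) ≤ k := by
    have := hls.le.trans (min_le_left _ _)
    rw [le_div_iff₀ (by positivity)] at this
    linarith
  have hb2 : (C + 4) * (1 - l) < min (ε / 2) (1 - yFold A) := by
    have := hls.trans_le (min_le_right _ _)
    rw [lt_div_iff₀ (by linarith)] at this
    linarith
  obtain ⟨hb3, hb4⟩ := lt_min_iff.1 hb2
  have hτ2 : 2 * A * l - 1 - A < A - 1 := by nlinarith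
  have hkδ : (2 * A * l - 1 - A) ^ 2 ≤ 4 * (1 - k) * (δ - k) := by nlinarith [sq_nonneg k]
  have hnear : ∀ p ∈ Γ, |p.1 - 1| ≤ (C + 4) * (1 - l) ∧ |p.2 - 1| ≤ (C + 4) * (1 - l) := by
    refine subset_of_turn P (by linarith) (G := {p | |p.1 - 1| ≤ (C + 4) * (1 - l) ∧
      |p.2 - 1| ≤ (C + 4) * (1 - l)}) hΓ ?_
    intro y m t₁ t₂ t₃ t₄ hsol h0 h1 h2 hL hR t ht
    exact turn_near_corner P (by linarith) hδ1 hk0 hk1 hkδ hC hb1 hsol h0 h1 h2 hL hR t ht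
  have hball : ∀ p ∈ Γ, dist p corner < ε / 2 := fun p hp => by
    obtain ⟨h1, h2⟩ := hnear p hp
    rw [Prod.dist_eq, max_lt_iff, Real.dist_eq, Real.dist_eq]
    exact ⟨h1.trans_lt hb3, h2.trans_lt hb3⟩
  refine ⟨hΓ, fun p hp => (hball p hp).trans (by linarith), fun p hp => ?_, ?_⟩
  · linarith [(abs_le.1 (hnear p hp).1).1]
  obtain ⟨γ, hγ, hr, -, h0⟩ := exists_turn_of_periodic P (by linarith) hΓ
  have hsol := hγ.sol 0
  simp only [add_zero] at hsol
  obtain ⟨t₁, t₂, t₃, t₄, hL, hR⟩ := hsol.exists_turn P (by linarith) h0.1 h0.2.2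
  have ht₃ : 0 < t₃ := hL.h01.trans (hL.h12.trans hL.h23)
  -- a point of the right branch, by the intermediate value theorem
  obtain ⟨a, ha, ha0⟩ : ∃ a ∈ Ioo t₃ t₄, (γ a).2 - F A (γ a).1 = 0 := by
    have hc := hsol.cN (a := t₃) (b := t₄) ht₃.le
    have := intermediate_value_Ioo' hR.hab.le hc
    refine this ⟨?_, ?_⟩
    · simp only [hR.eq_b, F_left le_rfl]; linarith [hR.lt_one]
    · linarith [hL.pos t₃ ⟨hL.h23.le, le_rfl⟩]
  -- the next passage through `y < l`
  have hsol' := hγ.sol t₄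
  obtain ⟨u₁, u₂, u₃, hL'⟩ := hsol'.exists_leftTurn P (by simpa using hR.eq_b)
    (by simpa using hR.lt_one.le)
  have htime := hL'.one_lt_time P hsol' (by linarith) (by linarith)
  refine ⟨γ, hγ, hr, a, u₁ + t₄, by linarith [ha.2, hL'.h01], ⟨by linarith, hR.gt a ha⟩,
    fun t ht => ⟨?_, ?_⟩⟩
  · have := hL'.lt_one (t - t₄) ⟨by linarith [ht.1, hL'.h01], by linarith [ht.2, hL'.h23]⟩
    simpa using this
  · refine Metric.mem_thickening_iff.2 ⟨q, hq, ?_⟩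
    have := hball (γ t) (hr ▸ mem_range_self t)
    have h3 := dist_triangle_right (γ t) q corner
    linarith

end Stommel

namespace Stommel
open PlanarODE

variable {A δ l : ℝ} {y m : ℝ → ℝ} {t₁ t₂ t₃ t₄ : ℝ}

/-! ### Relaxation oscillations: the phases of a turn -/

theorem two_mul_yFold (hA : 1 < A) : 2 * A * yFold A = 1 + A := by rw [yFold]; field_simp

theorem muFold_eq (hA : 1 < A) : muFold A = A * yFold A ^ 2 := by
  rw [yFold, muFold]; field_simp; ring

theorem F_eq_muFold_sub (hA : 1 < A) {y : ℝ} (hy : y ≤ 1) :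
    F A y = muFold A - A * (y - yFold A) ^ 2 := by
  rw [F_left hy, muFold_eq hA]
  linear_combination y * (-two_mul_yFold hA)

/-- Where `y` reaches a new maximum, the solution is not below the critical manifold. -/
theorem Sol.F_le_of_first_ge (h : Sol A δ l y m) {a b : ℝ} (ha : 0 ≤ a) (hab : a < b)
    (hlt : ∀ t ∈ Ico a b, y t < y b) : F A (y b) ≤ m b := by
  by_contra! hcon
  obtain ⟨d, hd, hd'⟩ := exists_forall_Icc_lt hab (h.cN ha) (c := 0) (by linarith)
  have := le_left_of_deriv_nonpos (a := d) (b := b) (h.cy (ha.trans hd.1.le))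
    (fun t ht => h.dy (ha.trans (hd.1.le.trans ht.1))) (fun t ht => (hd' t ⟨ht.1, ht.2.le⟩).le) b
    ⟨hd.2.le, le_rfl⟩
  linarith [hlt d ⟨hd.1.le, hd.2⟩]

/-- Smallness of `η` and of `√δ` with respect to `η`, as needed for a turn to follow the singular
cycle at distance `O(η)`; the equilibrium is at distance at least `d` from the fold. -/
structure Small (A δ l d η : ℝ) : Prop where
  P : Params A δ l
  η_pos : 0 < η
  η_lt : η < 1 / 2
  d_pos : 0 < d
  dl : yFold A + d ≤ l
  η_inv : η * A < 1
  gap : 1 / A + η < yFold A - η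
  ηd : 2 * η + A * η ^ 2 < A * d ^ 2
  σ₁ : 2 * √δ ≤ (A - 1) * η
  σ₂ : 2 * (muFold A + 2) * √δ ≤ η

/-- The four phases of a turn, separated by the times `a`, `b`, `c`: the jump from the corner, the
slow motion along the left branch, the jump from the fold, and the slow motion along the right
branch. -/
structure Phases (A η : ℝ) (y m : ℝ → ℝ) (t₄ a b c : ℝ) : Prop where
  h0a : 0 ≤ a
  hab : a ≤ b
  hbc : b ≤ c
  hc4 : c ≤ t₄
  y0 : y 0 = 1
  ya : y a = 1 / A + η
  yb : y b = yFold A - η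
  yc : 1 ≤ y c
  y4 : y t₄ = 1
  jump₁ : ∀ t ∈ Icc 0 a, 1 / A + η ≤ y t ∧ y t ≤ 1 ∧ |m t - 1| ≤ A * η
  slow₁ : ∀ t ∈ Icc a b, 1 / A - η ≤ y t ∧ y t ≤ yFold A - η ∧ |m t - F A (y t)| ≤ 2 * A * η
  jump₂ : ∀ t ∈ Icc b c, yFold A - η ≤ y t ∧ F A (y t) ≤ m t ∧ |m t - muFold A| ≤ (A + 2) * η
  slow₂ : ∀ t ∈ Icc c t₄, 1 ≤ y t ∧ |m t - F A (y t)| ≤ η ∧ m t ≤ muFold A + η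
  Fc : m c ≤ F A (y c) + η

theorem Sol.low_bound (h : Sol A δ l y m) (P : Params A δ l) (hδ1 : δ < 1) (h0 : y 0 = 1)
    (h0' : 1 - √δ * (1 - l) ≤ m 0) (hm0 : m 0 ≤ 1) (hL : LeftTurn A l y m t₁ t₂ t₃) :
    ∀ t ∈ Icc 0 t₂, 1 - 2 * √δ ≤ m t := by
  obtain ⟨q1, q2, q3⟩ := sqrt_facts P hδ1
  have hl1 := P.hl1
  have hl0 := P.l_pos
  have hδ := P.hδ
  have p1 : ∀ t ∈ Icc 0 t₁, 1 - 2 * √δ ≤ m t := fun t ht => by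
    have h1 := h.strip_bound P h0 hm0 (b := t₁) (fun t ht => (hL.down t ⟨ht.1, ht.2.le⟩).1) t ht
    have h2 : (1 - m 0) ^ 2 ≤ (√δ) ^ 2 := by
      refine pow_le_pow_left₀ (by linarith) ?_ 2
      nlinarith
    have h3 : 2 * δ * (1 - l) * (1 - y t) ≤ 2 * δ * 1 * 1 := by
      have h4 := hL.down t ht
      gcongr <;> linarith
    have h4 : (1 - m t) ^ 2 ≤ (2 * √δ) ^ 2 := by nlinarith
    linarith [(abs_le.1 (abs_le_of_sq_le_sq h4 (by linarith))).2]
  intro t ht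
  rcases le_total t t₁ with h1 | h1
  · exact p1 t ⟨ht.1, h1⟩
  · have := h.le_m P hL.h01.le (b := t₂) (fun s hs => hL.le_l s ⟨hs.1, hs.2.le⟩) t ⟨h1, ht.2⟩
    linarith [p1 t₁ ⟨hL.h01.le, le_rfl⟩]

set_option maxHeartbeats 400000 in
/-- The jump from the corner and the slow motion along the left branch. -/
theorem exists_left_phases {d η : ℝ} (S : Small A δ l d η) (h : Sol A δ l y m) (h0 : y 0 = 1)
    (h0' : 1 - √δ * (1 - l) ≤ m 0) (hm0 : m 0 ≤ 1) (hL : LeftTurn A l y m t₁ t₂ t₃) :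
    ∃ a b, t₁ < a ∧ a < b ∧ b < t₂ ∧ y a = 1 / A + η ∧ y b = yFold A - η ∧
      (∀ t ∈ Icc 0 a, 1 / A + η ≤ y t ∧ y t ≤ 1 ∧ |m t - 1| ≤ A * η) ∧
      (∀ t ∈ Icc a b, 1 / A - η ≤ y t ∧ y t ≤ yFold A - η ∧ |m t - F A (y t)| ≤ 2 * A * η) ∧
      F A (y b) ≤ m b ∧ m b ≤ F A (y b) + η / 2 := by
  obtain ⟨P, hη, hη2, hd, hdl, hηA, hgap, hηd, hσ₁, hσ₂⟩ := S
  have hA := P.hA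
  have hA0 : 0 < A := by linarith
  have hδ := P.hδ
  have hl1 := P.hl1
  have hμ1 : 0 < muFold A := by rw [muFold]; positivity
  have hσ0 : 0 ≤ √δ := Real.sqrt_nonneg δ
  have hσ4 : 4 * √δ ≤ η := by linarith [mul_nonneg hμ1.le hσ0]
  have hss : √δ * √δ = δ := Real.mul_self_sqrt hδ.le
  have hδη : 16 * δ ≤ η ^ 2 := by
    have := pow_le_pow_left₀ (mul_nonneg zero_le_four hσ0) hσ4 2
    linarith
  have hδ1 : δ < 1 := by
    have : η ^ 2 ≤ 1 := pow_le_one₀ hη.le (by linarith)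
    linarith
  have hfold := two_mul_yFold hA
  have hf1 := yFold_lt_one hA
  set f := yFold A with hf
  set w := 1 / A with hw
  have hAw : A * w = 1 := by rw [hw]; field_simp
  have hw0 : 0 < w := by positivity
  have hwη : η < w := lt_of_mul_lt_mul_left (by linarith) hA0.le
  have hlow := h.low_bound P hδ1 h0 h0' hm0 hL
  have hy1 : ∀ t ∈ Icc 0 t₂, y t ≤ 1 := fun t ht => by
    rcases le_total t t₁ with h1 | h1
    · exact (hL.down t ⟨ht.1, h1⟩).2
    · exact (hL.le_l t ⟨h1, ht.2⟩).trans hl1.le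
  have ht₂ : 0 < t₂ := hL.h01.trans hL.h12
  -- during the jump `μ` stays below the line `μ = 1 + K (1 - y)`
  set K := 2 * δ / (A * η) with hK
  have hKη : K * (A * η) = 2 * δ := by rw [hK]; field_simp
  have hK0 : 0 < K := by positivity
  have hKA : K ≤ A * η / 2 := by
    have : η ^ 2 ≤ (A * η) ^ 2 := pow_le_pow_left₀ hη.le (le_mul_of_one_le_left hη.le hA.le) 2
    rw [hK, div_le_iff₀ (by positivity)]; linarith
  have hbarA : ∀ b ≤ t₂, (∀ t ∈ Ico 0 b, w + η ≤ y t) → ∀ t ∈ Icc 0 b, m t ≤ 1 + K * (1 - y t) := by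
    intro b hb hyb t ht
    have := h.barrier' 0 0 0 K 1 (-1 - K) (t₀ := 0) (t₁ := b) le_rfl
      (by rw [h0]; linarith) (fun t ht hz => by
        have e1 := hyb t ht
        have e2 := hy1 t ⟨ht.1, ht.2.le.trans hb⟩
        rw [F_eq_of_le e2]
        have e3 : m t - (1 + (1 - y t) * (A * y t - 1)) = (1 - y t) * (K - (A * y t - 1)) := by
          linarith
        rw [e3]
        have e4 : A * η ≤ A * y t - 1 := by
          linarith [mul_le_mul_of_nonneg_left e1 hA0.le]
        have e5 : (1 - y t) * (K - (A * y t - 1)) ≤ (1 - y t) * (-(A * η / 2)) :=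
          mul_le_mul_of_nonneg_left (by linarith) (by linarith)
        have e6 := mul_le_mul_of_nonneg_left e5 hK0.le
        have e7 : K * ((1 - y t) * (-(A * η / 2))) = -(δ * (1 - y t)) := by
          linear_combination (-(1 - y t) / 2) * hKη
        linarith [mul_lt_mul_of_pos_left hl1 hδ]) t ht
    linarith
  obtain ⟨a, ha, hya, hlta⟩ : ∃ a ∈ Ioc 0 t₂, y a = w + η ∧ ∀ t ∈ Ico 0 a, w + η < y t := by
    suffices hs : ∃ t ∈ Icc 0 t₂, y t ≤ w + η by
      obtain ⟨t, ht, hyt⟩ := hs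
      obtain ⟨a, ha, h1, h2⟩ := exists_first_le ht.1 (h.cy le_rfl) (by rw [h0]; linarith) hyt
      exact ⟨a, ⟨ha.1, ha.2.trans ht.2⟩, h1, h2⟩
    by_contra! hcon
    have h1 := hbarA t₂ le_rfl (fun t ht => (hcon t ⟨ht.1, ht.2.le⟩).le) t₂ ⟨ht₂.le, le_rfl⟩
    have h2 := hL.pos t₂ ⟨le_rfl, hL.h23.le⟩
    rw [hL.eq₂] at h1 h2
    rw [F_l P] at h2
    have h3 : K * (1 - l) ≤ (1 - l) * (A * l - 1) := by
      have h4 : A * (w + 2 * η) < A * l := mul_lt_mul_of_pos_left (by linarith) hA0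
      have h5 : 0 < A * η := by positivity
      linarith [mul_le_mul_of_nonneg_right (show K ≤ A * l - 1 by linarith)
        (show 0 ≤ 1 - l by linarith)]
    linarith
  have hat₁ : t₁ < a := by
    by_contra! h1
    have := (hL.down a ⟨ha.1.le, h1⟩).1
    linarith
  have hA1 : ∀ t ∈ Icc 0 a, w + η ≤ y t := fun t ht => by
    rcases eq_or_lt_of_le ht.2 with h1 | h1
    · rw [h1, hya]
    · exact (hlta t ⟨ht.1, h1⟩).le
  have hup := hbarA a ha.2 (fun t ht => (hlta t ht).le)
  -- lower bound of `y`
  have hyl : ∀ t ∈ Icc 0 t₂, w - η ≤ y t := fun t ht => by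
    have := h.barrier' 0 0 0 (-1) 0 (w - η) (t₀ := 0) (t₁ := t₂) le_rfl
      (by rw [h0]; linarith) (fun t ht hz => by
        have e1 : y t = w - η := by linarith
        have e2 := hlow t ⟨ht.1, ht.2.le⟩
        rw [F_eq_of_le (hy1 t ⟨ht.1, ht.2.le⟩), e1]
        have e3 : (1 - (w - η)) * (A * (w - η) - 1) = -((A - 1) * η + A * η ^ 2) := by
          linear_combination (1 - w + 2 * η) * hAw
        have e4 : 0 < A * η ^ 2 := by positivity
        rw [e3]
        linarith) t ht
    linarith
  obtain ⟨b, hb, hyb, hltb⟩ := exists_first_ge (f := y) (c := f - η) ha.2 (h.cy ha.1.le)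
    (by rw [hya]; exact hgap) (by rw [hL.eq₂]; linarith)
  have hbt₂ : b < t₂ := lt_of_le_of_ne hb.2 fun h1 => by
    rw [h1, hL.eq₂] at hyb; linarith
  have hyub : ∀ t ∈ Icc a b, y t ≤ f - η := fun t ht => by
    rcases eq_or_lt_of_le ht.2 with h1 | h1
    · rw [h1, hyb]
    · exact (hltb t ⟨ht.1, h1⟩).le
  have hb02 : ∀ t ∈ Icc a b, t ∈ Icc 0 t₂ := fun t ht =>
    ⟨ha.1.le.trans ht.1, ht.2.trans hb.2⟩
  -- the solution is attracted to the left branch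
  set n := δ / (A * η) with hn
  have hnη : n * (A * η) = δ := by rw [hn]; field_simp
  have hn0 : 0 < n := by positivity
  have hn2 : n ≤ η / 2 := by
    have : η ^ 2 ≤ A * η ^ 2 := le_mul_of_one_le_left (sq_nonneg _) hA.le
    rw [hn, div_le_iff₀ (by positivity)]; linarith
  have hFa : F A (y a) = 1 + (1 - w - η) * (A * η) := by
    rw [F_eq_of_le (hy1 a ⟨ha.1.le, ha.2⟩), hya]
    linear_combination (1 - w - η) * hAw
  have hFleft : ∀ t ∈ Icc a b, F A (y t) = (1 + A) * y t - A * y t ^ 2 := fun t ht =>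
    F_left (hy1 t (hb02 t ht))
  have hN1 : ∀ t ∈ Icc a b, m t - F A (y t) ≤ n := fun t ht => by
    have := h.barrier' A 0 0 (-(1 + A)) 1 (-n) (t₀ := a) (t₁ := b) ha.1.le
      (by
        have e1 := hup a ⟨ha.1.le, le_rfl⟩
        have e2 := hFleft a ⟨le_rfl, hb.1.le⟩
        rw [hFa] at e2
        rw [hya] at e1 e2 ⊢
        have e3 : K * (1 - (w + η)) ≤ (1 - w - η) * (A * η) := by
          have h1 : 0 < A * η := by positivity
          linarith [mul_le_mul_of_nonneg_right (show K ≤ A * η by linarith)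
            (show 0 ≤ 1 - w - η by linarith)]
        linarith) (fun t ht hz => by
        have ht' : t ∈ Icc a b := ⟨ht.1, ht.2.le⟩
        have e1 : m t - F A (y t) = n := by rw [hFleft t ht']; linarith
        rw [e1]
        have e2 : (2 * A * y t + 0 * m t + -(1 + A)) * n ≤ (-(2 * A * η)) * n :=
          mul_le_mul_of_nonneg_right (by
            linarith [mul_le_mul_of_nonneg_left (hyub t ht') hA0.le]) hn0.le
        have e3 : 0 < y t := by linarith [hyl t (hb02 t ht')]
        linarith [mul_pos hδ e3, mul_lt_mul_of_pos_left hl1 hδ]) t ht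
    rw [hFleft t ht]; linarith
  have hN2 : ∀ t ∈ Icc a b, -(2 * A * η) ≤ m t - F A (y t) := fun t ht => by
    have hAη : 0 < A * η := by positivity
    have := h.barrier' (-A) 0 0 (1 + A) (-1) (-(2 * A * η)) (t₀ := a) (t₁ := b) ha.1.le
      (by
        have e1 := hlow a ⟨ha.1.le, ha.2⟩
        have e2 := hFleft a ⟨le_rfl, hb.1.le⟩
        rw [hFa] at e2
        have e3 : (1 - w - η) * (A * η) ≤ 1 * (A * η) :=
          mul_le_mul_of_nonneg_right (by linarith) hAη.le
        linarith) (fun t ht hz => by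
        have ht' : t ∈ Icc a b := ⟨ht.1, ht.2.le⟩
        have e1 : m t - F A (y t) = -(2 * A * η) := by rw [hFleft t ht']; linarith
        rw [e1]
        have e2 := hyub t ht'
        have e3 : 0 ≤ (1 + A - 2 * A * y t) * (2 * A * η) :=
          mul_nonneg (by linarith [mul_le_mul_of_nonneg_left e2 hA0.le]) (by linarith)
        have e4 : 0 < δ * (l - y t) := mul_pos hδ (by linarith)
        linarith) t ht
    rw [hFleft t ht]; linarith
  refine ⟨a, b, hat₁, hb.1, hbt₂, hya, hyb, fun t ht => ⟨hA1 t ht, hy1 t ⟨ht.1, ht.2.trans ha.2⟩,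
    abs_le.2 ⟨?_, ?_⟩⟩, fun t ht => ⟨hyl t (hb02 t ht), hyub t ht, abs_le.2 ⟨hN2 t ht, ?_⟩⟩,
    h.F_le_of_first_ge ha.1.le hb.1 (by rwa [hyb]), ?_⟩
  · have := hlow t ⟨ht.1, ht.2.trans ha.2⟩
    linarith
  · have e1 := hup t ht
    have e2 := hA1 t ht
    have e3 : K * (1 - y t) ≤ K * 1 := mul_le_mul_of_nonneg_left (by linarith) hK0.le
    have : 0 < A * η := by positivity
    linarith
  · have := hN1 t ht
    have : 1 * η ≤ A * η := mul_le_mul_of_nonneg_right hA.le hη.le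
    linarith
  · linarith [hN1 b ⟨hb.1.le, le_rfl⟩]

set_option maxHeartbeats 400000 in
/-- The jump from the fold and the slow motion along the right branch. -/
theorem exists_right_phases {d η : ℝ} (S : Small A δ l d η) (h : Sol A δ l y m)
    (hL : LeftTurn A l y m t₁ t₂ t₃) (hR : RightTurn A δ l y m t₃ t₄) {b : ℝ} (hb : t₁ < b)
    (hbt₂ : b < t₂) (hyb : y b = yFold A - η) (hmb : F A (y b) ≤ m b)
    (hmb' : m b ≤ F A (y b) + η / 2) :
    ∃ c, b < c ∧ c < t₄ ∧ 1 ≤ y c ∧ m c = F A (y c) + η ∧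
      (∀ t ∈ Icc b c, yFold A - η ≤ y t ∧ F A (y t) ≤ m t ∧ |m t - muFold A| ≤ (A + 2) * η) ∧
      (∀ t ∈ Icc c t₄, 1 ≤ y t ∧ |m t - F A (y t)| ≤ η ∧ m t ≤ muFold A + η) := by
  obtain ⟨P, hη, hη2, hd, hdl, hηA, hgap, hηd, hσ₁, hσ₂⟩ := S
  have hA := P.hA
  have hA0 : 0 < A := by linarith
  have hδ := P.hδ
  have hl1 := P.hl1
  have hμ1 : 0 < muFold A := by rw [muFold]; positivity
  have hσ0 : 0 ≤ √δ := Real.sqrt_nonneg δ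
  have hσ4 : 4 * √δ ≤ η := by linarith [mul_nonneg hμ1.le hσ0]
  have hss : √δ * √δ = δ := Real.mul_self_sqrt hδ.le
  have hδη : 16 * δ ≤ η ^ 2 := by
    have := pow_le_pow_left₀ (mul_nonneg zero_le_four hσ0) hσ4 2
    linarith
  have hf1 := yFold_lt_one hA
  have hFμ : ∀ y ≤ 1, F A y = muFold A - A * (y - yFold A) ^ 2 := fun y hy => F_eq_muFold_sub hA hy
  have hf0 : 1 / 2 < yFold A := by rw [yFold, lt_div_iff₀ (by linarith)]; linarith
  set f := yFold A with hf
  set μF := muFold A with hμF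
  set Y := μF + 2 with hY
  have hb0 : 0 ≤ b := hL.h01.le.trans hb.le
  have ht₂0 : 0 ≤ t₂ := hb0.trans hbt₂.le
  have hyl : ∀ t ∈ Icc b t₂, y t ≤ l := fun t ht => hL.le_l t ⟨hb.le.trans ht.1, ht.2⟩
  have hAη2 : A * η ^ 2 ≤ η := by
    linarith [mul_le_mul_of_nonneg_right hηA.le hη.le]
  have hAη0 : 0 < A * η := by positivity
  have hFb : F A (y b) = μF - A * η ^ 2 := by
    rw [hFμ _ (by rw [hyb]; linarith), hyb]; ring
  -- between the fold and `y = l`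
  have hN0 : ∀ t ∈ Icc b t₂, F A (y t) ≤ m t := fun t ht => by
    have := h.barrier' (-A) 0 0 (1 + A) (-1) 0 (t₀ := b) (t₁ := t₂) hb0
      (by rw [F_left (by rw [hyb]; linarith)] at hmb; linarith) (fun t ht hz => by
        have e1 : m t - F A (y t) = 0 := by
          rw [F_left ((hyl t ⟨ht.1, ht.2.le⟩).trans hl1.le)]; linarith
        rw [e1]
        have := hL.left t ⟨hb.trans_le ht.1, ht.2⟩
        have : 0 < δ * (l - y t) := mul_pos hδ (by linarith)
        linarith) t ht
    rw [F_left ((hyl t ht).trans hl1.le)]; linarith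
  have hyf : ∀ t ∈ Icc b t₂, f - η ≤ y t := fun t ht => by
    have := add_mul_le_of_le_deriv (c := 0) (h.cy (b := t₂) hb0) (fun t ht => h.dy (hb0.trans ht.1))
      (fun t ht => by linarith [hN0 t ⟨ht.1, ht.2.le⟩]) t ht
    linarith
  have hm1 : ∀ t ∈ Icc b t₂, m t ≤ μF + η := fun t ht => by
    have hK : 4 * δ / η * η = 4 * δ := by field_simp
    set K := 4 * δ / η with hKdef
    have hK0 : 0 < K := by positivity
    have hK4 : K ≤ η / 4 := by rw [hKdef, div_le_iff₀ hη]; linarith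
    have := h.barrier' 0 0 0 (-K) 1 (-μF - η / 2 + K * (f - η)) (t₀ := b) (t₁ := t₂) hb0
      (by rw [hyb]; have : 0 < A * η ^ 2 := by positivity
          linarith) (fun t ht hz => by
        have ht' : t ∈ Icc b t₂ := ⟨ht.1, ht.2.le⟩
        have e1 := hyf t ht'
        have e2 := hyl t ht'
        have e3 : η / 2 ≤ m t - F A (y t) := by
          rw [hFμ _ (e2.trans hl1.le)]
          have : 0 ≤ A * (y t - f) ^ 2 := by positivity
          have : 0 ≤ K * (y t - (f - η)) := mul_nonneg hK0.le (by linarith)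
          linarith
        have e4 : K * (η / 2) ≤ K * (m t - F A (y t)) := mul_le_mul_of_nonneg_left e3 hK0.le
        have e5 : δ * (l - y t) < δ * 1 := mul_lt_mul_of_pos_left (by linarith) hδ
        linarith) t ht
    have e1 : K * (y t - (f - η)) ≤ K * 1 :=
      mul_le_mul_of_nonneg_left (by linarith [hyl t ht]) hK0.le
    linarith
  have hm2 : ∀ t ∈ Icc b t₂, μF - A * η ^ 2 ≤ m t := fun t ht => by
    have := h.le_m P hb0 (b := t₂) (fun s hs => hyl s ⟨hs.1, hs.2.le⟩) t ht
    linarith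
  have hmt₂ := hm2 t₂ ⟨hbt₂.le, le_rfl⟩
  have hmt₂' := hm1 t₂ ⟨hbt₂.le, le_rfl⟩
  -- right of `y = l`
  have hFl : F A l + A * d ^ 2 ≤ μF := by
    rw [hFμ l hl1.le]
    linarith [mul_le_mul_of_nonneg_left (pow_le_pow_left₀ hd.le (show d ≤ l - f by linarith) 2)
      hA0.le]
  have h24 : t₂ < t₄ := hL.h23.trans hR.hab
  have hly : ∀ t ∈ Icc t₂ t₄, l ≤ y t := fun t ht => by
    rcases le_total t t₃ with h2 | h2
    · exact (hL.up t ⟨ht.1, h2⟩).1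
    · exact hl1.le.trans (hR.le t ⟨h2, ht.2⟩)
  have hmle : ∀ t ∈ Icc t₂ t₄, m t ≤ μF + η := fun t ht =>
    (h.m_le P ht₂0 (b := t₄) (fun s hs => hly s ⟨hs.1, hs.2.le⟩) t ht).trans hmt₂'
  obtain ⟨c, hc, hNc, hltc⟩ := exists_first_le (f := fun t => m t - F A (y t)) (c := η) h24.le
    (h.cN ht₂0) (by simp only [hL.eq₂]; linarith) (by
      simp only [hR.eq_b, F_left le_rfl]; linarith [hR.lt_one])
  have hge : ∀ t ∈ Icc t₂ c, F A (y t) + η ≤ m t := fun t ht => by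
    rcases eq_or_lt_of_le ht.2 with h1 | h1
    · rw [h1]; linarith
    · linarith [hltc t ⟨ht.1, h1⟩]
  have hyY : ∀ t ∈ Icc t₂ c, y t - l ≤ Y := fun t ht => by
    have h1 := hmle t ⟨ht.1, ht.2.trans hc.2⟩
    have h2 := hge t ht
    have h3 := P.l_pos
    rcases le_total (y t) 1 with h4 | h4
    · linarith
    · rw [F_eq_of_ge h4] at h2
      have : 0 ≤ (y t - 1) * (A * y t) :=
        mul_nonneg (by linarith) (mul_nonneg hA0.le (by linarith))
      linarith
  have hm3 : ∀ t ∈ Icc t₂ c, m t₂ - η ≤ m t := fun t ht => by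
    have hK : δ * Y / η * η = δ * Y := by field_simp
    set K := δ * Y / η with hKdef
    have hY0 : 0 < Y := by linarith
    have hK0 : 0 < K := by positivity
    have hKY : K * Y ≤ η := by
      have e1 : (Y * √δ) ^ 2 ≤ (η / 2) ^ 2 := pow_le_pow_left₀ (by positivity) (by linarith) 2
      have e2 : (Y * √δ) ^ 2 = Y ^ 2 * δ := by rw [mul_pow, pow_two √δ, hss]
      rw [hKdef, div_mul_eq_mul_div, div_le_iff₀ hη]
      linarith [sq_nonneg η]
    have := h.barrier 0 0 0 (-K) (-1) (m t₂ + K * l) (t₀ := t₂) (t₁ := c) ht₂0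
      (by rw [hL.eq₂]; linarith) (fun t ht _ => by
        have ht' : t ∈ Icc t₂ c := ⟨ht.1, ht.2.le⟩
        have e1 : K * η ≤ K * (m t - F A (y t)) :=
          mul_le_mul_of_nonneg_left (by linarith [hge t ht']) hK0.le
        have e2 : δ * (y t - l) ≤ δ * Y := mul_le_mul_of_nonneg_left (hyY t ht') hδ.le
        linarith) t ht
    have e1 : K * (y t - l) ≤ K * Y := mul_le_mul_of_nonneg_left (hyY t ht) hK0.le
    linarith
  have hyc : 1 ≤ y c := by
    by_contra! h1
    have h2 := hm3 c ⟨hc.1.le, le_rfl⟩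
    have h3 := hly c ⟨hc.1.le, hc.2⟩
    have h4 : F A (y c) + A * d ^ 2 ≤ μF := by
      rw [hFμ _ h1.le]
      linarith [mul_le_mul_of_nonneg_left
        (pow_le_pow_left₀ hd.le (show d ≤ y c - f by linarith) 2) hA0.le]
    linarith
  have hc3 : t₃ ≤ c := by
    by_contra! h1
    linarith [hL.lt_one c ⟨hL.h01.trans (hL.h12.trans hc.1), h1⟩]
  have hct : c < t₄ := lt_of_le_of_ne hc.2 fun h1 => by
    rw [h1, hR.eq_b, F_left le_rfl] at hNc
    linarith [hR.lt_one]
  have hc0 : 0 ≤ c := ht₂0.trans hc.1.le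
  refine ⟨c, hbt₂.trans hc.1, hct, hyc, by linarith, fun t ht => ?_, fun t ht => ?_⟩
  · rw [abs_le]
    rcases le_total t t₂ with h1 | h1
    · have e1 := hm1 t ⟨ht.1, h1⟩
      have e2 := hm2 t ⟨ht.1, h1⟩
      exact ⟨hyf t ⟨ht.1, h1⟩, hN0 t ⟨ht.1, h1⟩, by linarith, by linarith⟩
    · have e1 := hmle t ⟨h1, ht.2.trans hc.2⟩
      have e2 := hm3 t ⟨h1, ht.2⟩
      have e3 := hge t ⟨h1, ht.2⟩
      have e4 := hly t ⟨h1, ht.2.trans hc.2⟩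
      exact ⟨by linarith, by linarith, by linarith, by linarith⟩
  · have e0 : t ∈ Icc t₃ t₄ := ⟨hc3.trans ht.1, ht.2⟩
    have e1 := hR.le t e0
    have e2 := hmle t ⟨hc.1.le.trans ht.1, ht.2⟩
    have e3 := hR.above t e0
    refine ⟨e1, abs_le.2 ⟨?_, ?_⟩, e2⟩
    · have e4 : y t - l ≤ Y := by
        rw [F_eq_of_ge e1] at e3
        have h1 : 1 ≤ A * y t := one_le_mul_of_one_le_of_one_le hA.le e1
        have h2 : 0 ≤ (y t - 1) * (A * y t - √δ) := mul_nonneg (by linarith) (by linarith)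
        have h3 : √δ * (1 - l) ≤ 1 * 1 :=
          mul_le_mul (by linarith) (by linarith [P.l_pos]) (by linarith) zero_le_one
        have h4 : √δ * (y t - l) = √δ * (y t - 1) + √δ * (1 - l) := by ring
        linarith
      have e5 : √δ * (y t - l) ≤ √δ * Y := mul_le_mul_of_nonneg_left e4 hσ0
      linarith
    · have := h.barrier (-A) 0 0 (-(1 - A)) 1 (-η) (t₀ := c) (t₁ := t₄) hc0
        (by rw [F_right hyc] at hNc; linarith) (fun t ht hp => by
          have h1 := hR.le t ⟨hc3.trans ht.1, ht.2.le⟩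
          have h2 : η < m t - F A (y t) := by rw [F_right h1]; linarith
          have h3 : 0 ≤ (2 * A * y t + (1 - A)) * (m t - F A (y t)) :=
            mul_nonneg (by linarith [mul_le_mul_of_nonneg_left h1 hA0.le]) (by linarith)
          have h4 : 0 ≤ δ * (y t - l) := mul_nonneg hδ.le (by linarith)
          linarith) t ht
      rw [F_right e1]; linarith

theorem exists_phases {d η : ℝ} (S : Small A δ l d η) (h : Sol A δ l y m) (h0 : y 0 = 1)
    (h0' : 1 - √δ * (1 - l) ≤ m 0) (hm0 : m 0 ≤ 1) (hL : LeftTurn A l y m t₁ t₂ t₃)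
    (hR : RightTurn A δ l y m t₃ t₄) : ∃ a b c, Phases A η y m t₄ a b c := by
  obtain ⟨a, b, h1, h2, h3, h4, h5, h6, h7, h8, h9⟩ := exists_left_phases S h h0 h0' hm0 hL
  obtain ⟨c, g1, g2, g3, g4, g5, g6⟩ :=
    exists_right_phases S h hL hR (h1.trans h2) h3 h5 h8 h9
  exact ⟨a, b, c, (hL.h01.trans h1).le, h2.le, g1.le, g2.le, h0, h4, h5, g3, hR.eq_b, h6, h7, g5, g6,
    g4.le⟩

end Stommel

namespace Stommel
open PlanarODE

variable {A δ l : ℝ} {y m : ℝ → ℝ} {t₄ a b c η ε : ℝ}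

/-! ### Relaxation oscillations: comparison with the singular cycle -/

theorem continuous_F (A : ℝ) : Continuous (F A) := by unfold F; fun_prop

theorem sub_le_F_sub (hA : 1 < A) {y z : ℝ} (hy : 1 ≤ y) (hyz : y ≤ z) : z - y ≤ F A z - F A y := by
  rw [F_right hy, F_right (hy.trans hyz)]
  have h1 : 0 ≤ z - y := by linarith
  have h2 : (1 - A) * z + A * z ^ 2 - ((1 - A) * y + A * y ^ 2) - (z - y)
    = (z - y) * (A * (z + y - 1)) := by ring
  have := mul_nonneg h1 (mul_nonneg (show 0 ≤ A by linarith) (show 0 ≤ z + y - 1 by linarith))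
  linarith

/-- The end point of the jump from the fold. -/
theorem exists_landing (hA : 1 < A) : ∃ y, 1 < y ∧ F A y = muFold A := by
  have hμ : 1 < muFold A := by
    rw [muFold, lt_div_iff₀ (by linarith)]; nlinarith [sq_pos_of_pos (sub_pos.2 hA)]
  have h1 : F A 1 = 1 := by rw [F_left le_rfl]; ring
  have h2 := sub_le_F_sub hA le_rfl hμ.le
  obtain ⟨y, hy, hy'⟩ := intermediate_value_Icc hμ.le (continuous_F A).continuousOn
    (show muFold A ∈ Icc (F A 1) (F A (muFold A)) from ⟨by linarith, by linarith⟩)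
  refine ⟨y, lt_of_le_of_ne hy.1 fun h => ?_, hy'⟩
  rw [← h, h1] at hy'
  linarith

theorem F_le_muFold (hA : 1 < A) {y : ℝ} (hy : y ≤ 1) : F A y ≤ muFold A := by
  rw [F_eq_muFold_sub hA hy]
  have : 0 ≤ A * (y - yFold A) ^ 2 := mul_nonneg (by linarith) (sq_nonneg _)
  linarith

theorem dist_lt_of_abs {p q : ℝ × ℝ} (h1 : |p.1 - q.1| < ε) (h2 : |p.2 - q.2| < ε) :
    dist p q < ε := by
  rw [Prod.dist_eq, Real.dist_eq, Real.dist_eq]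
  exact max_lt h1 h2

theorem mem_bottom (hA : 1 < A) {z : ℝ} (h1 : 1 / A ≤ z) (h2 : z ≤ 1) :
    (z, (1:ℝ)) ∈ singularCycle A := by
  refine Or.inr ⟨rfl, h2, ?_⟩
  show 1 ≤ F A z
  rw [F_eq_of_le h2]
  rw [div_le_iff₀ (by linarith)] at h1
  have := mul_nonneg (sub_nonneg.2 h2) (show 0 ≤ A * z - 1 by linarith)
  linarith

theorem mem_left (hA : 1 < A) {z : ℝ} (h1 : 1 / A ≤ z) (h2 : z < yFold A) :
    (z, F A z) ∈ singularCycle A := by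
  refine Or.inl (Or.inl (Or.inl ⟨subset_closure ⟨rfl, h2⟩, ?_⟩))
  show 1 ≤ F A z
  have h3 := yFold_lt_one hA
  rw [F_eq_of_le (h2.trans h3).le]
  rw [div_le_iff₀ (by linarith)] at h1
  have := mul_nonneg (sub_nonneg.2 (h2.trans h3).le) (show 0 ≤ A * z - 1 by linarith)
  linarith

theorem mem_top {z : ℝ} (h1 : yFold A ≤ z) (h2 : F A z ≤ muFold A) :
    (z, muFold A) ∈ singularCycle A := Or.inl (Or.inr ⟨rfl, h1, h2⟩)

theorem mem_right (hA : 1 < A) {z : ℝ} (h1 : 1 ≤ z) (h2 : F A z ≤ muFold A) :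
    (z, F A z) ∈ singularCycle A := by
  rcases eq_or_lt_of_le h1 with h3 | h3
  · have : F A z = 1 := by rw [← h3, F_left le_rfl]; ring
    rw [this]
    exact mem_bottom hA (by rw [← h3, div_le_one (by linarith)]; exact hA.le) h3.ge
  · exact Or.inl (Or.inl (Or.inr ⟨subset_closure ⟨rfl, h3⟩, h2⟩))

theorem singularCycle_cases (hA : 1 < A) {q : ℝ × ℝ} (hq : q ∈ singularCycle A) :
    (q.2 = F A q.1 ∧ 1 / A ≤ q.1 ∧ q.1 ≤ yFold A) ∨
    (q.2 = F A q.1 ∧ 1 ≤ q.1 ∧ F A q.1 ≤ muFold A) ∨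
    (q.2 = muFold A ∧ yFold A ≤ q.1 ∧ F A q.1 ≤ muFold A) ∨
    (q.2 = 1 ∧ 1 / A ≤ q.1 ∧ q.1 ≤ 1) := by
  have hA0 : 0 < A := by linarith
  have h1A : 1 / A ≤ 1 := by rw [div_le_one hA0]; exact hA.le
  have hinv : ∀ z : ℝ, z ≤ 1 → 1 ≤ F A z → 1 / A ≤ z := fun z hz hF => by
    rw [F_eq_of_le hz] at hF
    by_contra! h1
    have h2 := h1.trans_le h1A
    rw [lt_div_iff₀ hA0] at h1
    have := mul_pos (sub_pos.2 h2) (show 0 < 1 - A * z by linarith)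
    linarith
  have hgr : IsClosed {p : ℝ × ℝ | p.2 = F A p.1} :=
    isClosed_eq continuous_snd ((continuous_F A).comp continuous_fst)
  rcases hq with ((⟨h1, h2⟩ | ⟨h1, h2⟩) | h) | h
  · have hsub : leftBranch A ⊆ {p : ℝ × ℝ | p.2 = F A p.1} ∩ {p | p.1 ≤ yFold A} :=
      fun p hp => ⟨hp.1, le_of_lt hp.2⟩
    have h3 := closure_minimal hsub (hgr.inter (isClosed_le continuous_fst continuous_const)) h1
    have h4 : q.2 = F A q.1 := h3.1
    exact Or.inl ⟨h4, hinv _ (le_trans h3.2 (yFold_lt_one hA).le) (h4 ▸ h2), h3.2⟩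
  · have hsub : rightBranch A ⊆ {p : ℝ × ℝ | p.2 = F A p.1} ∩ {p | 1 ≤ p.1} :=
      fun p hp => ⟨hp.1, le_of_lt hp.2⟩
    have h3 := closure_minimal hsub (hgr.inter (isClosed_le continuous_const continuous_fst)) h1
    have h4 : q.2 = F A q.1 := h3.1
    exact Or.inr (Or.inl ⟨h4, h3.2, h4 ▸ h2⟩)
  · exact Or.inr (Or.inr (Or.inl h))
  · exact Or.inr (Or.inr (Or.inr ⟨h.1, hinv _ h.2.1 h.2.2, h.2.1⟩))

/-- A turn in four phases stays close to the singular cycle. -/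
theorem Phases.mem_thickening (hA : 1 < A) (hη : 0 < η) (hηA : η * A < 1)
    (hε : (3 * A + 4) * η < ε) (h : Phases A η y m t₄ a b c) :
    ∀ t ∈ Icc 0 t₄, (y t, m t) ∈ Metric.thickening ε (singularCycle A) := by
  intro t ht
  rw [Metric.mem_thickening_iff]
  have hA0 : 0 < A := by linarith
  have hη1 : 1 * η < A * η := mul_lt_mul_of_pos_right hA hη
  have hf1 := yFold_lt_one hA
  obtain ⟨r, hr1, hr⟩ := exists_landing hA
  -- points above the landing point
  have hland : 1 ≤ y t → muFold A ≤ F A (y t) → F A (y t) ≤ muFold A + (2 * A + 4) * η →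
      |m t - muFold A| ≤ (A + 2) * η → ∃ z ∈ singularCycle A, dist (y t, m t) z < ε := by
    intro h1 h2 h3 h4
    refine ⟨(r, muFold A), mem_top (by linarith) hr.le, dist_lt_of_abs ?_ (by dsimp only; linarith)⟩
    have h5 : r ≤ y t := by
      by_contra! h6
      have := sub_le_F_sub hA h1 h6.le
      linarith
    have := sub_le_F_sub hA hr1.le h5
    dsimp only
    rw [abs_of_nonneg (by linarith)]
    linarith
  rcases le_total t a with h1 | h1
  · obtain ⟨e1, e2, e3⟩ := h.jump₁ t ⟨ht.1, h1⟩
    exact ⟨(y t, 1), mem_bottom hA (by linarith) e2,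
      dist_lt_of_abs (by simp only [sub_self, abs_zero]; linarith) (by dsimp only; linarith)⟩
  rcases le_total t b with h2 | h2
  · obtain ⟨e1, e2, e3⟩ := h.slow₁ t ⟨h1, h2⟩
    rcases le_total (1 / A) (y t) with h3 | h3
    · exact ⟨(y t, F A (y t)), mem_left hA h3 (by linarith),
        dist_lt_of_abs (by simp only [sub_self, abs_zero]; linarith) (by dsimp only; linarith)⟩
    · have hw : A * (1 / A) = 1 := by field_simp
      have h4 : 1 / A ≤ 1 := by rw [div_le_one hA0]; exact hA.le
      refine ⟨(1 / A, 1), mem_bottom hA le_rfl h4, dist_lt_of_abs ?_ ?_⟩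
      · dsimp only
        rw [abs_lt]; constructor <;> linarith
      · rw [abs_le, F_eq_of_le (by linarith)] at e3
        have hAy : A * y t ≤ 1 := by linarith [mul_le_mul_of_nonneg_left h3 hA0.le]
        have hAy' : 1 - A * η ≤ A * y t := by linarith [mul_le_mul_of_nonneg_left e1 hA0.le]
        have hy0 : 0 < y t := by
          have : η < 1 / A := by rw [lt_div_iff₀ hA0]; exact hηA
          linarith
        have h5 : (1 - y t) * (1 - A * y t) ≤ 1 * (A * η) :=
          mul_le_mul (by linarith) (by linarith) (by linarith) zero_le_one
        have h6 : 0 ≤ (1 - y t) * (1 - A * y t) := mul_nonneg (by linarith) (by linarith)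
        dsimp only
        rw [abs_lt]; constructor <;> linarith
  rcases le_total t c with h3 | h3
  · obtain ⟨e1, e2, e3⟩ := h.jump₂ t ⟨h2, h3⟩
    rcases lt_or_ge (y t) (yFold A) with h4 | h4
    · exact ⟨(yFold A, muFold A), mem_top le_rfl (F_le_muFold hA hf1.le),
        dist_lt_of_abs (by dsimp only; rw [abs_lt]; constructor <;> linarith)
          (by dsimp only; linarith)⟩
    · rcases le_total (F A (y t)) (muFold A) with h5 | h5
      · exact ⟨(y t, muFold A), mem_top h4 h5,
          dist_lt_of_abs (by simp only [sub_self, abs_zero]; linarith) (by dsimp only; linarith)⟩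
      · rcases le_total 1 (y t) with h6 | h6
        · exact hland h6 h5 (by linarith [(abs_le.1 e3).2]) e3
        · exact ⟨(y t, muFold A), mem_top h4 (F_le_muFold hA h6),
            dist_lt_of_abs (by simp only [sub_self, abs_zero]; linarith) (by dsimp only; linarith)⟩
  · obtain ⟨e1, e2, e3⟩ := h.slow₂ t ⟨h3, ht.2⟩
    rcases le_total (F A (y t)) (muFold A) with h5 | h5
    · exact ⟨(y t, F A (y t)), mem_right hA e1 h5,
        dist_lt_of_abs (by simp only [sub_self, abs_zero]; linarith) (by dsimp only; linarith)⟩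
    · have := abs_le.1 e2
      exact hland e1 h5 (by linarith) (abs_le.2 ⟨by linarith, by linarith⟩)

/-- A turn in four phases passes close to every point of the singular cycle. -/
theorem Phases.exists_near (hA : 1 < A) (hη : 0 < η) (hε : (3 * A + 4) * η < ε)
    (hgap : 1 / A + η < yFold A - η) (hyc : ContinuousOn y (Icc 0 t₄))
    (h : Phases A η y m t₄ a b c) {q : ℝ × ℝ} (hq : q ∈ singularCycle A) :
    ∃ t, 0 ≤ t ∧ dist q (y t, m t) < ε := by
  have hA0 : 0 < A := by linarith
  have hη1 : 1 * η < A * η := mul_lt_mul_of_pos_right hA hη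
  have hf1 := yFold_lt_one hA
  have hw0 : 0 < 1 / A := by positivity
  have hmc : c ∈ Icc c t₄ := ⟨le_rfl, h.hc4⟩
  obtain ⟨c1, c2, c3⟩ := h.slow₂ c hmc
  obtain ⟨d1, d2, d3⟩ := h.jump₂ c ⟨h.hbc, le_rfl⟩
  rw [abs_le] at d3
  have hFc := h.Fc
  have h0a := h.h0a
  have hab := h.hab
  have hbc := h.hbc
  have hc4 := h.hc4
  -- the distance from a point beyond `y c`
  have hbeyond : ∀ z, y c ≤ z → F A z ≤ muFold A → z - y c ≤ (A + 3) * η ∧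
      F A z - F A (y c) ≤ (A + 3) * η := fun z hz hF => by
    have := sub_le_F_sub hA c1 hz
    constructor <;> linarith
  obtain ⟨q1, q2⟩ := q
  rcases singularCycle_cases hA hq with ⟨e1, e2, e3⟩ | ⟨e1, e2, e3⟩ | ⟨e1, e2, e3⟩ | ⟨e1, e2, e3⟩ <;>
    dsimp only at e1 e2 e3
  · -- left arc
    obtain ⟨z, hz1, hz2, hz3⟩ : ∃ z, 1 / A + η ≤ z ∧ z ≤ yFold A - η ∧ |q1 - z| ≤ η := by
      rcases le_total q1 (1 / A + η) with h1 | h1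
      · exact ⟨1 / A + η, le_rfl, hgap.le, abs_le.2 ⟨by linarith, by linarith⟩⟩
      · rcases le_total q1 (yFold A - η) with h2 | h2
        · exact ⟨q1, h1, h2, by simpa using hη.le⟩
        · exact ⟨yFold A - η, hgap.le, le_rfl, abs_le.2 ⟨by linarith, by linarith⟩⟩
    obtain ⟨t, ht, htz⟩ := intermediate_value_Icc hab
      (hyc.mono (Icc_subset_Icc h0a (hbc.trans hc4)))
      (show z ∈ Icc (y a) (y b) by rw [h.ya, h.yb]; exact ⟨hz1, hz2⟩)
    obtain ⟨f1, f2, f3⟩ := h.slow₁ t ht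
    refine ⟨t, h0a.trans ht.1, dist_lt_of_abs (by dsimp only; rw [htz]; linarith) ?_⟩
    dsimp only
    rw [htz] at f3
    have hF : |F A q1 - F A z| ≤ (1 + A) * η := by
      rw [F_left (e3.trans hf1.le), F_left (by linarith)]
      have : (1 + A) * q1 - A * q1 ^ 2 - ((1 + A) * z - A * z ^ 2)
        = (1 + A - A * (q1 + z)) * (q1 - z) := by ring
      rw [this, abs_mul]
      refine mul_le_mul ?_ hz3 (abs_nonneg _) (by linarith)
      have g1 : 0 ≤ A * (q1 + z) := mul_nonneg hA0.le (by linarith)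
      have g2 : A * (q1 + z) ≤ A * 2 := mul_le_mul_of_nonneg_left (by linarith) hA0.le
      rw [abs_le]; constructor <;> linarith
    rw [e1, abs_lt]
    rw [abs_le] at f3 hF
    constructor <;> linarith
  · -- right arc
    obtain ⟨z, hz1, hz2, hz3, hz4⟩ : ∃ z, 1 ≤ z ∧ z ≤ y c ∧ |q1 - z| ≤ (A + 3) * η ∧
        |F A q1 - F A z| ≤ (A + 3) * η := by
      rcases le_total q1 (y c) with h1 | h1
      · exact ⟨q1, e2, h1, by simp; positivity, by simp; positivity⟩
      · obtain ⟨g1, g2⟩ := hbeyond q1 h1 e3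
        have g3 := sub_le_F_sub hA c1 h1
        exact ⟨y c, c1, le_rfl, by rwa [abs_of_nonneg (by linarith)],
          by rwa [abs_of_nonneg (by linarith)]⟩
    obtain ⟨t, ht, htz⟩ := intermediate_value_Icc' hc4
      (hyc.mono (Icc_subset_Icc_left (h0a.trans (hab.trans hbc))))
      (show z ∈ Icc (y t₄) (y c) by rw [h.y4]; exact ⟨hz1, hz2⟩)
    obtain ⟨f1, f2, f3⟩ := h.slow₂ t ht
    refine ⟨t, (h0a.trans (hab.trans hbc)).trans ht.1,
      dist_lt_of_abs (by dsimp only; rw [htz]; linarith) ?_⟩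
    dsimp only
    rw [htz] at f2
    rw [e1, abs_lt]
    rw [abs_le] at f2 hz4
    constructor <;> linarith
  · -- upper segment
    obtain ⟨z, hz1, hz2, hz3⟩ : ∃ z, yFold A - η ≤ z ∧ z ≤ y c ∧ |q1 - z| ≤ (A + 3) * η := by
      rcases le_total q1 (y c) with h1 | h1
      · exact ⟨q1, by linarith, h1, by simp; positivity⟩
      · obtain ⟨g1, g2⟩ := hbeyond q1 h1 e3
        exact ⟨y c, d1, le_rfl, by rwa [abs_of_nonneg (by linarith)]⟩
    obtain ⟨t, ht, htz⟩ := intermediate_value_Icc hbc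
      (hyc.mono (Icc_subset_Icc (h0a.trans hab) hc4))
      (show z ∈ Icc (y b) (y c) by rw [h.yb]; exact ⟨hz1, hz2⟩)
    obtain ⟨f1, f2, f3⟩ := h.jump₂ t ht
    refine ⟨t, (h0a.trans hab).trans ht.1,
      dist_lt_of_abs (by dsimp only; rw [htz]; linarith) ?_⟩
    dsimp only
    rw [e1, abs_sub_comm]
    linarith
  · -- lower segment
    obtain ⟨z, hz1, hz2, hz3⟩ : ∃ z, 1 / A + η ≤ z ∧ z ≤ 1 ∧ |q1 - z| ≤ η := by
      rcases le_total q1 (1 / A + η) with h1 | h1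
      · exact ⟨1 / A + η, le_rfl, by linarith, abs_le.2 ⟨by linarith, by linarith⟩⟩
      · exact ⟨q1, h1, e3, by simpa using hη.le⟩
    obtain ⟨t, ht, htz⟩ := intermediate_value_Icc' h0a
      (hyc.mono (Icc_subset_Icc_right (hab.trans (hbc.trans hc4))))
      (show z ∈ Icc (y a) (y 0) by rw [h.ya, h.y0]; exact ⟨hz1, hz2⟩)
    obtain ⟨f1, f2, f3⟩ := h.jump₁ t ht
    refine ⟨t, ht.1, dist_lt_of_abs (by dsimp only; rw [htz]; linarith) ?_⟩
    dsimp only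
    rw [e1, abs_sub_comm]
    linarith

theorem isRelaxationOscillation {d : ℝ} (S : Small A δ l d η) (hε : (3 * A + 4) * η < ε)
    {Γ : Set (ℝ × ℝ)} (hΓ : IsPeriodicOrbit (field A δ l) Γ) :
    IsRelaxationOscillation A ε Γ := by
  have P := S.P
  have hδ1 : δ < 1 := by
    have h0 : 0 < muFold A := by rw [muFold]; have := P.hA; positivity
    have h1 : √δ < 1 := by
      have := S.σ₂; have := S.η_lt
      linarith [mul_nonneg h0.le (Real.sqrt_nonneg δ), Real.sqrt_nonneg δ]
    have h2 := Real.mul_self_sqrt P.hδ.le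
    nlinarith [Real.sqrt_nonneg δ]
  constructor
  · refine subset_of_turn P hδ1 hΓ fun y m t₁ t₂ t₃ t₄ hs h0 h0' h0'' hL hR => ?_
    obtain ⟨a, b, c, h⟩ := exists_phases S hs h0 h0' h0'' hL hR
    exact h.mem_thickening P.hA S.η_pos S.η_inv hε
  · obtain ⟨γ, hγ, hr, -, h0⟩ := exists_turn_of_periodic P hδ1 hΓ
    have hs := hγ.sol 0
    simp only [add_zero] at hs
    obtain ⟨t₁, t₂, t₃, t₄, hL, hR⟩ := hs.exists_turn P hδ1 h0.1 h0.2.2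
    obtain ⟨a, b, c, h⟩ := exists_phases S hs h0.1 h0.2.1 h0.2.2 hL hR
    intro q hq
    obtain ⟨t, -, ht⟩ := h.exists_near P.hA S.η_pos hε S.gap (hs.cy le_rfl) hq
    exact Metric.mem_thickening_iff.2 ⟨γ t, hr ▸ mem_range_self t, ht⟩

theorem exists_relaxation {A l₁ ε : ℝ} (hA : 1 < A) (hl₁ : (1 + A) / (2 * A) < l₁)
    (hε : 0 < ε) : ∃ δ₁ : ℝ, 0 < δ₁ ∧ ∀ δ₀ : ℝ, 0 < δ₀ → δ₀ < δ₁ →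
        1 + 2 * √δ₀ < A ∧
        ∀ l : ℝ, l₁ ≤ l → l < 1 → ∀ Γ : Set (ℝ × ℝ),
          IsPeriodicOrbit (field A δ₀ l) Γ → IsRelaxationOscillation A ε Γ := by
  have hA0 : 0 < A := by linarith
  have hd : 0 < l₁ - yFold A := by rw [yFold]; linarith
  set d := l₁ - yFold A with hdd
  have hwf : 1 / A < yFold A := by
    rw [yFold, div_lt_div_iff₀ hA0 (by linarith)]; nlinarith
  have hev : ∀ᶠ η : ℝ in 𝓝[>] 0, (η < 1 / 2 ∧ η * A < 1) ∧ 1 / A + η < yFold A - η ∧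
      2 * η + A * η ^ 2 < A * d ^ 2 ∧ (3 * A + 4) * η < ε := by
    refine nhdsWithin_le_nhds ?_
    have lt : ∀ f g : ℝ → ℝ, Continuous f → Continuous g → f 0 < g 0 → ∀ᶠ η in 𝓝 0, f η < g η :=
      fun f g hf hg h => hf.continuousAt.eventually_lt hg.continuousAt h
    refine ((lt _ _ (by fun_prop) (by fun_prop) (by norm_num)).and
      (lt _ _ (by fun_prop) (by fun_prop) (by norm_num))).and
      ((lt _ _ (by fun_prop) (by fun_prop) (by simpa using hwf)).and
      ((lt _ _ (by fun_prop) (by fun_prop) (by simp; positivity)).and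
      (lt _ _ (by fun_prop) (by fun_prop) (by simpa using hε))))
  obtain ⟨η, ⟨⟨h1, h2⟩, h3, h4, h5⟩, hη⟩ := (hev.and self_mem_nhdsWithin).exists
  have hη : 0 < η := hη
  have hμ : 0 < muFold A := by rw [muFold]; positivity
  set κ := min ((A - 1) / 2) (1 / (2 * (muFold A + 2))) with hκ
  have hκ0 : 0 < κ := lt_min (by linarith) (by positivity)
  refine ⟨(κ * η) ^ 2, by positivity, fun δ hδ hδ1 => ?_⟩
  have hσ : √δ < κ * η := by rwa [Real.sqrt_lt' (by positivity)]
  have hσ1 : 2 * √δ ≤ (A - 1) * η := by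
    have : κ * η ≤ (A - 1) / 2 * η := mul_le_mul_of_nonneg_right (min_le_left _ _) hη.le
    linarith
  have hσ2 : 2 * (muFold A + 2) * √δ ≤ η := by
    have : κ * η ≤ 1 / (2 * (muFold A + 2)) * η :=
      mul_le_mul_of_nonneg_right (min_le_right _ _) hη.le
    have h6 := mul_le_mul_of_nonneg_left (hσ.le.trans this)
      (show 0 ≤ 2 * (muFold A + 2) by positivity)
    have h7 : 2 * (muFold A + 2) * (1 / (2 * (muFold A + 2)) * η) = η := by field_simp
    linarith
  refine ⟨?_, fun l hl hl1 Γ hΓ => ?_⟩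
  · have : (A - 1) * η < (A - 1) * 1 := mul_lt_mul_of_pos_left (by linarith) (by linarith)
    linarith
  · have P : Params A δ l := ⟨hA, hδ, by
      have := hl₁.trans_le hl; rw [div_lt_iff₀ (by linarith)] at this; linarith, hl1⟩
    exact isRelaxationOscillation ⟨P, hη, h1, hd, by linarith, h2, h3, h4, hσ1, hσ2⟩ h5 hΓ

end Stommel

namespace Stommel
open PlanarODE

variable {A δ l : ℝ}

/-! ### The equilibrium is repelling -/

/-- The quadratic form `δ x² + v² + 2 σ x v`, where `x` and `v` are the coordinates relative to the
equilibrium. -/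
noncomputable def lyap (A δ l σ : ℝ) (q : ℝ × ℝ) : ℝ :=
  δ * (q.1 - l) ^ 2 + (q.2 - F A l) ^ 2 + 2 * σ * ((q.1 - l) * (q.2 - F A l))

theorem continuous_lyap (A δ l σ : ℝ) : Continuous (lyap A δ l σ) := by unfold lyap; fun_prop

/-- The choice of `σ` for which `lyap` decreases along the solutions in reversed time. -/
noncomputable def lyapCoeff (A δ l : ℝ) : ℝ :=
  δ * (2 * A * l - 1 - A) / ((2 * A * l - 1 - A) ^ 2 + 2 * δ)

theorem lyapCoeff_facts (P : Params A δ l) : 0 < lyapCoeff A δ l ∧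
    lyapCoeff A δ l * ((2 * A * l - 1 - A) ^ 2 + 2 * δ) = δ * (2 * A * l - 1 - A) ∧
    4 * lyapCoeff A δ l ^ 2 ≤ δ := by
  have hδ := P.hδ
  have hτ : 0 < 2 * A * l - 1 - A := by linarith [P.hl]
  refine ⟨by unfold lyapCoeff; positivity, by unfold lyapCoeff; field_simp, ?_⟩
  unfold lyapCoeff
  set τ := 2 * A * l - 1 - A
  rw [div_pow, ← mul_div_assoc, div_le_iff₀ (by positivity)]
  nlinarith [sq_nonneg (τ ^ 2), mul_pos hδ hδ, mul_pos hδ (mul_pos hδ hδ), sq_nonneg τ,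
    mul_nonneg hδ.le (sq_nonneg (τ ^ 2))]

theorem le_lyap (P : Params A δ l) (q : ℝ × ℝ) :
    δ / 2 * (q.1 - l) ^ 2 + 1 / 2 * (q.2 - F A l) ^ 2 ≤ lyap A δ l (lyapCoeff A δ l) q := by
  obtain ⟨h1, -, h3⟩ := lyapCoeff_facts P
  unfold lyap
  nlinarith [sq_nonneg (2 * lyapCoeff A δ l * (q.1 - l) + (q.2 - F A l)), sq_nonneg (q.1 - l)]

theorem lyap_le (P : Params A δ l) (q : ℝ × ℝ) :
    lyap A δ l (lyapCoeff A δ l) q ≤ 2 * δ * (q.1 - l) ^ 2 + 2 * (q.2 - F A l) ^ 2 := by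
  obtain ⟨h1, -, h3⟩ := lyapCoeff_facts P
  unfold lyap
  nlinarith [sq_nonneg (2 * lyapCoeff A δ l * (q.1 - l) - (q.2 - F A l)), sq_nonneg (q.1 - l)]

/-- The derivative of `lyap` in reversed time, near the equilibrium. -/
theorem lyap_deriv_le (P : Params A δ l) {q : ℝ × ℝ} {r : ℝ} (hr1 : l + r ≤ 1)
    (hr2 : 4 * A * r * (δ + lyapCoeff A δ l) ≤ δ * (2 * A * l - 1 - A))
    (hx : |q.1 - l| ≤ r) (hv : |q.2 - F A l| ≤ r) :
    (2 * δ * (q.1 - l) + 2 * lyapCoeff A δ l * (q.2 - F A l)) * (-(q.2 - F A q.1))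
      + (2 * (q.2 - F A l) + 2 * lyapCoeff A δ l * (q.1 - l)) * (-(δ * (l - q.1)))
    ≤ -(min ((2 * A * l - 1 - A) / 4) (lyapCoeff A δ l / 2)) *
        lyap A δ l (lyapCoeff A δ l) q := by
  obtain ⟨h1, h2, h3⟩ := lyapCoeff_facts P
  have hle := lyap_le P q
  have hA : 0 < A := by linarith [P.hA]
  have hδ := P.hδ
  have hτ : 0 < 2 * A * l - 1 - A := by linarith [P.hl]
  have hk1 := min_le_left ((2 * A * l - 1 - A) / 4) (lyapCoeff A δ l / 2)
  have hk2 := min_le_right ((2 * A * l - 1 - A) / 4) (lyapCoeff A δ l / 2)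
  have hk0 : 0 < min ((2 * A * l - 1 - A) / 4) (lyapCoeff A δ l / 2) :=
    lt_min (by linarith) (by linarith)
  set k := min ((2 * A * l - 1 - A) / 4) (lyapCoeff A δ l / 2)
  have hN : q.2 - F A q.1 = (q.2 - F A l) + (2 * A * l - 1 - A) * (q.1 - l)
      + A * (q.1 - l) ^ 2 := by
    rw [F_left (by linarith [(abs_le.1 hx).2]), F_left P.hl1.le]; ring
  rw [hN]
  set σ := lyapCoeff A δ l
  set τ := 2 * A * l - 1 - A
  set x := q.1 - l with hxd
  set v := q.2 - F A l
  set W := lyap A δ l σ q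
  have e0 : l - q.1 = -x := by rw [hxd]; ring
  rw [e0]
  have e1 : (2 * δ * x + 2 * σ * v) * (-(v + τ * x + A * x ^ 2)) + (2 * v + 2 * σ * x) * (-(δ * -x))
      = -(2 * δ * τ * x ^ 2) - 2 * σ * v ^ 2 + 2 * σ * δ * x ^ 2 - 2 * σ * τ * (x * v)
        - 2 * A * (δ * x + σ * v) * x ^ 2 := by ring
  rw [e1]
  have e2 : -(2 * σ * τ * (x * v)) ≤ σ * v ^ 2 + σ * τ ^ 2 * x ^ 2 := by
    have := mul_nonneg h1.le (sq_nonneg (v + τ * x))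
    nlinarith
  have e3 : -(2 * A * (δ * x + σ * v) * x ^ 2) ≤ δ * τ / 2 * x ^ 2 := by
    have g1 : -(2 * A * (δ * x + σ * v)) ≤ δ * τ / 2 := by
      have i1 : δ * (-x) ≤ δ * r := mul_le_mul_of_nonneg_left (by linarith [(abs_le.1 hx).1]) hδ.le
      have i2 : σ * (-v) ≤ σ * r := mul_le_mul_of_nonneg_left (by linarith [(abs_le.1 hv).1]) h1.le
      have i3 : A * (δ * (-x) + σ * (-v)) ≤ A * (δ * r + σ * r) :=
        mul_le_mul_of_nonneg_left (by linarith) hA.le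
      linarith
    have := mul_le_mul_of_nonneg_right g1 (sq_nonneg x)
    linarith
  have e4 : σ * τ ^ 2 * x ^ 2 + 2 * σ * δ * x ^ 2 = δ * τ * x ^ 2 := by
    linear_combination x ^ 2 * h2
  have e5 : k * W ≤ k * (2 * δ * x ^ 2 + 2 * v ^ 2) := mul_le_mul_of_nonneg_left hle hk0.le
  have e6 : k * (2 * δ * x ^ 2) ≤ τ / 4 * (2 * δ * x ^ 2) :=
    mul_le_mul_of_nonneg_right hk1 (by positivity)
  have e7 : k * (2 * v ^ 2) ≤ σ / 2 * (2 * v ^ 2) :=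
    mul_le_mul_of_nonneg_right hk2 (by positivity)
  linarith

theorem isRepellingEquilibrium (P : Params A δ l) :
    IsRepellingEquilibrium (field A δ l) (l, F A l) := by
  have hA : 0 < A := by linarith [P.hA]
  have hδ := P.hδ
  have hτ : 0 < 2 * A * l - 1 - A := by linarith [P.hl]
  obtain ⟨h1, h2, h3⟩ := lyapCoeff_facts P
  set σ := lyapCoeff A δ l with hσ
  set k := min ((2 * A * l - 1 - A) / 4) (σ / 2) with hk
  have hk0 : 0 < k := lt_min (by linarith) (by linarith)
  set r := min (1 - l) (δ * (2 * A * l - 1 - A) / (4 * A * (δ + σ))) with hr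
  have hr0 : 0 < r := lt_min (by linarith [P.hl1]) (by positivity)
  have hr1 : l + r ≤ 1 := by linarith [min_le_left (1 - l) (δ * (2 * A * l - 1 - A) / (4 * A * (δ + σ)))]
  have hr2 : 4 * A * r * (δ + σ) ≤ δ * (2 * A * l - 1 - A) := by
    have := min_le_right (1 - l) (δ * (2 * A * l - 1 - A) / (4 * A * (δ + σ)))
    rw [← hr, le_div_iff₀ (by positivity)] at this
    linarith
  set W := lyap A δ l σ with hW
  have hWc : Continuous W := continuous_lyap A δ l σ
  -- small values of `W` confine to a small box
  set c := min (δ / 2) (1 / 2) with hc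
  have hc0 : 0 < c := lt_min (by linarith) (by norm_num)
  have hbox : ∀ ρ > 0, ∀ q : ℝ × ℝ, W q < c * ρ ^ 2 → |q.1 - l| ≤ ρ ∧ |q.2 - F A l| ≤ ρ := by
    intro ρ hρ q hq
    have e1 := le_lyap P q
    have e2 : c * (q.1 - l) ^ 2 ≤ δ / 2 * (q.1 - l) ^ 2 :=
      mul_le_mul_of_nonneg_right (min_le_left _ _) (sq_nonneg _)
    have e3 : c * (q.2 - F A l) ^ 2 ≤ 1 / 2 * (q.2 - F A l) ^ 2 :=
      mul_le_mul_of_nonneg_right (min_le_right _ _) (sq_nonneg _)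
    have e4 := mul_nonneg hc0.le (sq_nonneg (q.1 - l))
    have e5 := mul_nonneg hc0.le (sq_nonneg (q.2 - F A l))
    constructor
    · refine abs_le_of_sq_le_sq (le_of_mul_le_mul_left ?_ hc0) hρ.le; linarith
    · refine abs_le_of_sq_le_sq (le_of_mul_le_mul_left ?_ hc0) hρ.le; linarith
  have hWp : W (l, F A l) = 0 := by simp [hW, lyap]
  have hderiv : ∀ (γ : ℝ → ℝ × ℝ) (t : ℝ), HasDerivWithinAt γ (-field A δ l (γ t)) (Ici t) t →
      HasDerivWithinAt (fun t => W (γ t))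
        ((2 * δ * ((γ t).1 - l) + 2 * σ * ((γ t).2 - F A l)) * (-((γ t).2 - F A (γ t).1))
      + (2 * ((γ t).2 - F A l) + 2 * σ * ((γ t).1 - l)) * (-(δ * (l - (γ t).1)))) (Ici t) t := by
    intro γ t h
    rw [field_eq] at h
    have d1 := ((hasFDerivWithinAt_iff_hasDerivWithinAt.1 h.hasFDerivWithinAt.fst).congr_deriv
      (show _ = -((γ t).2 - F A (γ t).1) by simp)).sub_const l
    have d2 := ((hasFDerivWithinAt_iff_hasDerivWithinAt.1 h.hasFDerivWithinAt.snd).congr_deriv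
      (show _ = -(δ * (l - (γ t).1)) by simp)).sub_const (F A l)
    have := (((d1.fun_pow 2).const_mul δ).fun_add (d2.fun_pow 2)).fun_add
      ((d1.fun_mul d2).const_mul (2 * σ))
    exact this.congr_deriv (by push_cast; ring)
  -- confinement and decay
  have hdecay : ∀ (S : ℝ) (γ : ℝ → ℝ × ℝ), 0 ≤ S → W (γ 0) < c * r ^ 2 →
      ContinuousOn γ (Icc 0 S) →
      (∀ t ∈ Ico 0 S, HasDerivWithinAt γ (-field A δ l (γ t)) (Ici t) t) →
      W (γ S) ≤ W (γ 0) * Real.exp (-k * S) := by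
    intro S γ hS h0 hγc hγ
    have hd : ∀ t ∈ Ico 0 S, W (γ t) < c * r ^ 2 →
        (2 * δ * ((γ t).1 - l) + 2 * σ * ((γ t).2 - F A l)) * (-((γ t).2 - F A (γ t).1))
        + (2 * ((γ t).2 - F A l) + 2 * σ * ((γ t).1 - l)) * (-(δ * (l - (γ t).1)))
        ≤ -k * W (γ t) := fun t ht hWt => by
      obtain ⟨b1, b2⟩ := hbox r hr0 _ hWt
      exact lyap_deriv_le P hr1 hr2 b1 b2
    have hcW : ContinuousOn (fun t => W (γ t)) (Icc 0 S) := hWc.comp_continuousOn hγc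
    have hlt : ∀ t ∈ Icc 0 S, W (γ t) < c * r ^ 2 := by
      by_contra! hcon
      obtain ⟨t, ht, hWt⟩ := hcon
      obtain ⟨u, hu, hu1, hu2⟩ := exists_first_ge ht.1 (hcW.mono (Icc_subset_Icc_right ht.2)) h0 hWt
      have huS : u ≤ S := hu.2.trans ht.2
      have := le_left_of_deriv_nonpos (hcW.mono (Icc_subset_Icc_right huS))
        (fun t ht => hderiv γ t (hγ t ⟨ht.1, ht.2.trans_le huS⟩)) (fun t ht => by
          have g1 := hd t ⟨ht.1, ht.2.trans_le huS⟩ (hu2 t ht)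
          have g2 : 0 ≤ W (γ t) := le_trans (by positivity) (le_lyap P (γ t))
          nlinarith) u ⟨hu.1.le, le_rfl⟩
      linarith
    have := le_left_of_deriv_nonpos (a := 0) (b := S)
      (g := fun t => W (γ t) * Real.exp (k * t)) (g' := fun t =>
        (((2 * δ * ((γ t).1 - l) + 2 * σ * ((γ t).2 - F A l)) * (-((γ t).2 - F A (γ t).1))
        + (2 * ((γ t).2 - F A l) + 2 * σ * ((γ t).1 - l)) * (-(δ * (l - (γ t).1))))
          + k * W (γ t)) * Real.exp (k * t)) (by fun_prop)
      (fun t ht => by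
        have h4 : HasDerivWithinAt (fun t => Real.exp (k * t))
            (Real.exp (k * t) * (k * 1)) (Ici t) t :=
          (((hasDerivAt_id t).const_mul k).exp).hasDerivWithinAt
        exact ((hderiv γ t (hγ t ht)).fun_mul h4).congr_deriv (by ring))
      (fun t ht => mul_nonpos_of_nonpos_of_nonneg
        (by linarith [hd t ht (hlt t ⟨ht.1, ht.2.le⟩)]) (Real.exp_pos _).le) S ⟨hS, le_rfl⟩
    simp only [mul_zero, Real.exp_zero, mul_one] at this
    have h5 := mul_le_mul_of_nonneg_right this (Real.exp_pos (-k * S)).le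
    rwa [mul_assoc, ← Real.exp_add, show k * S + -k * S = 0 by ring, Real.exp_zero, mul_one] at h5
  have hdecay' : ∀ γ, IsForwardSolution (fun q => -field A δ l q) γ → W (γ 0) < c * r ^ 2 →
      ∀ t ≥ 0, W (γ t) ≤ W (γ 0) * Real.exp (-k * t) := fun γ hγ h0 t ht =>
    hdecay t γ ht h0 (hγ.continuousOn.mono Icc_subset_Ici_self)
      (fun s hs => hγ.hasDerivWithinAt hs.1)
  have hdist : ∀ ρ > 0, ∀ q : ℝ × ℝ, W q < c * ρ ^ 2 → dist q (l, F A l) ≤ ρ := fun ρ hρ q hq => by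
    rw [Prod.dist_eq, Real.dist_eq, Real.dist_eq]
    exact max_le (hbox ρ hρ q hq).1 (hbox ρ hρ q hq).2
  have hnhd : ∀ w > 0, {q | W q < w} ∈ 𝓝 (l, F A l) := fun w hw =>
    hWc.continuousAt.eventually_lt_const (by rwa [hWp])
  have hW0 : ∀ q, 0 ≤ W q := fun q => le_trans (by positivity) (le_lyap P q)
  refine ⟨(field_eq_zero_iff P _).2 rfl, ?_, ?_⟩
  · intro U hU
    rw [nhdsSet_singleton] at hU ⊢
    obtain ⟨ρ, hρ, hρU⟩ := Metric.nhds_basis_closedBall.mem_iff.1 hU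
    refine ⟨{q | W q < min (c * r ^ 2) (c * ρ ^ 2)},
      hnhd _ (lt_min (by positivity) (by positivity)), fun γ hγ h0 t ht => hρU ?_⟩
    have h0 : W (γ 0) < min (c * r ^ 2) (c * ρ ^ 2) := h0
    refine hdist ρ hρ _ ((hdecay' γ hγ (h0.trans_le (min_le_left _ _)) t ht).trans_lt ?_)
    refine lt_of_le_of_lt (mul_le_of_le_one_right (hW0 _) (Real.exp_le_one_iff.2 (by nlinarith)))
      (h0.trans_le (min_le_right _ _))
  · refine ⟨{q | W q < c * r ^ 2}, by
      rw [nhdsSet_singleton]; exact hnhd _ (by positivity), fun p hp => ⟨?_, ?_⟩⟩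
    · refine exists_isForwardSolution (lipschitzOnBalls_field A δ l).neg p fun T _ =>
        ⟨r + ‖((l, F A l) : ℝ × ℝ)‖ + 1, fun S γ hS _ h0 hγc hγ => ?_⟩
      have h5 := hdecay S γ hS (by rw [h0]; exact hp) hγc hγ
      have h6 : W (γ S) < c * r ^ 2 := by
        rw [h0] at h5
        exact (h5.trans (mul_le_of_le_one_right (hW0 _)
          (Real.exp_le_one_iff.2 (by nlinarith)))).trans_lt hp
      have h7 := hdist r hr0 _ h6
      rw [dist_eq_norm] at h7
      linarith [norm_le_norm_sub_add (γ S) (l, F A l)]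
    · intro γ hγ h0
      have hlim : Tendsto (fun t => W (γ 0) * Real.exp (-k * t)) atTop (𝓝 0) := by
        have h8 : Tendsto (fun t : ℝ => -k * t) atTop atBot :=
          tendsto_id.const_mul_atTop_of_neg (by linarith)
        simpa using (Real.tendsto_exp_atBot.comp h8).const_mul (W (γ 0))
      simp only [Metric.infDist_singleton]
      rw [Metric.tendsto_atTop]
      intro ε hε
      have := hlim.eventually (gt_mem_nhds (show 0 < c * (ε / 2) ^ 2 by positivity))
      obtain ⟨N, hN⟩ := (this.and (eventually_ge_atTop 0)).exists_forall_of_atTop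
      refine ⟨N, fun t ht => ?_⟩
      obtain ⟨h9, h10⟩ := hN t ht
      have h11 := hdist (ε / 2) (by positivity) _
        ((hdecay' γ hγ (by rw [h0]; exact hp) t h10).trans_lt h9)
      rw [Real.dist_0_eq_abs, abs_of_nonneg dist_nonneg]
      linarith

end Stommel

namespace Volterra

/-! ### Linear Volterra equations on the unit interval -/

/-- The continuous functions on the unit interval. -/
abbrev CI := C(Icc (0 : ℝ) 1, ℝ)

/-- The extension of a function on the unit interval by constants. -/
noncomputable def ext (f : CI) : ℝ → ℝ := IccExtend zero_le_one f

theorem continuous_ext (f : CI) : Continuous (ext f) := f.continuous.Icc_extend'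

theorem ext_of_mem (f : CI) {t : ℝ} (ht : t ∈ Icc (0 : ℝ) 1) : ext f t = f ⟨t, ht⟩ :=
  IccExtend_of_mem _ _ ht

theorem ext_val (f : CI) (t : Icc (0 : ℝ) 1) : ext f t = f t := IccExtend_val _ _ _

theorem abs_ext_le (f : CI) (t : ℝ) : |ext f t| ≤ ‖f‖ := f.norm_coe_le_norm _

theorem ext_ext {f g : CI} (h : ∀ t ∈ Icc (0 : ℝ) 1, ext f t = ext g t) : f = g := by
  ext t
  rw [← ext_val, ← ext_val, h t t.2]

/-- The primitive that vanishes at `0`. -/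
noncomputable def prim : CI →L[ℝ] CI :=
  LinearMap.mkContinuous
    { toFun := fun f => ⟨fun t => ∫ s in (0 : ℝ)..t, ext f s,
        (intervalIntegral.continuous_primitive
          (fun a b => (continuous_ext f).intervalIntegrable a b) 0).comp continuous_subtype_val⟩
      map_add' := fun f g => by
        ext t
        exact intervalIntegral.integral_add ((continuous_ext f).intervalIntegrable _ _)
          ((continuous_ext g).intervalIntegrable _ _)
      map_smul' := fun a f => by
        ext t
        exact intervalIntegral.integral_const_mul a (ext f) } 1 (fun f => by
      rw [one_mul, ContinuousMap.norm_le _ (norm_nonneg f)]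
      intro t
      have := intervalIntegral.norm_integral_le_of_norm_le_const (a := 0) (b := (t : ℝ))
        (C := ‖f‖) (f := ext f) (fun s _ => abs_ext_le f s)
      refine this.trans ?_
      rw [sub_zero, abs_of_nonneg t.2.1]
      exact mul_le_of_le_one_right (norm_nonneg f) t.2.2)

theorem prim_apply (f : CI) (t : Icc (0 : ℝ) 1) : prim f t = ∫ s in (0 : ℝ)..t, ext f s := rfl

theorem ext_prim (f : CI) {t : ℝ} (ht : t ∈ Icc (0 : ℝ) 1) :
    ext (prim f) t = ∫ s in (0 : ℝ)..t, ext f s := by rw [ext_of_mem _ ht, prim_apply]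

theorem ext_prim_zero (f : CI) : ext (prim f) 0 = 0 := by
  rw [ext_prim _ ⟨le_rfl, zero_le_one⟩, intervalIntegral.integral_same]

theorem hasDerivWithinAt_prim (f : CI) {t : ℝ} (ht : t ∈ Ico (0 : ℝ) 1) :
    HasDerivWithinAt (ext (prim f)) (ext f t) (Ici t) t := by
  have h1 : HasDerivAt (fun t => ∫ s in (0 : ℝ)..t, ext f s) (ext f t) t :=
    intervalIntegral.integral_hasDerivAt_right ((continuous_ext f).intervalIntegrable _ _)
      ((continuous_ext f).stronglyMeasurableAtFilter _ _) (continuous_ext f).continuousAt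
  refine h1.hasDerivWithinAt.congr_of_eventuallyEq ?_ (ext_prim f ⟨ht.1, ht.2.le⟩)
  filter_upwards [Icc_mem_nhdsGE ht.2] with s hs
  exact ext_prim f ⟨ht.1.trans hs.1, hs.2⟩

theorem eq_prim_of_hasDerivWithinAt {f g : CI} (h0 : ext f 0 = 0)
    (h : ∀ t ∈ Ico (0 : ℝ) 1, HasDerivWithinAt (ext f) (ext g t) (Ici t) t) : f = prim g := by
  refine ext_ext fun t ht => ?_
  have h2 : ∀ t ∈ Icc (0 : ℝ) 1, ext f t - ext (prim g) t = ext f 0 - ext (prim g) 0 :=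
    constant_of_has_deriv_right_zero
      (((continuous_ext f).sub (continuous_ext (prim g))).continuousOn) (fun t ht => by
        simpa using (h t ht).fun_sub (hasDerivWithinAt_prim g ht))
  have := h2 t ht
  rw [h0, ext_prim_zero] at this
  linarith

/-- The Volterra operator with kernel a matrix of multiplications. -/
noncomputable def volt (a b c d : CI) : CI × CI →L[ℝ] CI × CI :=
  (prim.comp (((ContinuousLinearMap.mul ℝ CI a).comp (ContinuousLinearMap.fst ℝ CI CI)) +
      ((ContinuousLinearMap.mul ℝ CI b).comp (ContinuousLinearMap.snd ℝ CI CI)))).prod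
  (prim.comp (((ContinuousLinearMap.mul ℝ CI c).comp (ContinuousLinearMap.fst ℝ CI CI)) +
      ((ContinuousLinearMap.mul ℝ CI d).comp (ContinuousLinearMap.snd ℝ CI CI))))

theorem volt_apply (a b c d : CI) (x : CI × CI) :
    volt a b c d x = (prim (a * x.1 + b * x.2), prim (c * x.1 + d * x.2)) := rfl

theorem abs_prim_le {f : CI} {B : ℝ} {n : ℕ} (h : ∀ t ∈ Icc (0 : ℝ) 1, |ext f t| ≤ B * t ^ n)
    {t : ℝ} (ht : t ∈ Icc (0 : ℝ) 1) : |ext (prim f) t| ≤ B * (t ^ (n + 1) / (n + 1)) := by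
  rw [ext_prim f ht]
  have := intervalIntegral.norm_integral_le_of_norm_le (μ := MeasureTheory.volume) (f := ext f)
    (g := fun s => B * s ^ n) ht.1
    (Eventually.of_forall fun s hs => h s ⟨hs.1.le, hs.2.trans ht.2⟩)
    ((by fun_prop : Continuous fun s : ℝ => B * s ^ n).intervalIntegrable _ _)
  refine this.trans (le_of_eq ?_)
  rw [intervalIntegral.integral_const_mul, integral_pow]
  simp

/-- The `n`-th power of a Volterra operator gains a factor `t ^ n / n!`, whence its Neumann series
converges. -/
theorem abs_volt_pow_le (a b c d : CI) (n : ℕ) (x : CI × CI) {t : ℝ} (ht : t ∈ Icc (0 : ℝ) 1) :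
    |ext ((volt a b c d ^ n) x).1 t| ≤ ‖x‖ * (‖a‖ + ‖b‖ + ‖c‖ + ‖d‖) ^ n / n.factorial * t ^ n ∧
    |ext ((volt a b c d ^ n) x).2 t| ≤ ‖x‖ * (‖a‖ + ‖b‖ + ‖c‖ + ‖d‖) ^ n / n.factorial * t ^ n := by
  set L := ‖a‖ + ‖b‖ + ‖c‖ + ‖d‖ with hL
  induction n generalizing t with
  | zero =>
    simp only [pow_zero, Nat.factorial_zero, Nat.cast_one, mul_one, div_one]
    exact ⟨(abs_ext_le _ _).trans (norm_fst_le x), (abs_ext_le _ _).trans (norm_snd_le x)⟩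
  | succ n ih =>
    rw [pow_succ']
    set z := (volt a b c d ^ n) x with hz
    set B := ‖x‖ * L ^ n / n.factorial with hB
    have hB0 : 0 ≤ B := by positivity
    have key : ∀ u v : CI, ‖u‖ + ‖v‖ ≤ L →
        |ext (prim (u * z.1 + v * z.2)) t| ≤ ‖x‖ * L ^ (n + 1) / (n + 1).factorial * t ^ (n + 1) := by
      intro u v huv
      have h1 := abs_prim_le (f := u * z.1 + v * z.2) (B := L * B) (n := n) (fun s hs => by
        have e : ext (u * z.1 + v * z.2) s = ext u s * ext z.1 s + ext v s * ext z.2 s := rfl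
        rw [e]
        obtain ⟨i1, i2⟩ := ih hs
        have hs0 : 0 ≤ B * s ^ n := mul_nonneg hB0 (pow_nonneg hs.1 n)
        calc |ext u s * ext z.1 s + ext v s * ext z.2 s|
            ≤ |ext u s * ext z.1 s| + |ext v s * ext z.2 s| := abs_add_le _ _
          _ ≤ ‖u‖ * (B * s ^ n) + ‖v‖ * (B * s ^ n) := by
              rw [abs_mul, abs_mul]
              exact add_le_add
                (mul_le_mul (abs_ext_le u s) i1 (abs_nonneg _) (norm_nonneg _))
                (mul_le_mul (abs_ext_le v s) i2 (abs_nonneg _) (norm_nonneg _))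
          _ = (‖u‖ + ‖v‖) * (B * s ^ n) := by ring
          _ ≤ L * (B * s ^ n) := mul_le_mul_of_nonneg_right huv hs0
          _ = L * B * s ^ n := by ring) ht
      refine h1.trans (le_of_eq ?_)
      rw [hB, Nat.factorial_succ]
      push_cast
      field_simp
      ring
    exact ⟨key a b (by rw [hL]; linarith [norm_nonneg c, norm_nonneg d]),
      key c d (by rw [hL]; linarith [norm_nonneg a, norm_nonneg b])⟩

theorem norm_volt_pow_le (a b c d : CI) (n : ℕ) :
    ‖volt a b c d ^ n‖ ≤ (‖a‖ + ‖b‖ + ‖c‖ + ‖d‖) ^ n / n.factorial := by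
  refine ContinuousLinearMap.opNorm_le_bound _ (by positivity) fun x => ?_
  have h0 : 0 ≤ ‖x‖ * (‖a‖ + ‖b‖ + ‖c‖ + ‖d‖) ^ n / n.factorial := by positivity
  have e : (‖a‖ + ‖b‖ + ‖c‖ + ‖d‖) ^ n / n.factorial * ‖x‖
    = ‖x‖ * (‖a‖ + ‖b‖ + ‖c‖ + ‖d‖) ^ n / n.factorial := by ring
  rw [e, Prod.norm_def]
  have hle : ∀ t : Icc (0 : ℝ) 1, ‖x‖ * (‖a‖ + ‖b‖ + ‖c‖ + ‖d‖) ^ n / n.factorial * (t : ℝ) ^ n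
      ≤ ‖x‖ * (‖a‖ + ‖b‖ + ‖c‖ + ‖d‖) ^ n / n.factorial := fun t =>
    mul_le_of_le_one_right h0 (pow_le_one₀ t.2.1 t.2.2)
  refine max_le ((ContinuousMap.norm_le _ h0).2 fun t => ?_)
    ((ContinuousMap.norm_le _ h0).2 fun t => ?_)
  · rw [← ext_val]
    exact (abs_volt_pow_le a b c d n x t.2).1.trans (hle t)
  · rw [← ext_val]
    exact (abs_volt_pow_le a b c d n x t.2).2.trans (hle t)

/-- Linear Volterra equations are uniquely solvable. -/
theorem isUnit_one_sub_volt (a b c d : CI) : IsUnit (1 - volt a b c d) := by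
  obtain ⟨n, hn⟩ := ((FloorSemiring.tendsto_pow_div_factorial_atTop
    (‖a‖ + ‖b‖ + ‖c‖ + ‖d‖)).eventually (gt_mem_nhds zero_lt_one)).exists
  have h1 : IsUnit (1 - volt a b c d ^ n) := by
    have h2 := isUnit_one_sub_of_norm_lt_one (R := (CI × CI) →L[ℝ] (CI × CI))
      (x := volt a b c d ^ n) ((norm_volt_pow_le a b c d n).trans_lt hn)
    exact h2
  rw [← mul_neg_geom_sum] at h1
  have hcomm : Commute (1 - volt a b c d) (∑ i ∈ Finset.range n, volt a b c d ^ i) := by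
    refine Commute.sum_right _ _ _ fun i _ => ?_
    exact ((Commute.one_left _).sub_left ((Commute.refl _).pow_right i))
  exact (hcomm.isUnit_mul_iff.1 h1).1

theorem volt_solve (a b c d : CI) :
    Function.Bijective (fun x : CI × CI => x - volt a b c d x) := by
  obtain ⟨u, hu⟩ := isUnit_one_sub_volt a b c d
  have h1 : ∀ x, (fun x : CI × CI => x - volt a b c d x) x = (u : CI × CI →L[ℝ] CI × CI) x := by
    intro x; rw [hu]; rfl
  have h2 : (fun x : CI × CI => x - volt a b c d x) = (u : CI × CI →L[ℝ] CI × CI) := funext h1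
  rw [h2]
  refine Function.bijective_iff_has_inverse.2 ⟨(↑u⁻¹ : CI × CI →L[ℝ] CI × CI), fun x => ?_, fun x => ?_⟩
  · rw [← mul_apply_eq_comp, Units.inv_mul]; rfl
  · rw [← mul_apply_eq_comp, Units.mul_inv]; rfl

end Volterra

namespace Volterra

/-! ### Analytic dependence of arcs on the starting point -/

variable {p₁ p₂ δ l : ℝ} {Y M : CI} {c ζ : ℝ}

/-- An arc of the quadratic system `y' = m - p₁ y - p₂ y²`, `m' = δ (l - y)` from `(1, ζ)` to the
line `y = 1`, in time `c`, parametrized by the unit interval. -/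
structure IsArc (p₁ p₂ δ l : ℝ) (Y M : CI) (c ζ : ℝ) : Prop where
  y_eq : Y = 1 + c • prim (M - p₁ • Y - p₂ • (Y * Y))
  m_eq : M = ζ • 1 + c • prim (δ • (l • 1 - Y))
  end_eq : Y 1 = 1

/-- The map whose level sets are the arcs. -/
noncomputable def arcEqn (p₁ p₂ δ l : ℝ) (z : (CI × CI) × ℝ) : (CI × CI) × ℝ :=
  ((z.1.1 - 1 - z.2 • prim (z.1.2 - p₁ • z.1.1 - p₂ • (z.1.1 * z.1.1)),
    z.1.2 - z.2 • prim (δ • (l • 1 - z.1.1))), z.1.1 1 - 1)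

theorem arcEqn_eq_iff : arcEqn p₁ p₂ δ l ((Y, M), c) = ((0, ζ • 1), 0) ↔ IsArc p₁ p₂ δ l Y M c ζ := by
  simp only [arcEqn, Prod.mk.injEq]
  constructor
  · rintro ⟨⟨h1, h2⟩, h3⟩
    exact ⟨by rw [sub_sub, sub_eq_zero] at h1; exact h1, by rw [sub_eq_iff_eq_add] at h2; exact h2,
      by linarith⟩
  · rintro ⟨h1, h2, h3⟩
    exact ⟨⟨by rw [sub_sub, sub_eq_zero]; exact h1, by rw [sub_eq_iff_eq_add]; exact h2⟩,
      by linarith⟩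

theorem contDiff_arcEqn : ContDiff ℝ ⊤ (arcEqn p₁ p₂ δ l) := by
  have hY : ContDiff ℝ ⊤ (fun z : (CI × CI) × ℝ => z.1.1) := contDiff_fst.fst
  have hM : ContDiff ℝ ⊤ (fun z : (CI × CI) × ℝ => z.1.2) := contDiff_fst.snd
  have hc : ContDiff ℝ ⊤ (fun z : (CI × CI) × ℝ => z.2) := contDiff_snd
  have he : ContDiff ℝ ⊤ (fun z : (CI × CI) × ℝ => z.1.1 1) :=
    ((ContinuousMap.evalCLM ℝ (1 : Icc (0 : ℝ) 1) : CI →L[ℝ] ℝ).contDiff (n := ⊤)).comp hY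
  exact (((hY.sub contDiff_const).sub (hc.smul (prim.contDiff.comp
    ((hM.sub (hY.const_smul p₁)).sub ((hY.mul hY).const_smul p₂))))).prodMk
    (hM.sub (hc.smul (prim.contDiff.comp ((contDiff_const.sub hY).const_smul δ))))).prodMk
    (he.sub contDiff_const)

/-- The derivative of `arcEqn` is, up to a rank-one term, the identity minus a Volterra operator. -/
theorem exists_hasFDerivAt_arcEqn (p₁ p₂ δ l : ℝ) (Y M : CI) (c : ℝ) :
    ∃ D : ((CI × CI) × ℝ) →L[ℝ] ((CI × CI) × ℝ),
      HasFDerivAt (arcEqn p₁ p₂ δ l) D ((Y, M), c) ∧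
      ∀ w : (CI × CI) × ℝ, D w =
        (w.1 - volt (-(c * p₁) • 1 - (2 * c * p₂) • Y) (c • 1) (-(c * δ) • 1) 0 w.1
          - w.2 • (prim (M - p₁ • Y - p₂ • (Y * Y)), prim (δ • (l • 1 - Y))), w.1.1 1) := by
  set z : (CI × CI) × ℝ := ((Y, M), c) with hz
  have hY : HasFDerivAt (fun z : (CI × CI) × ℝ => z.1.1)
    ((ContinuousLinearMap.fst ℝ CI CI).comp (ContinuousLinearMap.fst ℝ (CI × CI) ℝ)) z :=
    ((ContinuousLinearMap.fst ℝ CI CI).comp (ContinuousLinearMap.fst ℝ (CI × CI) ℝ)).hasFDerivAt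
  have hM : HasFDerivAt (fun z : (CI × CI) × ℝ => z.1.2)
    ((ContinuousLinearMap.snd ℝ CI CI).comp (ContinuousLinearMap.fst ℝ (CI × CI) ℝ)) z :=
    ((ContinuousLinearMap.snd ℝ CI CI).comp (ContinuousLinearMap.fst ℝ (CI × CI) ℝ)).hasFDerivAt
  have hc : HasFDerivAt (fun z : (CI × CI) × ℝ => z.2) (ContinuousLinearMap.snd ℝ (CI × CI) ℝ) z :=
    (ContinuousLinearMap.snd ℝ (CI × CI) ℝ).hasFDerivAt
  have he : HasFDerivAt (fun z : (CI × CI) × ℝ => z.1.1 1)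
    ((ContinuousMap.evalCLM ℝ (1 : Icc (0 : ℝ) 1)).comp
      ((ContinuousLinearMap.fst ℝ CI CI).comp (ContinuousLinearMap.fst ℝ (CI × CI) ℝ))) z :=
    ((ContinuousMap.evalCLM ℝ (1 : Icc (0 : ℝ) 1)).comp
      ((ContinuousLinearMap.fst ℝ CI CI).comp (ContinuousLinearMap.fst ℝ (CI × CI) ℝ))).hasFDerivAt
  have h1 := (hY.sub_const 1).fun_sub (hc.fun_smul (prim.hasFDerivAt.comp z
    ((hM.fun_sub (hY.fun_const_smul p₁)).fun_sub ((hY.mul hY).fun_const_smul p₂))))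
  have h2 := hM.fun_sub (hc.fun_smul (prim.hasFDerivAt.comp z ((hY.const_sub (l • 1)).fun_const_smul δ)))
  refine ⟨_, (h1.prodMk h2).prodMk (he.sub_const 1), fun w => ?_⟩
  obtain ⟨⟨ξ, η⟩, k⟩ := w
  have e1 : prim ((-(c * p₁) • 1 - (2 * c * p₂) • Y) * ξ + (c • 1) * η)
      = c • prim (η - p₁ • ξ - p₂ • (Y * ξ + Y * ξ)) := by
    rw [← map_smul]; congr 1; ext t; simp; ring
  have e2 : prim ((-(c * δ) • 1) * ξ + 0 * η) = c • prim (δ • (-ξ)) := by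
    rw [← map_smul]; congr 1; ext t; simp; ring
  rw [volt_apply]
  simp only []
  rw [e1, e2]
  refine Prod.ext (Prod.ext ?_ ?_) ?_
  · ext t
    simp [hz]
    ring
  · ext t
    simp [hz]
    ring
  · simp

theorem IsArc.dY (h : IsArc p₁ p₂ δ l Y M c ζ) {t : ℝ} (ht : t ∈ Ico (0 : ℝ) 1) :
    HasDerivWithinAt (ext Y) (c * (ext M t - p₁ * ext Y t - p₂ * (ext Y t * ext Y t))) (Ici t) t := by
  have h1 := ((hasDerivWithinAt_prim (M - p₁ • Y - p₂ • (Y * Y)) ht).const_mul c).const_add 1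
  have h2 : ext Y = fun t => 1 + c * ext (prim (M - p₁ • Y - p₂ • (Y * Y))) t := by
    conv_lhs => rw [h.y_eq]
    rfl
  exact h1.congr_of_eventuallyEq (Eventually.of_forall fun s => congrFun h2 s) (congrFun h2 t)

theorem IsArc.dM (h : IsArc p₁ p₂ δ l Y M c ζ) {t : ℝ} (ht : t ∈ Ico (0 : ℝ) 1) :
    HasDerivWithinAt (ext M) (c * (δ * (l - ext Y t))) (Ici t) t := by
  have h1 := ((hasDerivWithinAt_prim (δ • (l • 1 - Y)) ht).const_mul c).const_add ζ
  have h2 : ext M = fun t => ζ + c * ext (prim (δ • (l • 1 - Y))) t := by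
    conv_lhs => rw [h.m_eq]
    funext t
    show ζ * 1 + _ = _
    rw [mul_one]
    rfl
  refine (h1.congr_of_eventuallyEq (Eventually.of_forall fun s => congrFun h2 s)
    (congrFun h2 t)).congr_deriv ?_
  show c * (δ * (l * 1 - _)) = _
  rw [mul_one]
  rfl

theorem IsArc.Y_zero (h : IsArc p₁ p₂ δ l Y M c ζ) : ext Y 0 = 1 := by
  rw [h.y_eq]
  show 1 + c * ext (prim _) 0 = 1
  rw [ext_prim_zero]; ring

theorem IsArc.M_zero (h : IsArc p₁ p₂ δ l Y M c ζ) : ext M 0 = ζ := by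
  rw [h.m_eq]
  show ζ * 1 + c * ext (prim _) 0 = ζ
  rw [ext_prim_zero]; ring

theorem IsArc.Y_one (h : IsArc p₁ p₂ δ l Y M c ζ) : ext Y 1 = 1 := by
  rw [ext_of_mem _ ⟨zero_le_one, le_rfl⟩]; exact h.end_eq

/-- The coordinate function of the unit interval. -/
def coord : CI := ⟨Subtype.val, continuous_subtype_val⟩

theorem ext_coord {t : ℝ} (ht : t ∈ Icc (0 : ℝ) 1) : ext coord t = t := ext_of_mem _ ht

theorem hasDerivWithinAt_coord {t : ℝ} (ht : t ∈ Ico (0 : ℝ) 1) :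
    HasDerivWithinAt (ext coord) 1 (Ici t) t := by
  refine (hasDerivWithinAt_id t (Ici t)).congr_of_eventuallyEq ?_ (ext_coord ⟨ht.1, ht.2.le⟩)
  filter_upwards [Icc_mem_nhdsGE ht.2] with s hs
  exact ext_coord ⟨ht.1.trans hs.1, hs.2⟩

/-- Stretching time solves the linearized equation. -/
theorem IsArc.stretch (h : IsArc p₁ p₂ δ l Y M c ζ) :
    (coord * (M - p₁ • Y - p₂ • (Y * Y)), coord * (δ • (l • 1 - Y)))
      - volt (-(c * p₁) • 1 - (2 * c * p₂) • Y) (c • 1) (-(c * δ) • 1) 0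
        (coord * (M - p₁ • Y - p₂ • (Y * Y)), coord * (δ • (l • 1 - Y)))
      = (prim (M - p₁ • Y - p₂ • (Y * Y)), prim (δ • (l • 1 - Y))) := by
  rw [volt_apply, sub_eq_iff_eq_add, Prod.mk_add_mk, ← map_add, ← map_add]
  have hc0 : ext coord 0 = 0 := ext_coord ⟨le_rfl, zero_le_one⟩
  refine Prod.ext (eq_prim_of_hasDerivWithinAt ?_ fun t ht => ?_)
    (eq_prim_of_hasDerivWithinAt ?_ fun t ht => ?_)
  · show ext coord 0 * _ = 0
    rw [hc0, zero_mul]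
  · have h1 := (hasDerivWithinAt_coord ht).fun_mul (((h.dM ht).fun_sub ((h.dY ht).const_mul p₁)).fun_sub
      (((h.dY ht).fun_mul (h.dY ht)).const_mul p₂))
    refine h1.congr_deriv ?_
    have ht' := ext_coord (t := t) ⟨ht.1, ht.2.le⟩
    show _ = (ext M t - p₁ * ext Y t - p₂ * (ext Y t * ext Y t)) +
      ((-(c * p₁) * 1 - (2 * c * p₂) * ext Y t) *
        (ext coord t * (ext M t - p₁ * ext Y t - p₂ * (ext Y t * ext Y t)))
        + (c * 1) * (ext coord t * (δ * (l * 1 - ext Y t))))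
    ring
  · show ext coord 0 * _ = 0
    rw [hc0, zero_mul]
  · have h1 := (hasDerivWithinAt_coord ht).fun_mul (((h.dY ht).const_sub l).const_mul δ)
    have e : ext (coord * (δ • (l • 1 - Y))) = fun i => ext coord i * (δ * (l - ext Y i)) := by
      funext i
      show _ * (δ * (l * 1 - _)) = _
      rw [mul_one]
      rfl
    refine (h1.congr_of_eventuallyEq (Eventually.of_forall fun s => congrFun e s)
      (congrFun e t)).congr_deriv ?_
    show _ = (δ * (l * 1 - ext Y t)) +
      (-(c * δ) * 1 * (ext coord t * (ext M t - p₁ * ext Y t - p₂ * (ext Y t * ext Y t)))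
        + 0 * (ext coord t * (δ * (l * 1 - ext Y t))))
    ring

/-- The linearized arc equation can be solved: for a given stretching `w.2` of time it is a linear
Volterra equation, and stretching moves the end point along the field, which is transversal to the
line `y = 1` by `hend`, so that a unique `w.2` meets the end condition. -/
theorem IsArc.bijective (h : IsArc p₁ p₂ δ l Y M c ζ) (hend : M 1 - p₁ - p₂ ≠ 0)
    {D : ((CI × CI) × ℝ) →L[ℝ] ((CI × CI) × ℝ)} (hD : ∀ w : (CI × CI) × ℝ, D w =
        (w.1 - volt (-(c * p₁) • 1 - (2 * c * p₂) • Y) (c • 1) (-(c * δ) • 1) 0 w.1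
          - w.2 • (prim (M - p₁ • Y - p₂ • (Y * Y)), prim (δ • (l • 1 - Y))), w.1.1 1)) :
    Function.Bijective D := by
  have hq := h.stretch
  have hsol := volt_solve (-(c * p₁) • 1 - (2 * c * p₂) • Y) (c • 1) (-(c * δ) • 1) 0
  have hq1 : (coord * (M - p₁ • Y - p₂ • (Y * Y))) 1 = M 1 - p₁ - p₂ := by
    show (1 : ℝ) * (M 1 - p₁ * Y 1 - p₂ * (Y 1 * Y 1)) = _
    rw [h.end_eq]; ring
  set q : CI × CI := (coord * (M - p₁ • Y - p₂ • (Y * Y)), coord * (δ • (l • 1 - Y))) with hqd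
  set K := volt (-(c * p₁) • 1 - (2 * c * p₂) • Y) (c • 1) (-(c * δ) • 1) 0
  have hD' : ∀ w : (CI × CI) × ℝ, D w = ((w.1 - w.2 • q) - K (w.1 - w.2 • q), w.1.1 1) := by
    intro w
    rw [hD w, ← hq, map_sub, map_smul, smul_sub]
    congr 1
    abel
  have hq1' : q.1 1 ≠ 0 := by rw [hqd]; show (coord * _) 1 ≠ 0; rw [hq1]; exact hend
  constructor
  · rw [injective_iff_map_eq_zero]
    intro w hw
    rw [hD', Prod.mk_eq_zero] at hw
    have h1 : w.1 - w.2 • q = 0 := hsol.1 (by simpa using hw.1)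
    have h2 : w.1 = w.2 • q := sub_eq_zero.1 h1
    have h3 : w.2 * q.1 1 = 0 := by
      have := hw.2
      rw [h2] at this
      exact this
    have h4 : w.2 = 0 := (mul_eq_zero.1 h3).resolve_right hq1'
    exact Prod.ext (by rw [h2, h4, zero_smul]; rfl) h4
  · rintro ⟨u, r⟩
    obtain ⟨x, hx⟩ := hsol.2 u
    refine ⟨(x + ((r - x.1 1) / q.1 1) • q, (r - x.1 1) / q.1 1), ?_⟩
    rw [hD', add_sub_cancel_right]
    refine Prod.ext hx ?_
    show x.1 1 + (r - x.1 1) / q.1 1 * q.1 1 = r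
    field_simp
    ring

/-- An arc that ends transversally belongs to an analytic family of arcs. -/
theorem IsArc.exists_family (h : IsArc p₁ p₂ δ l Y M c ζ) (hend : M 1 - p₁ - p₂ ≠ 0) :
    ∃ φ : ℝ → (CI × CI) × ℝ, φ ζ = ((Y, M), c) ∧ AnalyticAt ℝ φ ζ ∧
      ∀ᶠ s in 𝓝 ζ, IsArc p₁ p₂ δ l (φ s).1.1 (φ s).1.2 (φ s).2 s := by
  obtain ⟨D, hD, hDw⟩ := exists_hasFDerivAt_arcEqn p₁ p₂ δ l Y M c
  have hbij := h.bijective hend hDw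
  set D' : ((CI × CI) × ℝ) ≃L[ℝ] ((CI × CI) × ℝ) := ContinuousLinearEquiv.ofBijective D
    (LinearMap.ker_eq_bot.2 hbij.1) (LinearMap.range_eq_top.2 hbij.2)
  have hD' : HasFDerivAt (arcEqn p₁ p₂ δ l) (D' : ((CI × CI) × ℝ) →L[ℝ] ((CI × CI) × ℝ)) ((Y, M), c) :=
    hD
  have hcd : ContDiffAt ℝ ⊤ (arcEqn p₁ p₂ δ l) ((Y, M), c) := contDiff_arcEqn.contDiffAt
  have hval := arcEqn_eq_iff.2 h
  set ψ := hcd.localInverse hD' (by simp) with hψ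
  have hψa : ContDiffAt ℝ ⊤ ψ ((0, ζ • 1), 0) := hval ▸ hcd.to_localInverse hD' (by simp)
  have hψ0 : ψ ((0, ζ • 1), 0) = ((Y, M), c) := hval ▸ hcd.localInverse_apply_image hD' (by simp)
  have hψr : ∀ᶠ w in 𝓝 (((0, ζ • 1), 0) : (CI × CI) × ℝ), arcEqn p₁ p₂ δ l (ψ w) = w :=
    hval ▸ (hcd.hasStrictFDerivAt' hD' (by simp)).eventually_right_inverse
  have hι : ContDiff ℝ ⊤ (fun s : ℝ => (((0, s • 1), 0) : (CI × CI) × ℝ)) :=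
    by fun_prop
  refine ⟨fun s => ψ ((0, s • 1), 0), hψ0, ?_, ?_⟩
  · exact (ContDiffAt.comp ζ hψa hι.contDiffAt).analyticAt
  · have := (hι.continuous.tendsto ζ).eventually hψr
    filter_upwards [this] with s hs
    exact arcEqn_eq_iff.1 hs

end Volterra

namespace Volterra

variable {p₁ p₂ δ l : ℝ} {Y M : CI} {c ζ : ℝ}

/-- The variation of an arc with its starting point, and the velocity of the arc, are two solutions
of the same linear equation up to a multiple of the velocity; their Wronskian solves a scalar linear
equation and keeps its sign. Hence the endpoint `M 1` moves in the same direction as `ζ` if the arc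
crosses the line `y = 1` at both ends in the same direction, and oppositely otherwise. -/
theorem IsArc.exists_endpoint_deriv (h : IsArc p₁ p₂ δ l Y M c ζ) {φ : ℝ → (CI × CI) × ℝ}
    (hφ0 : φ ζ = ((Y, M), c)) {w : (CI × CI) × ℝ} (hφ : HasDerivAt φ w ζ)
    (hev : ∀ᶠ s in 𝓝 ζ, IsArc p₁ p₂ δ l (φ s).1.1 (φ s).1.2 (φ s).2 s) :
    ∃ κ > 0, w.1.2 1 * (M 1 - p₁ - p₂) = κ * (ζ - p₁ - p₂) := by
  obtain ⟨D, hD, hDw⟩ := exists_hasFDerivAt_arcEqn p₁ p₂ δ l Y M c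
  obtain ⟨⟨ξ, η⟩, k⟩ := w
  have h1 : HasDerivAt (fun s => arcEqn p₁ p₂ δ l (φ s)) (D ((ξ, η), k)) ζ := by
    rw [← hφ0] at hD
    exact hD.comp_hasDerivAt ζ hφ
  have h2 : HasDerivAt (fun s : ℝ => (((0, s • 1), 0) : (CI × CI) × ℝ)) ((0, (1 : ℝ) • 1), 0) ζ :=
    ((hasDerivAt_const ζ (0 : CI)).prodMk ((hasDerivAt_id ζ).smul_const (1 : CI))).prodMk
      (hasDerivAt_const ζ (0 : ℝ))
  have h3 : (fun s => arcEqn p₁ p₂ δ l (φ s)) =ᶠ[𝓝 ζ]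
      fun s : ℝ => (((0, s • 1), 0) : (CI × CI) × ℝ) := by
    filter_upwards [hev] with s hs
    exact arcEqn_eq_iff.2 hs
  have h4 := h1.unique (h2.congr_of_eventuallyEq h3)
  rw [hDw, Prod.mk.injEq, volt_apply, Prod.mk_sub_mk, Prod.smul_mk, Prod.mk_sub_mk,
    Prod.mk.injEq, one_smul] at h4
  obtain ⟨⟨hξ, hη⟩, hξ1⟩ := h4
  set g₁ : CI := M - p₁ • Y - p₂ • (Y * Y) with hg₁
  set g₂ : CI := δ • (l • 1 - Y) with hg₂
  set u : CI := (-(c * p₁) • 1 - (2 * c * p₂) • Y) * ξ + (c • 1) * η with hu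
  set v : CI := (-(c * δ) • 1) * ξ + 0 * η with hv
  have eg₁ : ∀ t, ext g₁ t = ext M t - p₁ * ext Y t - p₂ * (ext Y t * ext Y t) := fun t => rfl
  have eg₂ : ∀ t, ext g₂ t = δ * (l - ext Y t) := fun t => by
    show δ * (l * 1 - ext Y t) = _
    rw [mul_one]
  have eξ : ext ξ = fun t => ext (prim u) t + k * ext (prim g₁) t := by
    have : ξ = prim u + k • prim g₁ := by
      rw [sub_sub, sub_eq_zero] at hξ; exact hξ
    conv_lhs => rw [this]
    rfl
  have eη : ext η = fun t => 1 + (ext (prim v) t + k * ext (prim g₂) t) := by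
    have : η = 1 + (prim v + k • prim g₂) := by
      rw [sub_sub, sub_eq_iff_eq_add] at hη; exact hη
    conv_lhs => rw [this]
    rfl
  have eu : ∀ t, ext u t = (-(c * p₁) - 2 * c * p₂ * ext Y t) * ext ξ t + c * ext η t := fun t => by
    show (-(c * p₁) * 1 - (2 * c * p₂) * ext Y t) * ext ξ t + (c * 1) * ext η t = _
    ring
  have ev : ∀ t, ext v t = -(c * δ) * ext ξ t := fun t => by
    show (-(c * δ) * 1) * ext ξ t + 0 * ext η t = _
    ring
  have dξ : ∀ t ∈ Ico (0 : ℝ) 1, HasDerivWithinAt (ext ξ) (ext u t + k * ext g₁ t) (Ici t) t := by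
    intro t ht
    exact ((hasDerivWithinAt_prim u ht).fun_add
      ((hasDerivWithinAt_prim g₁ ht).const_mul k)).congr_of_eventuallyEq
      (Eventually.of_forall fun s => congrFun eξ s) (congrFun eξ t)
  have dη : ∀ t ∈ Ico (0 : ℝ) 1, HasDerivWithinAt (ext η) (ext v t + k * ext g₂ t) (Ici t) t := by
    intro t ht
    exact (((hasDerivWithinAt_prim v ht).fun_add
      ((hasDerivWithinAt_prim g₂ ht).const_mul k)).const_add 1).congr_of_eventuallyEq
      (Eventually.of_forall fun s => congrFun eη s) (congrFun eη t)
  have dg₁ : ∀ t ∈ Ico (0 : ℝ) 1, HasDerivWithinAt (ext g₁)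
      (c * (δ * (l - ext Y t)) - p₁ * (c * ext g₁ t)
        - p₂ * (c * ext g₁ t * ext Y t + ext Y t * (c * ext g₁ t))) (Ici t) t := by
    intro t ht
    exact ((h.dM ht).fun_sub ((h.dY ht).const_mul p₁)).fun_sub
      (((h.dY ht).fun_mul (h.dY ht)).const_mul p₂)
  have dg₂ : ∀ t ∈ Ico (0 : ℝ) 1, HasDerivWithinAt (ext g₂) (δ * (-(c * ext g₁ t))) (Ici t) t := by
    intro t ht
    exact (((h.dY ht).const_sub l).const_mul δ).congr_of_eventuallyEq
      (Eventually.of_forall fun s => eg₂ s) (eg₂ t)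
  set q : CI := (c * p₁) • 1 + (2 * c * p₂) • Y with hq
  have eq : ∀ t, ext q t = c * p₁ + 2 * c * p₂ * ext Y t := fun t => by
    show (c * p₁) * 1 + (2 * c * p₂) * ext Y t = _
    ring
  set f : ℝ → ℝ := fun t => (ext g₁ t * ext η t - ext g₂ t * ext ξ t) * Real.exp (ext (prim q) t)
    with hf
  have df : ∀ t ∈ Ico (0 : ℝ) 1, HasDerivWithinAt f 0 (Ici t) t := by
    intro t ht
    refine ((((dg₁ t ht).fun_mul (dη t ht)).fun_sub ((dg₂ t ht).fun_mul (dξ t ht))).fun_mul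
      (hasDerivWithinAt_prim q ht).exp).congr_deriv ?_
    rw [eu, ev, eq, eg₂]
    ring
  have cf : ContinuousOn f (Icc 0 1) := by
    have c1 := continuous_ext g₁
    have c2 := continuous_ext g₂
    have c3 := continuous_ext ξ
    have c4 := continuous_ext η
    have c5 := continuous_ext (prim q)
    exact (((c1.mul c4).sub (c2.mul c3)).mul (Real.continuous_exp.comp c5)).continuousOn
  have hconst := constant_of_has_deriv_right_zero cf df 1 ⟨zero_le_one, le_rfl⟩
  have f0 : f 0 = ζ - p₁ - p₂ := by
    simp only [hf]
    rw [congrFun eξ 0, congrFun eη 0]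
    simp only [ext_prim_zero, eg₁, h.Y_zero, h.M_zero, Real.exp_zero]
    ring
  have f1 : f 1 = η 1 * (M 1 - p₁ - p₂) * Real.exp (ext (prim q) 1) := by
    have e1 : ∀ x : CI, ext x 1 = x 1 := fun x => ext_of_mem _ ⟨zero_le_one, le_rfl⟩
    simp only [hf, eg₁, h.Y_one]
    rw [e1 ξ, e1 η, e1 M]
    have : ξ 1 = 0 := hξ1
    rw [this]
    ring
  refine ⟨Real.exp (-ext (prim q) 1), Real.exp_pos _, ?_⟩
  have he : Real.exp (-ext (prim q) 1) * Real.exp (ext (prim q) 1) = 1 := by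
    rw [← Real.exp_add, neg_add_cancel, Real.exp_zero]
  rw [← f0, ← hconst, f1]
  linear_combination (-(η 1 * (M 1 - p₁ - p₂))) * he

end Volterra

namespace Volterra

variable {p₁ p₂ δ l : ℝ} {Y M : CI} {c ζ : ℝ}

theorem continuous_ext_uncurry : Continuous (fun z : CI × ℝ => ext z.1 z.2) :=
  continuous_eval.comp (continuous_fst.prodMk ((continuous_projIcc (h := zero_le_one)).comp continuous_snd))

theorem lt_of_deriv_pos {g g' : ℝ → ℝ} {a b : ℝ} (hab : a < b) (hc : ContinuousOn g (Icc a b))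
    (hd : ∀ t ∈ Ico a b, HasDerivWithinAt g (g' t) (Ici t) t)
    (hb : ∀ t ∈ Ico a b, 0 < g' t) : g a < g b := by
  obtain ⟨u, hu, hu'⟩ := Stommel.exists_gt_of_deriv_pos (hd a ⟨le_rfl, hab⟩) (hb a ⟨le_rfl, hab⟩)
  have h1 : a < min u b := lt_min hu hab
  have h2 := hu' (min u b) ⟨h1, min_le_left _ _⟩
  have h3 := add_mul_le_of_le_deriv (c := 0) (a := min u b) (b := b)
    (hc.mono (Icc_subset_Icc_left h1.le)) (fun t ht => hd t ⟨h1.le.trans ht.1, ht.2⟩)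
    (fun t ht => (hb t ⟨h1.le.trans ht.1, ht.2⟩).le) b ⟨min_le_right _ _, le_rfl⟩
  linarith

/-- An arc on one side of the line `y = 1`, transversal to it at both ends, is stable: nearby arcs
stay on that side, too. -/
theorem IsArc.eventually_side (h : IsArc p₁ p₂ δ l Y M c ζ) (hp : p₁ + p₂ = 1) (hc : 0 < c) {e : ℝ}
    (h0 : 0 < e * (ζ - 1)) (h1 : 0 < e * (1 - M 1))
    (hside : ∀ t ∈ Ioo (0 : ℝ) 1, 0 < e * (ext Y t - 1)) {φ : ℝ → (CI × CI) × ℝ}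
    (hφ0 : φ ζ = ((Y, M), c)) (hφ : ContinuousAt φ ζ)
    (hev : ∀ᶠ s in 𝓝 ζ, IsArc p₁ p₂ δ l (φ s).1.1 (φ s).1.2 (φ s).2 s) :
    ∀ᶠ s in 𝓝 ζ, ∀ t ∈ Ioo (0 : ℝ) 1, 0 < e * (ext (φ s).1.1 t - 1) := by
  have cY : ∀ t, Tendsto (fun z : ℝ × ℝ => ext (φ z.1).1.1 z.2) (𝓝 ζ ×ˢ 𝓝 t) (𝓝 (ext Y t)) := by
    intro t
    have h2 : ContinuousAt (fun z : ℝ × ℝ => ((φ z.1).1.1, z.2)) (ζ, t) :=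
      (ContinuousAt.comp (x := (ζ, t)) (f := fun z : ℝ × ℝ => φ z.1) (g := fun w => w.1.1)
        (continuous_fst.fst).continuousAt (hφ.comp continuousAt_fst)).prodMk continuousAt_snd
    have := continuous_ext_uncurry.continuousAt.comp h2
    rw [ContinuousAt, nhds_prod_eq] at this
    simpa [hφ0, Function.comp_def] using this
  have cM : ∀ t, Tendsto (fun z : ℝ × ℝ => ext (φ z.1).1.2 z.2) (𝓝 ζ ×ˢ 𝓝 t) (𝓝 (ext M t)) := by
    intro t
    have h2 : ContinuousAt (fun z : ℝ × ℝ => ((φ z.1).1.2, z.2)) (ζ, t) :=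
      (ContinuousAt.comp (x := (ζ, t)) (f := fun z : ℝ × ℝ => φ z.1) (g := fun w => w.1.2)
        (continuous_fst.snd).continuousAt (hφ.comp continuousAt_fst)).prodMk continuousAt_snd
    have := continuous_ext_uncurry.continuousAt.comp h2
    rw [ContinuousAt, nhds_prod_eq] at this
    simpa [hφ0, Function.comp_def] using this
  have cc : Tendsto (fun s => (φ s).2) (𝓝 ζ) (𝓝 c) := by
    have := (continuous_snd.tendsto (φ ζ)).comp hφ
    simpa [hφ0, Function.comp_def] using this
  have cG : ∀ t, Tendsto (fun z : ℝ × ℝ => e * (ext (φ z.1).1.2 z.2 - p₁ * ext (φ z.1).1.1 z.2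
      - p₂ * (ext (φ z.1).1.1 z.2 * ext (φ z.1).1.1 z.2))) (𝓝 ζ ×ˢ 𝓝 t)
      (𝓝 (e * (ext M t - p₁ * ext Y t - p₂ * (ext Y t * ext Y t)))) := fun t =>
    (((cM t).sub ((cY t).const_mul p₁)).sub (((cY t).mul (cY t)).const_mul p₂)).const_mul e
  have hcpos : ∀ᶠ s in 𝓝 ζ, 0 < (φ s).2 := cc.eventually (lt_mem_nhds hc)
  have hM1 : ext M 1 = M 1 := ext_of_mem _ ⟨zero_le_one, le_rfl⟩
  have key : ∀ t ∈ Icc (0 : ℝ) 1, ∀ᶠ z : ℝ × ℝ in 𝓝 ζ ×ˢ 𝓝 t,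
      z.2 ∈ Ioo (0 : ℝ) 1 → 0 < e * (ext (φ z.1).1.1 z.2 - 1) := by
    intro t ht
    rcases eq_or_lt_of_le ht.1 with h3 | h3
    · -- the velocity is positive near the starting point
      subst h3
      have h4 := (cG 0).eventually (lt_mem_nhds (a := 0) (by
        rw [h.Y_zero, h.M_zero]
        have : ζ - p₁ * 1 - p₂ * (1 * 1) = ζ - 1 := by linarith
        rw [this]; exact h0))
      obtain ⟨U, hU, V, hV, hUV⟩ := eventually_prod_iff.1 h4
      obtain ⟨η, hη, hηV⟩ := Metric.eventually_nhds_iff.1 hV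
      refine eventually_prod_iff.2 ⟨_, hU.and (hcpos.and hev), fun t => dist t 0 < η,
        Metric.ball_mem_nhds 0 hη, fun {s} hs {t} ht htI => ?_⟩
      obtain ⟨hsU, hsc, hsA⟩ := hs
      replace htI : t ∈ Ioo (0 : ℝ) 1 := htI
      replace ht : dist t 0 < η := ht
      rw [Real.dist_eq, sub_zero, abs_of_pos htI.1] at ht
      have h5 : ∀ u ∈ Ico 0 t, 0 < (φ s).2 * (e * (ext (φ s).1.2 u - p₁ * ext (φ s).1.1 u
          - p₂ * (ext (φ s).1.1 u * ext (φ s).1.1 u))) := fun u hu => mul_pos hsc (hUV hsU (hηV (by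
        rw [Real.dist_eq, sub_zero, abs_of_nonneg hu.1]; linarith [hu.2])))
      have h6 : ∀ u ∈ Ico 0 t, HasDerivWithinAt (fun u => e * (ext (φ s).1.1 u - 1))
          ((φ s).2 * (e * (ext (φ s).1.2 u - p₁ * ext (φ s).1.1 u
          - p₂ * (ext (φ s).1.1 u * ext (φ s).1.1 u)))) (Ici u) u := fun u hu =>
        (((hsA.dY ⟨hu.1, hu.2.trans htI.2⟩).sub_const 1).const_mul e).congr_deriv (by ring)
      have := lt_of_deriv_pos htI.1 (((((continuous_ext _).sub continuous_const).const_mul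
        e)).continuousOn) h6 h5
      simpa [hsA.Y_zero] using this
    rcases eq_or_lt_of_le ht.2 with h3' | h3'
    · -- and negative near the endpoint
      subst h3'
      have hneg : e * (ext M 1 - p₁ * ext Y 1 - p₂ * (ext Y 1 * ext Y 1)) < 0 := by
        rw [h.Y_one, hM1]
        have : M 1 - p₁ * 1 - p₂ * (1 * 1) = -(1 - M 1) := by linarith
        rw [this]; linarith
      have h4 := (cG 1).eventually (gt_mem_nhds hneg)
      obtain ⟨U, hU, V, hV, hUV⟩ := eventually_prod_iff.1 h4
      obtain ⟨η, hη, hηV⟩ := Metric.eventually_nhds_iff.1 hV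
      refine eventually_prod_iff.2 ⟨_, hU.and (hcpos.and hev), fun t => dist t 1 < η,
        Metric.ball_mem_nhds 1 hη, fun {s} hs {t} ht htI => ?_⟩
      obtain ⟨hsU, hsc, hsA⟩ := hs
      replace htI : t ∈ Ioo (0 : ℝ) 1 := htI
      replace ht : dist t 1 < η := ht
      rw [Real.dist_eq, abs_lt] at ht
      have h5 : ∀ u ∈ Ico t 1, 0 < (φ s).2 * -(e * (ext (φ s).1.2 u - p₁ * ext (φ s).1.1 u
          - p₂ * (ext (φ s).1.1 u * ext (φ s).1.1 u))) := fun u hu => mul_pos hsc (neg_pos.2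
        (hUV hsU (hηV (by
          rw [Real.dist_eq, abs_lt]; constructor <;> linarith [hu.1, hu.2, ht.1]))))
      have h6 : ∀ u ∈ Ico t 1, HasDerivWithinAt (fun u => -(e * (ext (φ s).1.1 u - 1)))
          ((φ s).2 * -(e * (ext (φ s).1.2 u - p₁ * ext (φ s).1.1 u
          - p₂ * (ext (φ s).1.1 u * ext (φ s).1.1 u)))) (Ici u) u := fun u hu =>
        (((hsA.dY ⟨htI.1.le.trans hu.1, hu.2⟩).sub_const 1).const_mul e).fun_neg.congr_deriv
          (by ring)
      have := lt_of_deriv_pos htI.2 (((((continuous_ext _).sub continuous_const).const_mul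
        e)).neg.continuousOn) h6 h5
      simpa [hsA.Y_one] using this
    · filter_upwards [(((cY t).sub_const 1).const_mul e).eventually
        (lt_mem_nhds (hside t ⟨h3, h3'⟩))] with z hz _ using hz
  have := (isCompact_Icc (a := (0 : ℝ)) (b := 1)).eventually_forall_of_forall_eventually
    (P := fun s t => t ∈ Ioo (0 : ℝ) 1 → 0 < e * (ext (φ s).1.1 t - 1))
    (fun t ht => by rw [nhds_prod_eq]; exact key t ht)
  filter_upwards [this] with s hs t ht using hs t (Ioo_subset_Icc_self ht) ht

end Volterra

namespace Stommel
open PlanarODE Volterra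

variable {A δ l e : ℝ}

/-! ### Half turns -/

/-- The solution from `(1, ζ)` enters the half plane `0 < e (y - 1)`, where `e` is `1` or `-1`, and
leaves it transversally at time `T` through the point `(1, ρ)`. -/
def HalfTurn (A δ l e ζ T ρ : ℝ) : Prop :=
  0 < e * (ζ - 1) ∧ 0 < e * (1 - ρ) ∧ 0 < T ∧ ∃ y m : ℝ → ℝ, Sol A δ l y m ∧ y 0 = 1 ∧ m 0 = ζ ∧
    y T = 1 ∧ m T = ρ ∧ ∀ t ∈ Ioo 0 T, 0 < e * (y t - 1)

theorem HalfTurn.unique {ζ T ρ T' ρ' : ℝ} (h : HalfTurn A δ l e ζ T ρ)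
    (h' : HalfTurn A δ l e ζ T' ρ') : T = T' ∧ ρ = ρ' := by
  obtain ⟨-, -, hT, y, m, hs, hy0, hm0, hyT, hmT, hside⟩ := h
  obtain ⟨-, -, hT', y', m', hs', hy0', hm0', hyT', hmT', hside'⟩ := h'
  have heq := hs.eqOn (lipschitzOnBalls_field A δ l) hs' (by simp [hy0, hm0, hy0', hm0'])
  have e1 : ∀ t, 0 ≤ t → y t = y' t := fun t ht => congrArg Prod.fst (heq ht)
  have e2 : ∀ t, 0 ≤ t → m t = m' t := fun t ht => congrArg Prod.snd (heq ht)
  have hTT : T = T' := by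
    rcases lt_trichotomy T T' with h1 | h1 | h1
    · have := hside' T ⟨hT, h1⟩
      rw [← e1 T hT.le, hyT] at this
      simp at this
    · exact h1
    · have := hside T' ⟨hT', h1⟩
      rw [e1 T' hT'.le, hyT'] at this
      simp at this
  exact ⟨hTT, by rw [← hmT, ← hmT', ← hTT, e2 T hT.le]⟩

theorem F_of_side (he : e = 1 ∨ e = -1) {y : ℝ} (hy : 0 ≤ e * (y - 1)) :
    F A y = (1 - e * A) * y + e * A * (y * y) := by
  rcases he with rfl | rfl
  · rw [F_right (by linarith)]; ring
  · rw [F_left (by linarith)]; ring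

/-- Rescaling time to the unit interval turns a half turn into an arc. The quadratic field of the
half plane is used, `e` being the sign of `y - 1` there. -/
theorem HalfTurn.exists_isArc (he : e = 1 ∨ e = -1) {ζ T ρ : ℝ} (h : HalfTurn A δ l e ζ T ρ) :
    ∃ Y M : CI, IsArc (1 - e * A) (e * A) δ l Y M T ζ ∧ M 1 = ρ ∧
      ∀ t ∈ Ioo (0 : ℝ) 1, 0 < e * (ext Y t - 1) := by
  obtain ⟨-, -, hT, y, m, hs, hy0, hm0, hyT, hmT, hside⟩ := h
  have hmaps : ∀ t ∈ Icc (0 : ℝ) 1, T * t ∈ Icc 0 T := fun t ht =>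
    ⟨mul_nonneg hT.le ht.1, mul_le_of_le_one_right hT.le ht.2⟩
  have hcont : ∀ {f : ℝ → ℝ}, ContinuousOn f (Icc 0 T) →
      Continuous (fun t : Icc (0 : ℝ) 1 => f (T * t)) := fun hf =>
    hf.comp_continuous (by fun_prop) fun t => hmaps t t.2
  set Y : CI := ⟨fun t => y (T * t), hcont (hs.cy le_rfl)⟩ with hY
  set M : CI := ⟨fun t => m (T * t), hcont (hs.cm le_rfl)⟩ with hM
  have eY : ∀ t ∈ Icc (0 : ℝ) 1, ext Y t = y (T * t) := fun t ht => ext_of_mem _ ht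
  have eM : ∀ t ∈ Icc (0 : ℝ) 1, ext M t = m (T * t) := fun t ht => ext_of_mem _ ht
  have hge : ∀ t ∈ Icc (0 : ℝ) T, 0 ≤ e * (y t - 1) := fun t ht => by
    rcases eq_or_lt_of_le ht.1 with h1 | h1
    · rw [← h1, hy0]; simp
    · rcases eq_or_lt_of_le ht.2 with h2 | h2
      · rw [h2, hyT]; simp
      · exact (hside t ⟨h1, h2⟩).le
  have hscale : ∀ {f : ℝ → ℝ} {d : ℝ} {t : ℝ}, 0 ≤ t → HasDerivWithinAt f d (Ici (T * t)) (T * t) →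
      HasDerivWithinAt (fun s => f (T * s)) (T * d) (Ici t) t := by
    intro f d t ht hf
    have h1 : HasDerivWithinAt (fun s : ℝ => T * s) (T * 1) (Ici t) t :=
      ((hasDerivAt_id t).const_mul T).hasDerivWithinAt
    have := HasDerivWithinAt.scomp t hf h1 (fun s hs => mul_le_mul_of_nonneg_left hs hT.le)
    simpa [Function.comp_def] using this
  have hnear : ∀ t ∈ Ico (0 : ℝ) 1, ∀ᶠ s in 𝓝[Ici t] t, s ∈ Icc (0 : ℝ) 1 := fun t ht => by
    filter_upwards [Icc_mem_nhdsGE ht.2] with s hs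
    exact ⟨ht.1.trans hs.1, hs.2⟩
  have h0 : (0 : ℝ) ∈ Icc (0 : ℝ) 1 := ⟨le_rfl, zero_le_one⟩
  have h1 : (1 : ℝ) ∈ Icc (0 : ℝ) 1 := ⟨zero_le_one, le_rfl⟩
  refine ⟨Y, M, ⟨?_, ?_, ?_⟩, ?_, fun t ht => ?_⟩
  · rw [← map_smul, ← sub_eq_iff_eq_add']
    refine eq_prim_of_hasDerivWithinAt ?_ fun t ht => ?_
    · show ext Y 0 - 1 = 0
      rw [eY 0 h0, mul_zero, hy0, sub_self]
    · have htI : t ∈ Icc (0 : ℝ) 1 := ⟨ht.1, ht.2.le⟩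
      have hd := hscale ht.1 (hs.dy (hmaps t htI).1)
      rw [F_of_side he (hge _ (hmaps t htI))] at hd
      have hd' := (hd.congr_of_eventuallyEq ((hnear t ht).mono fun s hs => eY s hs)
        (eY t htI)).sub_const 1
      refine hd'.congr_deriv ?_
      show _ = T * (ext M t - (1 - e * A) * ext Y t - e * A * (ext Y t * ext Y t))
      rw [eY t htI, eM t htI]; ring
  · rw [← map_smul, ← sub_eq_iff_eq_add']
    refine eq_prim_of_hasDerivWithinAt ?_ fun t ht => ?_
    · show ext M 0 - ζ * 1 = 0
      rw [eM 0 h0, mul_zero, hm0, mul_one, sub_self]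
    · have htI : t ∈ Icc (0 : ℝ) 1 := ⟨ht.1, ht.2.le⟩
      have hd := hscale ht.1 (hs.dm (hmaps t htI).1)
      have hd' := (hd.congr_of_eventuallyEq ((hnear t ht).mono fun s hs => eM s hs)
        (eM t htI)).sub_const (ζ * 1)
      refine hd'.congr_deriv ?_
      show _ = T * (δ * (l * 1 - ext Y t))
      rw [eY t htI]; ring
  · have := eY 1 h1
    rw [ext_of_mem _ h1, mul_one, hyT] at this
    exact this
  · have := eM 1 h1
    rw [ext_of_mem _ h1, mul_one, hmT] at this
    exact this
  · rw [eY t (Ioo_subset_Icc_self ht)]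
    exact hside _ ⟨mul_pos hT ht.1, mul_lt_of_lt_one_right hT ht.2⟩

theorem HalfTurn.of_isArc (P : Params A δ l) (he : e = 1 ∨ e = -1) {Y M : CI} {c s : ℝ}
    (h : IsArc (1 - e * A) (e * A) δ l Y M c s) (hc : 0 < c) (h0 : 0 < e * (s - 1))
    (h1 : 0 < e * (1 - M 1)) (hside : ∀ t ∈ Ioo (0 : ℝ) 1, 0 < e * (ext Y t - 1)) :
    HalfTurn A δ l e s c (M 1) := by
  obtain ⟨γ, hγ, hγ0⟩ := exists_sol P (1, s)
  have hdiv : ∀ t ∈ Icc 0 c, t / c ∈ Icc (0 : ℝ) 1 := fun t ht =>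
    ⟨div_nonneg ht.1 hc.le, (div_le_one hc).2 ht.2⟩
  have hge : ∀ t ∈ Icc (0 : ℝ) 1, 0 ≤ e * (ext Y t - 1) := fun t ht => by
    rcases eq_or_lt_of_le ht.1 with h1 | h1
    · rw [← h1, h.Y_zero]; simp
    · rcases eq_or_lt_of_le ht.2 with h2 | h2
      · rw [h2, h.Y_one]; simp
      · exact (hside t ⟨h1, h2⟩).le
  set η : ℝ → ℝ × ℝ := fun t => (ext Y (t / c), ext M (t / c)) with hη
  have hηc : Continuous η := ((continuous_ext Y).comp (continuous_id.div_const c)).prodMk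
    ((continuous_ext M).comp (continuous_id.div_const c))
  have hscale : ∀ {f : ℝ → ℝ} {d : ℝ} {t : ℝ}, HasDerivWithinAt f (c * d) (Ici (t / c)) (t / c) →
      HasDerivWithinAt (fun s => f (s / c)) d (Ici t) t := by
    intro f d t hf
    have h1 : HasDerivWithinAt (fun s : ℝ => s / c) (1 / c) (Ici t) t :=
      ((hasDerivAt_id t).div_const c).hasDerivWithinAt
    have := HasDerivWithinAt.scomp t hf h1 (fun s hs => div_le_div_of_nonneg_right hs hc.le)
    refine this.congr_deriv ?_
    rw [smul_eq_mul]
    field_simp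
  have hηd : ∀ t ∈ Ico 0 c, HasDerivWithinAt η (field A δ l (η t)) (Ici t) t := fun t ht => by
    have ht1 : t / c ∈ Ico (0 : ℝ) 1 := ⟨div_nonneg ht.1 hc.le, (div_lt_one hc).2 ht.2⟩
    rw [field_eq]
    have hF := F_of_side (A := A) he (hge _ (hdiv t ⟨ht.1, ht.2.le⟩))
    simp only [hη, hF]
    refine (hscale ((h.dY ht1).congr_deriv ?_)).prodMk (hscale (h.dM ht1))
    ring
  obtain ⟨R, hR⟩ := hγ.exists_bound c
  obtain ⟨R', hR'⟩ : ∃ R', ∀ t ∈ Icc 0 c, η t ∈ Metric.closedBall 0 R' := by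
    obtain ⟨R', hR'⟩ := ((isCompact_Icc (a := (0 : ℝ)) (b := c)).image hηc).isBounded.subset_closedBall 0
    exact ⟨R', fun t ht => hR' ⟨t, ht, rfl⟩⟩
  obtain ⟨K, hK⟩ := lipschitzOnBalls_field A δ l (max R R')
  have heq : EqOn γ η (Icc 0 c) := ODE_solution_unique_of_mem_Icc_right (v := fun _ => field A δ l)
    (K := K) (s := fun _ => Metric.closedBall 0 (max R R')) (fun _ _ => hK)
    (hγ.continuousOn.mono Icc_subset_Ici_self) (fun t ht => hγ.hasDerivWithinAt ht.1)
    (fun t ht => Metric.closedBall_subset_closedBall (le_max_left _ _) (hR t ⟨ht.1, ht.2.le⟩))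
    hηc.continuousOn hηd
    (fun t ht => Metric.closedBall_subset_closedBall (le_max_right _ _) (hR' t ⟨ht.1, ht.2.le⟩))
    (by simp only [hγ0, hη, zero_div, h.Y_zero, h.M_zero])
  have hγc : γ c = (1, M 1) := by
    have h2 : ext M 1 = M 1 := ext_of_mem _ ⟨zero_le_one, le_rfl⟩
    rw [heq ⟨hc.le, le_rfl⟩]
    simp only [hη, div_self hc.ne', h.Y_one, h2]
  refine ⟨h0, h1, hc, fun t => (γ t).1, fun t => (γ t).2, hγ, by simp [hγ0], by simp [hγ0],
    by simp [hγc], by simp [hγc], fun t ht => ?_⟩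
  have := heq (Ioo_subset_Icc_self ht)
  simp only [this, hη]
  exact hside _ ⟨div_pos ht.1 hc, (div_lt_one hc).2 ht.2⟩

/-- Half turns depend analytically on their starting point, and the endpoint moves in the direction
opposite to the starting point. -/
theorem HalfTurn.exists_family (P : Params A δ l) (he : e = 1 ∨ e = -1) {ζ T ρ : ℝ}
    (h : HalfTurn A δ l e ζ T ρ) : ∃ τ r : ℝ → ℝ, ContinuousAt τ ζ ∧ AnalyticAt ℝ r ζ ∧
      deriv r ζ < 0 ∧ ∀ᶠ s in 𝓝 ζ, HalfTurn A δ l e s (τ s) (r s) := by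
  obtain ⟨Y, M, hA, hM1, hside⟩ := h.exists_isArc he
  obtain ⟨h0, h1, hT, -⟩ := h
  rw [← hM1] at h1
  have hp : 1 - e * A + e * A = 1 := by ring
  have hne : M 1 - (1 - e * A) - e * A ≠ 0 := by
    intro h2
    have : 1 - M 1 = 0 := by linarith
    rw [this, mul_zero] at h1
    exact lt_irrefl _ h1
  obtain ⟨φ, hφ0, hφa, hev⟩ := hA.exists_family hne
  have hφc := hφa.continuousAt
  have hside' := hA.eventually_side hp hT h0 h1 hside hφ0 hφc hev
  set E : ((CI × CI) × ℝ) →L[ℝ] ℝ := (ContinuousMap.evalCLM ℝ (1 : Icc (0 : ℝ) 1)).comp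
      ((ContinuousLinearMap.snd ℝ CI CI).comp (ContinuousLinearMap.fst ℝ (CI × CI) ℝ)) with hE
  have hra : AnalyticAt ℝ (fun s => (φ s).1.2 1) ζ := (E.analyticAt (φ ζ)).comp hφa
  have hτc : ContinuousAt (fun s => (φ s).2) ζ :=
    ContinuousAt.comp (g := Prod.snd) continuousAt_snd hφc
  have hd : HasDerivAt φ (deriv φ ζ) ζ := hφa.differentiableAt.hasDerivAt
  obtain ⟨κ, hκ, hκe⟩ := hA.exists_endpoint_deriv hφ0 hd hev
  have hrd : HasDerivAt (fun s => (φ s).1.2 1) ((deriv φ ζ).1.2 1) ζ :=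
    E.hasFDerivAt.comp_hasDerivAt ζ hd
  refine ⟨fun s => (φ s).2, fun s => (φ s).1.2 1, hτc, hra, ?_, ?_⟩
  · rw [hrd.deriv]
    have e1 : M 1 - (1 - e * A) - e * A = -(1 - M 1) := by ring
    have e2 : ζ - (1 - e * A) - e * A = ζ - 1 := by ring
    rw [e1, e2] at hκe
    have h2 := mul_pos hκ h0
    by_contra! hcon
    have h3 := mul_nonneg hcon h1.le
    have h4 : (deriv φ ζ).1.2 1 * (e * (1 - M 1)) + κ * (e * (ζ - 1)) = 0 := by
      linear_combination (-e) * hκe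
    linarith
  · have hM : ∀ᶠ s in 𝓝 ζ, 0 < e * (1 - (φ s).1.2 1) := by
      have : ContinuousAt (fun s => e * (1 - (φ s).1.2 1)) ζ :=
        (hra.continuousAt.const_sub 1).const_mul e
      exact this.eventually (lt_mem_nhds (by simpa [hφ0] using h1))
    have hτ : ∀ᶠ s in 𝓝 ζ, 0 < (φ s).2 := hτc.eventually (lt_mem_nhds (by simpa [hφ0] using hT))
    have hs : ∀ᶠ s in 𝓝 ζ, 0 < e * (s - 1) := by
      have : ContinuousAt (fun s => e * (s - 1)) ζ := by fun_prop
      exact this.eventually (lt_mem_nhds h0)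
    filter_upwards [hev, hside', hM, hτ, hs] with s a1 a2 a3 a4 a5
    exact HalfTurn.of_isArc P he a1 a4 a5 a3 a2

theorem exists_halfTurn_right (P : Params A δ l) (hδ1 : δ < 1) {ζ : ℝ} (hζ : 1 < ζ) :
    ∃ T ρ, HalfTurn A δ l 1 ζ T ρ ∧ 1 - √δ * (1 - l) ≤ ρ := by
  obtain ⟨γ, hγ, hγ0⟩ := exists_sol P (1, ζ)
  obtain ⟨b, hb⟩ := Sol.exists_rightTurn (y := fun t => (γ t).1) (m := fun t => (γ t).2) hγ P hδ1
    le_rfl (by simp [hγ0]) (by simpa [hγ0] using hζ)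
  refine ⟨b, (γ b).2, ⟨by linarith, by linarith [hb.lt_one], hb.hab, _, _, hγ, by simp [hγ0],
    by simp [hγ0], hb.eq_b, rfl, fun t ht => ?_⟩, hb.le_m⟩
  linarith [hb.gt t ht]

theorem exists_halfTurn_left (P : Params A δ l) {ζ : ℝ} (hζ : ζ < 1) :
    ∃ T ρ, HalfTurn A δ l (-1) ζ T ρ ∧ 1 + (2 * A * l - 1 - A) * (1 - l) < ρ := by
  obtain ⟨γ, hγ, hγ0⟩ := exists_sol P (1, ζ)
  obtain ⟨t₁, t₂, t₃, hL⟩ := Sol.exists_leftTurn (y := fun t => (γ t).1) (m := fun t => (γ t).2) hγ P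
    (by simp [hγ0]) (by simpa [hγ0] using hζ.le)
  have hpos : 0 ≤ (2 * A * l - 1 - A) * (1 - l) :=
    mul_nonneg (by linarith [P.hl]) (by linarith [P.hl1])
  refine ⟨t₃, (γ t₃).2, ⟨by linarith, by linarith [hL.high], hL.h01.trans (hL.h12.trans hL.h23), _,
    _, hγ, by simp [hγ0], by simp [hγ0], hL.eq₃, rfl, fun t ht => ?_⟩, hL.high⟩
  linarith [hL.lt_one t ht]

end Stommel

namespace Stommel
open PlanarODE Volterra

variable {A δ l : ℝ}

/-! ### The return map -/

/-- The return map `Q` of the half line `{y = 1, μ > 1}`, with return time `τ`. -/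
theorem exists_returnMap (P : Params A δ l) (hδ1 : δ < 1) : ∃ Q τ : ℝ → ℝ,
    (∀ ζ > 1, 0 < τ ζ ∧ ∀ γ, IsForwardSolution (field A δ l) γ → γ 0 = (1, ζ) →
      γ (τ ζ) = (1, Q ζ)) ∧
    (∀ ζ > 1, ContinuousAt τ ζ ∧ AnalyticAt ℝ Q ζ ∧ 0 < deriv Q ζ) ∧
    ∃ c > 0, ∃ B, ∀ ζ > 1, 1 + c < Q ζ ∧ Q ζ ≤ B := by
  have hR : ∀ ζ : ℝ, ∃ w : ℝ × ℝ, 1 < ζ →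
      HalfTurn A δ l 1 ζ w.1 w.2 ∧ 1 - √δ * (1 - l) ≤ w.2 := fun ζ => by
    by_cases h : 1 < ζ
    · obtain ⟨T, ρ, h1⟩ := exists_halfTurn_right P hδ1 h
      exact ⟨(T, ρ), fun _ => h1⟩
    · exact ⟨0, fun h' => absurd h' h⟩
  have hL : ∀ ζ : ℝ, ∃ w : ℝ × ℝ, ζ < 1 →
      HalfTurn A δ l (-1) ζ w.1 w.2 ∧ 1 + (2 * A * l - 1 - A) * (1 - l) < w.2 := fun ζ => by
    by_cases h : ζ < 1
    · obtain ⟨T, ρ, h1⟩ := exists_halfTurn_left P h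
      exact ⟨(T, ρ), fun _ => h1⟩
    · exact ⟨0, fun h' => absurd h' h⟩
  choose wR hwR using hR
  choose wL hwL using hL
  have regR : ∀ ζ > 1, ContinuousAt (fun s => (wR s).1) ζ ∧ AnalyticAt ℝ (fun s => (wR s).2) ζ ∧
      deriv (fun s => (wR s).2) ζ < 0 := by
    intro ζ hζ
    obtain ⟨τ, r, h1, h2, h3, h4⟩ := (hwR ζ hζ).1.exists_family P (Or.inl rfl)
    have h5 : ∀ᶠ s in 𝓝 ζ, τ s = (wR s).1 ∧ r s = (wR s).2 := by
      filter_upwards [h4, lt_mem_nhds hζ] with s hs hs1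
      exact hs.unique (hwR s hs1).1
    have h6 : r =ᶠ[𝓝 ζ] fun s => (wR s).2 := h5.mono fun _ h => h.2
    exact ⟨h1.congr (h5.mono fun _ h => h.1), h2.congr h6, h6.deriv_eq ▸ h3⟩
  have regL : ∀ ζ < 1, ContinuousAt (fun s => (wL s).1) ζ ∧ AnalyticAt ℝ (fun s => (wL s).2) ζ ∧
      deriv (fun s => (wL s).2) ζ < 0 := by
    intro ζ hζ
    obtain ⟨τ, r, h1, h2, h3, h4⟩ := (hwL ζ hζ).1.exists_family P (Or.inr rfl)
    have h5 : ∀ᶠ s in 𝓝 ζ, τ s = (wL s).1 ∧ r s = (wL s).2 := by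
      filter_upwards [h4, gt_mem_nhds hζ] with s hs hs1
      exact hs.unique (hwL s hs1).1
    have h6 : r =ᶠ[𝓝 ζ] fun s => (wL s).2 := h5.mono fun _ h => h.2
    exact ⟨h1.congr (h5.mono fun _ h => h.1), h2.congr h6, h6.deriv_eq ▸ h3⟩
  have hR1 : ∀ ζ > 1, (wR ζ).2 < 1 := fun ζ hζ => by
    have := (hwR ζ hζ).1.2.1
    linarith
  refine ⟨fun ζ => (wL (wR ζ).2).2, fun ζ => (wL (wR ζ).2).1 + (wR ζ).1, fun ζ hζ => ⟨?_, ?_⟩,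
    fun ζ hζ => ⟨?_, ?_, ?_⟩, (2 * A * l - 1 - A) * (1 - l), mul_pos (by linarith [P.hl])
      (by linarith [P.hl1]), (wL (1 - √δ * (1 - l))).2, fun ζ hζ => ⟨(hwL _ (hR1 ζ hζ)).2, ?_⟩⟩
  · exact add_pos (hwL _ (hR1 ζ hζ)).1.2.2.1 (hwR ζ hζ).1.2.2.1
  · intro γ hγ hγ0
    obtain ⟨-, -, hT, y, m, hs, hy0, hm0, hyT, hmT, -⟩ := (hwR ζ hζ).1
    obtain ⟨-, -, hT', y', m', hs', hy0', hm0', hyT', hmT', -⟩ := (hwL _ (hR1 ζ hζ)).1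
    have e1 := hγ.eqOn (lipschitzOnBalls_field A δ l) hs (by simp only [hγ0, hy0, hm0])
      (show (wR ζ).1 ∈ Ici 0 from hT.le)
    have e2 := (hγ.shift hT.le).eqOn (lipschitzOnBalls_field A δ l) hs'
      (by simp only [zero_add, e1, hyT, hmT, hy0', hm0'])
      (show (wL (wR ζ).2).1 ∈ Ici 0 from hT'.le)
    simp only [hyT', hmT'] at e2
    exact e2
  · exact (ContinuousAt.comp (g := fun s => (wL s).1) (f := fun ζ => (wR ζ).2)
      (regL _ (hR1 ζ hζ)).1 (regR ζ hζ).2.1.continuousAt).add (regR ζ hζ).1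
  · exact AnalyticAt.fun_comp (g := fun s => (wL s).2) (f := fun ζ => (wR ζ).2)
      (regL _ (hR1 ζ hζ)).2.1 (regR ζ hζ).2.1
  · have h1 := (regL _ (hR1 ζ hζ)).2.1.differentiableAt.hasDerivAt
    have h2 := (regR ζ hζ).2.1.differentiableAt.hasDerivAt
    have h3 := HasDerivAt.comp ζ (h₂ := fun s => (wL s).2) (h := fun ζ => (wR ζ).2) h1 h2
    have h4 : deriv (fun ζ => (wL (wR ζ).2).2) ζ = _ := h3.deriv
    rw [h4]
    exact mul_pos_of_neg_of_neg (regL _ (hR1 ζ hζ)).2.2 (regR ζ hζ).2.2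
  -- the left half turn reverses order, and it starts no lower than at `1 - √δ (1 - l)`
  · have hanti : StrictAntiOn (fun s => (wL s).2) (Iio 1) := by
      refine strictAntiOn_of_deriv_neg (convex_Iio 1)
        (fun s hs => (regL s hs).2.1.continuousAt.continuousWithinAt) fun s hs => ?_
      rw [interior_Iio] at hs
      exact (regL s hs).2.2
    have h1 : 0 < √δ * (1 - l) := mul_pos (sqrt_facts P hδ1).1 (by linarith [P.hl1])
    exact hanti.antitoneOn (show 1 - √δ * (1 - l) < 1 by linarith) (hR1 ζ hζ) (hwR ζ hζ).2

/-- An analytic map `Q` of the half line to the right of `1`, with image bounded and bounded away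
from `1`, has a fixed point that is attracting from both sides: the supremum of the set where
`ζ < Q ζ`. There `Q ζ - ζ` has an isolated zero, and it is positive on the left because it is positive
arbitrarily close to the fixed point. -/
theorem exists_attracting_fixedPoint {Q : ℝ → ℝ} {c B : ℝ} (hc : 0 < c)
    (ha : ∀ ζ > 1, AnalyticAt ℝ Q ζ) (hQ : ∀ ζ > 1, 1 + c < Q ζ ∧ Q ζ ≤ B) :
    ∃ z > 1, Q z = z ∧ ∃ r > 0, 1 < z - r ∧ (∀ ζ ∈ Ioo (z - r) z, ζ < Q ζ) ∧
      ∀ ζ ∈ Ioo z (z + r), Q ζ < ζ := by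
  set S : Set ℝ := {ζ | 1 < ζ ∧ ζ < Q ζ} with hS
  have hcS : 1 + c ∈ S := ⟨by linarith, (hQ (1 + c) (by linarith)).1⟩
  have hbS : BddAbove S := ⟨B, fun ζ hζ => hζ.2.le.trans (hQ ζ hζ.1).2⟩
  set z := sSup S with hz
  have hzc : 1 + c ≤ z := le_csSup hbS hcS
  have hz1 : 1 < z := by linarith
  have hcont : ContinuousAt (fun ζ => Q ζ - ζ) z := (ha z hz1).continuousAt.sub continuousAt_id
  have hS_near : ∀ a < z, ∃ ζ ∈ S, a < ζ ∧ ζ ≤ z := fun a haz => by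
    obtain ⟨ζ, hζ, h⟩ := exists_lt_of_lt_csSup ⟨_, hcS⟩ haz
    exact ⟨ζ, hζ, h, le_csSup hbS hζ⟩
  have hfix : Q z = z := by
    rcases lt_trichotomy (Q z) z with h | h | h
    · obtain ⟨a, b, hab, hsub⟩ := mem_nhds_iff_exists_Ioo_subset.1
        (hcont.eventually (gt_mem_nhds (show Q z - z < 0 by linarith)))
      obtain ⟨ζ, hζ, h1, h2⟩ := hS_near a hab.1
      have := hsub ⟨h1, h2.trans_lt hab.2⟩
      have h3 := hζ.2
      simp only [mem_ofPred_eq] at this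
      linarith
    · exact h
    · obtain ⟨a, b, hab, hsub⟩ := mem_nhds_iff_exists_Ioo_subset.1
        (hcont.eventually (lt_mem_nhds (show 0 < Q z - z by linarith)))
      have h1 : z < (z + b) / 2 := by linarith [hab.2]
      have := hsub (show (z + b) / 2 ∈ Ioo a b from ⟨by linarith [hab.1], by linarith [hab.2]⟩)
      simp only [mem_ofPred_eq] at this
      exact absurd (le_csSup hbS (show (z + b) / 2 ∈ S from ⟨by linarith, by linarith⟩)) (not_le.2 h1)
  have hzS : z ∉ S := fun h => by
    have := h.2
    rw [hfix] at this
    exact lt_irrefl _ this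
  have hne : ∀ᶠ ζ in 𝓝[≠] z, Q ζ - ζ ≠ 0 := by
    rcases ((ha z hz1).sub analyticAt_id).eventually_eq_zero_or_eventually_ne_zero with h | h
    · exfalso
      obtain ⟨a, b, hab, hsub⟩ := mem_nhds_iff_exists_Ioo_subset.1 h
      obtain ⟨ζ, hζ, h1, h2⟩ := hS_near a hab.1
      have h3 : Q ζ - ζ = 0 := hsub ⟨h1, h2.trans_lt hab.2⟩
      have h4 := hζ.2
      linarith
    · exact h
  obtain ⟨r, hr, hrne⟩ := Metric.eventually_nhds_iff.1 (eventually_nhdsWithin_iff.1 hne)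
  have hnz : ∀ ζ, |ζ - z| < r → ζ ≠ z → Q ζ ≠ ζ := fun ζ h h' h'' =>
    hrne (by rwa [Real.dist_eq]) h' (sub_eq_zero.2 h'')
  refine ⟨z, hz1, hfix, min r (c / 2), lt_min hr (by linarith),
    by linarith [min_le_right r (c / 2)], fun ζ hζ => ?_, fun ζ hζ => ?_⟩
  · have hmr := min_le_left r (c / 2)
    have hmc := min_le_right r (c / 2)
    obtain ⟨x, hx, h1, h2⟩ := hS_near ζ hζ.2
    have h3 : x < z := lt_of_le_of_ne h2 fun h => hzS (h ▸ hx)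
    by_contra! hcon
    have hco : ContinuousOn (fun ζ => Q ζ - ζ) (Icc ζ x) := fun u hu =>
      ((ha u (by linarith [hu.1, hζ.1])).continuousAt.sub continuousAt_id).continuousWithinAt
    obtain ⟨u, hu, hu0⟩ := intermediate_value_Icc h1.le hco
      (show (0 : ℝ) ∈ Icc _ _ from ⟨by linarith, by linarith [hx.2]⟩)
    have hu0 : Q u - u = 0 := hu0
    refine hnz u ?_ (by linarith [hu.2] : u < z).ne (by linarith)
    rw [abs_lt]
    constructor <;> linarith [hu.1, hu.2, hζ.1]
  · have hmr := min_le_left r (c / 2)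
    refine lt_of_le_of_ne ?_ (hnz ζ (by rw [abs_lt]; constructor <;> linarith [hζ.1, hζ.2]) hζ.1.ne')
    by_contra! hcon
    exact absurd (le_csSup hbS (show ζ ∈ S from ⟨by linarith [hζ.1], hcon⟩)) (not_le.2 hζ.1)

/-- Iteration of a monotone map near a fixed point that attracts from both sides. -/
theorem tendsto_iterate_fixedPoint {Q : ℝ → ℝ} {z r : ℝ} (hQz : Q z = z)
    (hmono : MonotoneOn Q (Ioo (z - r) (z + r))) (hcont : ∀ ζ ∈ Ioo (z - r) (z + r), ContinuousAt Q ζ)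
    (hl : ∀ ζ ∈ Ioo (z - r) z, ζ < Q ζ) (hu : ∀ ζ ∈ Ioo z (z + r), Q ζ < ζ) {ζ : ℝ}
    (hζ : ζ ∈ Ioo (z - r) (z + r)) :
    (∀ n, |Q^[n] ζ - z| ≤ |ζ - z|) ∧ Tendsto (fun n => Q^[n] ζ) atTop (𝓝 z) := by
  have hzI : z ∈ Ioo (z - r) (z + r) := ⟨by linarith [hζ.1, hζ.2], by linarith [hζ.1, hζ.2]⟩
  rcases le_total z ζ with h | h
  · have hmem : ∀ n, Q^[n] ζ ∈ Icc z ζ ∧ Q^[n + 1] ζ ≤ Q^[n] ζ := by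
      have hstep : ∀ x ∈ Icc z ζ, Q x ∈ Icc z x := fun x hx => by
        have hxI : x ∈ Ioo (z - r) (z + r) := ⟨by linarith [hzI.1, hx.1], by linarith [hζ.2, hx.2]⟩
        refine ⟨by simpa [hQz] using hmono hzI hxI hx.1, ?_⟩
        rcases eq_or_lt_of_le hx.1 with h1 | h1
        · rw [← h1, hQz]
        · exact (hu x ⟨h1, hxI.2⟩).le
      intro n
      induction n with
      | zero => exact ⟨⟨h, le_rfl⟩, (hstep ζ ⟨h, le_rfl⟩).2⟩
      | succ n ih =>
        have h1 := hstep _ ih.1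
        rw [← Function.iterate_succ_apply' Q] at h1
        have h2 : Q^[n + 1] ζ ∈ Icc z ζ := ⟨h1.1, h1.2.trans ih.1.2⟩
        refine ⟨h2, ?_⟩
        rw [Function.iterate_succ_apply' Q (n + 1)]
        exact (hstep _ h2).2
    refine ⟨fun n => ?_, ?_⟩
    · rw [abs_of_nonneg (by linarith [(hmem n).1.1]), abs_of_nonneg (by linarith)]
      linarith [(hmem n).1.2]
    · have hlim := tendsto_atTop_ciInf (antitone_nat_of_succ_le fun n => (hmem n).2)
        ⟨z, by rintro _ ⟨n, rfl⟩; exact (hmem n).1.1⟩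
      set L := ⨅ n, Q^[n] ζ
      have hLI : L ∈ Icc z ζ := isClosed_Icc.mem_of_tendsto hlim (Eventually.of_forall fun n => (hmem n).1)
      have hL := isFixedPt_of_tendsto_iterate hlim
        (hcont L ⟨by linarith [hzI.1, hLI.1], by linarith [hζ.2, hLI.2]⟩)
      have : L = z := by
        by_contra hne
        have := hu L ⟨lt_of_le_of_ne hLI.1 (Ne.symm hne), by linarith [hζ.2, hLI.2]⟩
        rw [hL] at this
        exact lt_irrefl _ this
      rwa [this] at hlim
  · have hmem : ∀ n, Q^[n] ζ ∈ Icc ζ z ∧ Q^[n] ζ ≤ Q^[n + 1] ζ := by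
      have hstep : ∀ x ∈ Icc ζ z, Q x ∈ Icc x z := fun x hx => by
        have hxI : x ∈ Ioo (z - r) (z + r) := ⟨by linarith [hζ.1, hx.1], by linarith [hzI.2, hx.2]⟩
        refine ⟨?_, by simpa [hQz] using hmono hxI hzI hx.2⟩
        rcases eq_or_lt_of_le hx.2 with h1 | h1
        · rw [h1, hQz]
        · exact (hl x ⟨hxI.1, h1⟩).le
      intro n
      induction n with
      | zero => exact ⟨⟨le_rfl, h⟩, (hstep ζ ⟨le_rfl, h⟩).1⟩
      | succ n ih =>
        have h1 := hstep _ ih.1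
        rw [← Function.iterate_succ_apply' Q] at h1
        have h2 : Q^[n + 1] ζ ∈ Icc ζ z := ⟨ih.1.1.trans h1.1, h1.2⟩
        refine ⟨h2, ?_⟩
        rw [Function.iterate_succ_apply' Q (n + 1)]
        exact (hstep _ h2).1
    refine ⟨fun n => ?_, ?_⟩
    · rw [abs_of_nonpos (by linarith [(hmem n).1.2]), abs_of_nonpos (by linarith)]
      linarith [(hmem n).1.1]
    · have hlim := tendsto_atTop_ciSup (monotone_nat_of_le_succ fun n => (hmem n).2)
        ⟨z, by rintro _ ⟨n, rfl⟩; exact (hmem n).1.2⟩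
      set L := ⨆ n, Q^[n] ζ
      have hLI : L ∈ Icc ζ z := isClosed_Icc.mem_of_tendsto hlim (Eventually.of_forall fun n => (hmem n).1)
      have hL := isFixedPt_of_tendsto_iterate hlim
        (hcont L ⟨by linarith [hζ.1, hLI.1], by linarith [hzI.2, hLI.2]⟩)
      have : L = z := by
        by_contra hne
        have := hl L ⟨by linarith [hζ.1, hLI.1], lt_of_le_of_ne hLI.2 hne⟩
        rw [hL] at this
        exact lt_irrefl _ this
      rwa [this] at hlim

end Stommel

namespace PlanarODE

variable {X : ℝ × ℝ → ℝ × ℝ} {γ : ℝ → ℝ × ℝ}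

/-! ### Attracting periodic orbits -/

/-- A forward solution that returns to its starting point extends to a periodic solution. -/
theorem IsForwardSolution.exists_periodic (hX : LipschitzOnBalls X) (h : IsForwardSolution X γ)
    {T : ℝ} (hT : 0 < T) (hret : γ T = γ 0) :
    ∃ η : ℝ → ℝ × ℝ, IsIntegralCurve η (fun _ => X) ∧ Function.Periodic η T ∧ η 0 = γ 0 := by
  have hper : ∀ (n : ℕ) (t : ℝ), 0 ≤ t → γ (t + n * T) = γ t := by
    intro n
    induction n with
    | zero => intro t _; simp
    | succ n ih =>
      intro t ht
      have h1 := (h.shift hT.le).eqOn hX h (by simpa using hret)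
        (show t + n * T ∈ Ici 0 by simp only [mem_Ici]; positivity)
      simp only at h1
      have e : t + ((n + 1 : ℕ) : ℝ) * T = t + n * T + T := by push_cast; ring
      rw [e, h1, ih t ht]
  set N : ℝ → ℕ := fun t => ⌈-t / T⌉₊ with hN
  have hN0 : ∀ t, 0 ≤ t + N t * T := fun t => by
    have := Nat.le_ceil (-t / T)
    rw [div_le_iff₀ hT] at this
    linarith
  have hval : ∀ (t : ℝ) (n : ℕ), 0 ≤ t + n * T → γ (t + N t * T) = γ (t + n * T) := fun t n hn => by
    rw [← hper n _ (hN0 t), ← hper (N t) _ hn]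
    congr 1; ring
  refine ⟨fun t => γ (t + N t * T), fun t => ?_, fun t => ?_, ?_⟩
  · obtain ⟨n, hn⟩ := exists_nat_gt (-t / T)
    rw [div_lt_iff₀ hT] at hn
    have hpos : 0 < t + n * T := by linarith
    have h1 : HasDerivAt γ (X (γ (t + n * T))) (t + n * T) :=
      (h (t + n * T) hpos.le).hasDerivAt (Ici_mem_nhds hpos)
    have h2 := h1.comp_add_const t (n * T)
    show HasDerivAt _ (X (γ (t + N t * T))) t
    rw [hval t n hpos.le]
    refine h2.congr_of_eventuallyEq ?_
    have : ∀ᶠ s in 𝓝 t, 0 < s + n * T :=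
      (continuous_id.add continuous_const).continuousAt.eventually (lt_mem_nhds hpos)
    filter_upwards [this] with s hs using hval s n hs.le
  · show γ (t + T + N (t + T) * T) = γ (t + N t * T)
    have h1 := hN0 (t + T)
    have e : t + T + N (t + T) * T = t + ((N (t + T) + 1 : ℕ) : ℝ) * T := by push_cast; ring
    rw [e] at h1 ⊢
    exact (hval t _ h1).symm
  · have := hval 0 0 (by simp)
    simpa using this

/-- Near a point `(1, z)` of a periodic orbit that crosses the line `y = 1` to the right, solutions
that start near the orbit follow it until they meet the line close to `(1, z)`. -/
theorem exists_meet_section (hX : LipschitzOnBalls X) (hγ : IsIntegralCurve γ (fun _ => X)) {T : ℝ}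
    (hT : 0 < T) (hp : Function.Periodic γ T) {z : ℝ} (hγ0 : γ 0 = (1, z)) (hz : 0 < (X (1, z)).1)
    {ε κ : ℝ} (hε : 0 < ε) (hκ : 0 < κ) {q : ℝ × ℝ} (hq : q ∈ range γ) :
    ∃ ρ > 0, ∀ η, IsForwardSolution X η → dist (η 0) q < ρ → ∃ s ≥ 0, ∃ ζ, |ζ - z| < κ ∧
      η s = (1, ζ) ∧ ∀ t ∈ Icc 0 s, η t ∈ Metric.thickening ε (range γ) := by
  obtain ⟨a, rfl⟩ := hq
  have hd : HasDerivAt (fun t => (γ t).1) (X (1, z)).1 0 := by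
    have h1 := hγ 0
    rw [hγ0] at h1
    exact (hasFDerivAt_iff_hasDerivAt.1 h1.hasFDerivAt.fst).congr_deriv (by simp)
  -- the orbit is on the left of the line just before time `0` and on the right just after
  have hcross : ∀ᶠ t in 𝓝 (0 : ℝ), t ≠ 0 → 0 < t * ((γ t).1 - 1) := by
    have h1 := (hasDerivAt_iff_tendsto_slope.1 hd).eventually (lt_mem_nhds hz)
    rw [eventually_nhdsWithin_iff] at h1
    filter_upwards [h1] with t ht ht0
    have h2 := ht ht0
    rw [slope_def_field, hγ0, sub_zero] at h2
    have h3 := mul_pos h2 (mul_self_pos.2 ht0)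
    have h4 : ((γ t).1 - 1) / t * (t * t) = t * ((γ t).1 - 1) := by field_simp
    linarith
  have hnear : ∀ᶠ t in 𝓝 (0 : ℝ), |(γ t).2 - z| < κ / 2 := by
    have h1 : ContinuousAt (fun t => |(γ t).2 - z|) 0 :=
      ((continuous_snd.comp hγ.continuous).sub continuous_const).abs.continuousAt
    exact h1.eventually (gt_mem_nhds (by simp [hγ0, hκ]))
  obtain ⟨θ, hθ, hθ'⟩ := Metric.eventually_nhds_iff.1 (hcross.and hnear)
  set v := min (θ / 2) 1 with hv
  have hv0 : 0 < v := lt_min (by linarith) one_pos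
  have hvθ : v < θ := (min_le_left _ _).trans_lt (by linarith)
  have hv1 : v ≤ 1 := min_le_right _ _
  have hin : ∀ t ∈ Icc (-v) v, dist t 0 < θ := fun t ht => by
    rw [Real.dist_eq, sub_zero, abs_lt]; constructor <;> linarith [ht.1, ht.2]
  have hr : 0 < (γ v).1 - 1 := by
    have := (hθ' (hin v ⟨by linarith, le_rfl⟩)).1 hv0.ne'
    exact (mul_pos_iff_of_pos_left hv0).1 this
  have hl : (γ (-v)).1 - 1 < 0 := by
    have := (hθ' (hin (-v) ⟨le_rfl, by linarith⟩)).1 (by linarith)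
    by_contra! h
    have h2 := mul_nonneg hv0.le h
    linarith
  obtain ⟨n, hn⟩ := exists_nat_gt ((a + 1) / T)
  rw [div_lt_iff₀ hT] at hn
  set u := n * T - a with hu
  have hu1 : 1 < u := by linarith
  set ω := min (min ε (κ / 2)) (min ((γ v).1 - 1) (1 - (γ (-v)).1)) with hω
  have hω0 : 0 < ω := lt_min (lt_min hε (by linarith)) (lt_min hr (by linarith))
  have hω1 : ω ≤ ε := (min_le_left _ _).trans (min_le_left _ _)
  have hω2 : ω ≤ κ / 2 := (min_le_left _ _).trans (min_le_right _ _)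
  have hω3 : ω ≤ (γ v).1 - 1 := (min_le_right _ _).trans (min_le_left _ _)
  have hω4 : ω ≤ 1 - (γ (-v)).1 := (min_le_right _ _).trans (min_le_right _ _)
  obtain ⟨ρ, hρ, hclose⟩ := (hγ.isForwardSolution a).exists_dist_lt hX (u + v) hω0
  refine ⟨ρ, hρ, fun η hη hη0 => ?_⟩
  have hc := hclose η hη (by simpa using hη0)
  have hγu : ∀ t, γ (u + t + a) = γ t := fun t => by
    have := hp.nat_mul n t
    rw [← this]; congr 1; rw [hu]; ring
  have hc' : ∀ t ∈ Icc (-v) v, dist (η (u + t)) (γ t) < ω := fun t ht => by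
    have := hc (u + t) ⟨by linarith [ht.1], by linarith [ht.2]⟩
    rwa [hγu] at this
  have hfst : ∀ t ∈ Icc (-v) v, |(η (u + t)).1 - (γ t).1| < ω := fun t ht =>
    (Real.dist_eq _ _ ▸ le_max_left _ _ : _ ≤ dist (η (u + t)) (γ t)).trans_lt (hc' t ht)
  have hsnd : ∀ t ∈ Icc (-v) v, |(η (u + t)).2 - (γ t).2| < ω := fun t ht =>
    (Real.dist_eq _ _ ▸ le_max_right _ _ : _ ≤ dist (η (u + t)) (γ t)).trans_lt (hc' t ht)
  have hcont : ContinuousOn (fun t => (η t).1) (Icc (u + -v) (u + v)) :=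
    (continuous_fst.comp_continuousOn hη.continuousOn).mono
      (fun t ht => by simp only [mem_Ici]; linarith [ht.1])
  have h1 := abs_lt.1 (hfst (-v) ⟨le_rfl, by linarith⟩)
  have h2 := abs_lt.1 (hfst v ⟨by linarith, le_rfl⟩)
  obtain ⟨s, hs, hs1⟩ := intermediate_value_Icc (by linarith) hcont
    (show (1 : ℝ) ∈ Icc _ _ from ⟨by linarith, by linarith⟩)
  have hsv : s - u ∈ Icc (-v) v := ⟨by linarith [hs.1], by linarith [hs.2]⟩
  have h3 := abs_lt.1 (hsnd _ hsv)
  have h4 := abs_lt.1 (hθ' (hin _ hsv)).2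
  rw [add_sub_cancel] at h3
  refine ⟨s, by linarith [hs.1], (η s).2, ?_, Prod.ext hs1 rfl, fun t ht => ?_⟩
  · rw [abs_lt]; constructor <;> linarith
  · exact Metric.mem_thickening_iff.2 ⟨γ (t + a), ⟨_, rfl⟩,
      (hc t ⟨ht.1, ht.2.trans hs.2⟩).trans_le hω1⟩

/-- A periodic orbit is attracting if its first return map to the line `y = 1` has a fixed point
that attracts from both sides. -/
theorem isAttracting_of_returnMap (hX : LipschitzOnBalls X)
    (hex : ∀ p, ∃ γ, IsForwardSolution X γ ∧ γ 0 = p)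
    (hγ : IsIntegralCurve γ (fun _ => X)) {T : ℝ}
    (hT : 0 < T) (hp : Function.Periodic γ T) {z : ℝ} (hγ0 : γ 0 = (1, z)) (hz : 0 < (X (1, z)).1)
    {Q τ : ℝ → ℝ} {r : ℝ} (hr : 0 < r)
    (hret : ∀ ζ ∈ Ioo (z - r) (z + r), ∀ η, IsForwardSolution X η → η 0 = (1, ζ) →
      η (τ ζ) = (1, Q ζ))
    (hτ : ContinuousAt τ z) (hτz : 0 < τ z)
    (hit : ∀ ζ ∈ Ioo (z - r) (z + r), (∀ n, |Q^[n] ζ - z| ≤ |ζ - z|) ∧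
      Tendsto (fun n => Q^[n] ζ) atTop (𝓝 z)) :
    IsAttracting X (range γ) := by
  have hfwd : IsForwardSolution X γ := by simpa using hγ.isForwardSolution 0
  have hcompact : IsCompact (range γ) := by
    rw [← hp.image_Icc hT 0]
    exact isCompact_Icc.image hγ.continuous
  -- solutions that start near `(1, z)` on the line follow the orbit from each return to the next
  have near : ∀ ε > 0, ∃ κ > 0, κ ≤ r ∧ ∀ ζ, |ζ - z| < κ → ∀ η, IsForwardSolution X η →
      η 0 = (1, ζ) → ∀ n : ℕ, ∃ s ≥ n * (τ z / 2), η s = (1, Q^[n] ζ) ∧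
        ∀ t ∈ Icc 0 s, η t ∈ Metric.thickening ε (range γ) := by
    intro ε hε
    obtain ⟨κ₁, hκ₁, hclose⟩ := hfwd.exists_dist_lt hX (τ z + 1) hε
    have h1 : ∀ᶠ ζ in 𝓝 z, τ z / 2 < τ ζ ∧ τ ζ < τ z + 1 :=
      (hτ.eventually (lt_mem_nhds (by linarith))).and (hτ.eventually (gt_mem_nhds (by linarith)))
    obtain ⟨κ₂, hκ₂, hτ'⟩ := Metric.eventually_nhds_iff.1 h1
    refine ⟨min r (min κ₁ κ₂), lt_min hr (lt_min hκ₁ hκ₂), min_le_left _ _,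
      fun ζ hζ η hη hη0 n => ?_⟩
    have hζr : |ζ - z| < r := hζ.trans_le (min_le_left _ _)
    have hζI : ζ ∈ Ioo (z - r) (z + r) := by
      rw [abs_lt] at hζr; constructor <;> linarith [hζr.1, hζr.2]
    have hn := (hit ζ hζI).1
    induction n with
    | zero =>
      refine ⟨0, by simp, hη0, fun t ht => ?_⟩
      have e : t = 0 := le_antisymm ht.2 ht.1
      rw [e, hη0]
      refine Metric.mem_thickening_iff.2 ⟨γ 0, ⟨0, rfl⟩, ?_⟩
      have h2 := hclose η hη (by
        rw [hη0, hγ0, Prod.dist_eq, dist_self, Real.dist_eq, max_eq_right (abs_nonneg _)]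
        exact hζ.trans_le ((min_le_right _ _).trans (min_le_left _ _))) 0
        ⟨le_rfl, by linarith⟩
      rwa [hη0] at h2
    | succ n ih =>
      obtain ⟨s, hs, hηs, hth⟩ := ih
      have hs0 : 0 ≤ s := le_trans (by positivity) hs
      set x := Q^[n] ζ with hx
      have hxz : |x - z| < min r (min κ₁ κ₂) := (hn n).trans_lt hζ
      have hxr : |x - z| < r := hxz.trans_le (min_le_left _ _)
      have hxI : x ∈ Ioo (z - r) (z + r) := by
        rw [abs_lt] at hxr; constructor <;> linarith [hxr.1, hxr.2]
      have hsh := hη.shift hs0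
      have h2 := hret x hxI _ hsh (by simpa using hηs)
      obtain ⟨h3, h4⟩ := hτ' (y := x) (by
        rw [Real.dist_eq]; exact hxz.trans_le ((min_le_right _ _).trans (min_le_right _ _)))
      refine ⟨τ x + s, ?_, ?_, fun t ht => ?_⟩
      · push_cast; linarith
      · rw [Function.iterate_succ_apply']; exact h2
      · rcases le_total t s with h5 | h5
        · exact hth t ⟨ht.1, h5⟩
        · have h6 := hclose _ hsh (by
            simp only [zero_add]
            rw [hηs, hγ0, Prod.dist_eq, dist_self, Real.dist_eq, max_eq_right (abs_nonneg _)]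
            exact hxz.trans_le ((min_le_right _ _).trans (min_le_left _ _))) (t - s)
            ⟨by linarith, by linarith [ht.2]⟩
          simp only [sub_add_cancel] at h6
          exact Metric.mem_thickening_iff.2 ⟨_, ⟨_, rfl⟩, h6⟩
  have stay : ∀ ε > 0, ∃ κ > 0, κ ≤ r ∧ ∀ ζ, |ζ - z| < κ → ∀ η, IsForwardSolution X η →
      η 0 = (1, ζ) → ∀ t ≥ 0, η t ∈ Metric.thickening ε (range γ) := by
    intro ε hε
    obtain ⟨κ, hκ, hκr, h⟩ := near ε hε
    refine ⟨κ, hκ, hκr, fun ζ hζ η hη hη0 t ht => ?_⟩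
    obtain ⟨n, hn⟩ := exists_nat_gt (t / (τ z / 2))
    rw [div_lt_iff₀ (by linarith)] at hn
    obtain ⟨s, hs, -, hth⟩ := h ζ hζ η hη hη0 n
    exact hth t ⟨ht, by linarith⟩
  -- a neighbourhood of the orbit from which solutions reach the line close to `(1, z)`
  have enter : ∀ ε > 0, ∀ κ > 0, ∃ V ∈ 𝓝ˢ (range γ), ∀ η, IsForwardSolution X η → η 0 ∈ V →
      ∃ s ≥ 0, ∃ ζ, |ζ - z| < κ ∧ η s = (1, ζ) ∧
        ∀ t ∈ Icc 0 s, η t ∈ Metric.thickening ε (range γ) := by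
    intro ε hε κ hκ
    have h := fun q (hq : q ∈ range γ) => exists_meet_section hX hγ hT hp hγ0 hz hε hκ hq
    refine ⟨{p | ∀ η, IsForwardSolution X η → η 0 = p → ∃ s ≥ 0, ∃ ζ, |ζ - z| < κ ∧ η s = (1, ζ) ∧
        ∀ t ∈ Icc 0 s, η t ∈ Metric.thickening ε (range γ)}, ?_, fun η hη h0 => h0 η hη rfl⟩
    rw [mem_nhdsSet_iff_forall]
    intro q hq
    obtain ⟨ρ, hρ, h1⟩ := h q hq
    filter_upwards [Metric.ball_mem_nhds q hρ] with p hp η hη hη0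
    exact h1 η hη (by rw [hη0]; exact hp)
  refine ⟨fun U hU => ?_, ?_⟩
  · obtain ⟨O, hO, hΓO, hOU⟩ := mem_nhdsSet_iff_exists.1 hU
    obtain ⟨ε, hε, hεO⟩ := hcompact.exists_thickening_subset_open hO hΓO
    obtain ⟨κ, hκ, -, hstay⟩ := stay ε hε
    obtain ⟨V, hV, hV'⟩ := enter ε hε κ hκ
    refine ⟨V, hV, fun η hη h0 t ht => hOU (hεO ?_)⟩
    obtain ⟨s, hs, ζ, hζ, hηs, hth⟩ := hV' η hη h0
    rcases le_total t s with h1 | h1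
    · exact hth t ⟨ht, h1⟩
    · have := hstay ζ hζ _ (hη.shift hs) (by simpa using hηs) (t - s) (by linarith)
      simpa using this
  · obtain ⟨κ, hκ, hκr, hnear⟩ := near 1 one_pos
    obtain ⟨V, hV, hV'⟩ := enter 1 one_pos κ hκ
    refine ⟨V, hV, fun p hpV => ⟨hex p, fun η hη hη0 => ?_⟩⟩
    obtain ⟨s, hs, ζ, hζ, hηs, -⟩ := hV' η hη (by rwa [hη0])
    have hζr : |ζ - z| < r := hζ.trans_le hκr
    have hζI : ζ ∈ Ioo (z - r) (z + r) := by
      rw [abs_lt] at hζr; constructor <;> linarith [hζr.1, hζr.2]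
    rw [Metric.tendsto_atTop]
    intro ε hε
    obtain ⟨κ', hκ', -, hstay⟩ := stay ε hε
    obtain ⟨n, hn⟩ := ((Metric.tendsto_atTop.1 (hit ζ hζI).2) κ' hκ').imp fun n h => h n le_rfl
    rw [Real.dist_eq] at hn
    obtain ⟨s', hs', hηs', -⟩ := hnear ζ hζ _ (hη.shift hs) (by simpa using hηs) n
    have hs'0 : 0 ≤ s' := le_trans (by positivity) hs'
    refine ⟨s' + s, fun t ht => ?_⟩
    have h1 := hstay _ hn _ (hη.shift (add_nonneg hs'0 hs)) (by simpa using hηs') (t - (s' + s))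
      (by linarith)
    simp only [sub_add_cancel] at h1
    obtain ⟨x, hx, hxt⟩ := Metric.mem_thickening_iff.1 h1
    rw [Real.dist_eq, sub_zero, abs_of_nonneg Metric.infDist_nonneg]
    exact (Metric.infDist_le_dist_of_mem hx).trans_lt hxt

end PlanarODE

namespace Stommel
open PlanarODE

variable {A δ l : ℝ}

theorem exists_attracting_periodicOrbit (P : Params A δ l) (hδ1 : δ < 1) :
    ∃ Γ, IsPeriodicOrbit (field A δ l) Γ ∧ IsAttracting (field A δ l) Γ := by
  obtain ⟨Q, τ, h1, h2, c, hc, B, h3⟩ := exists_returnMap P hδ1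
  obtain ⟨z, hz, hQz, r, hr, hr1, hl, hu⟩ :=
    exists_attracting_fixedPoint hc (fun ζ hζ => (h2 ζ hζ).2.1) h3
  have hX := lipschitzOnBalls_field A δ l
  obtain ⟨γ, hγ, hγ0⟩ := exists_sol P (1, z)
  have hret := (h1 z hz).2 γ hγ hγ0
  rw [hQz, ← hγ0] at hret
  obtain ⟨η, hη, hper, hη0⟩ := hγ.exists_periodic hX (h1 z hz).1 hret
  rw [hγ0] at hη0
  have hfz : (field A δ l (1, z)).1 = z - 1 := by rw [field_eq, F_left le_rfl]; ring
  refine ⟨range η, ⟨η, hη, ⟨_, (h1 z hz).1, hper⟩, ?_, rfl⟩, ?_⟩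
  · by_contra! hconst
    have h4 : HasDerivAt η 0 0 := by
      have : η = fun _ => η 0 := funext hconst
      rw [this]
      exact hasDerivAt_const _ _
    have h5 := (hη 0).unique h4
    simp only [hη0] at h5
    rw [h5] at hfz
    simp only [Prod.fst_zero] at hfz
    linarith
  · have hI : ∀ ζ ∈ Ioo (z - r) (z + r), 1 < ζ := fun ζ hζ => by linarith [hζ.1]
    have hmono : MonotoneOn Q (Ioo (z - r) (z + r)) := by
      refine (strictMonoOn_of_deriv_pos (convex_Ioo _ _)
        (fun s hs => (h2 s (hI s hs)).2.1.continuousAt.continuousWithinAt) fun s hs => ?_).monotoneOn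
      rw [interior_Ioo] at hs
      exact (h2 s (hI s hs)).2.2
    exact isAttracting_of_returnMap hX (exists_sol P) hη (h1 z hz).1 hper hη0 (by rw [hfz]; linarith)
      hr (fun ζ hζ => (h1 ζ (hI ζ hζ)).2) (h2 z hz).1 (h1 z hz).1
      (fun ζ hζ => tendsto_iterate_fixedPoint hQz hmono
        (fun s hs => (h2 s (hI s hs)).2.1.continuousAt) hl hu hζ)

end Stommel

theorem mainTheorem1 :
    -- attracting periodic orbit, and its dependence on the sign of `A - (1 + 2 √δ₀)` near `l = 1`
    (∃ δs : ℝ, 0 < δs ∧ ∀ A δ₀ : ℝ, 1 < A → 0 < δ₀ → δ₀ < δs →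
      (∀ l : ℝ, (1 + A) / (2 * A) < l → l < 1 →
        (∀ p : ℝ × ℝ, Stommel.field A δ₀ l p = 0 ↔ p = (l, Stommel.F A l)) ∧
        PlanarODE.IsRepellingEquilibrium (Stommel.field A δ₀ l) (l, Stommel.F A l) ∧
        ∃ Γ : Set (ℝ × ℝ), PlanarODE.IsPeriodicOrbit (Stommel.field A δ₀ l) Γ ∧
          PlanarODE.IsAttracting (Stommel.field A δ₀ l) Γ) ∧
      (A < 1 + 2 * √δ₀ →
        (∀ l : ℝ, (1 + A) / (2 * A) < l → l < 1 →
          PlanarODE.IsUnstableFocus (Stommel.field A δ₀ l) (l, Stommel.F A l)) ∧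
        ∀ ε : ℝ, 0 < ε → ∀ᶠ l in 𝓝[<] (1 : ℝ), ∀ Γ : Set (ℝ × ℝ),
          PlanarODE.IsPeriodicOrbit (Stommel.field A δ₀ l) Γ →
            Stommel.IsCanardCycle (Stommel.field A δ₀ l) A ε Γ) ∧
      (1 + 2 * √δ₀ < A →
        ∃ r : ℝ, 0 < r ∧ ∀ᶠ l in 𝓝[<] (1 : ℝ),
          PlanarODE.IsUnstableNode (Stommel.field A δ₀ l) (l, Stommel.F A l) ∧
          ∀ Γ : Set (ℝ × ℝ), PlanarODE.IsPeriodicOrbit (Stommel.field A δ₀ l) Γ →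
            ∃ p ∈ Γ, r ≤ dist p (l, Stommel.F A l))) ∧
    -- relaxation oscillations for fixed `A` and small `δ₀`, uniformly up to `l = 1`
    (∀ A l₁ ε : ℝ, 1 < A → (1 + A) / (2 * A) < l₁ → l₁ < 1 → 0 < ε →
      ∃ δ₁ : ℝ, 0 < δ₁ ∧ ∀ δ₀ : ℝ, 0 < δ₀ → δ₀ < δ₁ →
        1 + 2 * √δ₀ < A ∧
        ∀ l : ℝ, l₁ ≤ l → l < 1 → ∀ Γ : Set (ℝ × ℝ),
          PlanarODE.IsPeriodicOrbit (Stommel.field A δ₀ l) Γ →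
            Stommel.IsRelaxationOscillation A ε Γ) := by
  have params : ∀ {A δ₀ l : ℝ}, 1 < A → 0 < δ₀ → (1 + A) / (2 * A) < l → l < 1 →
      Stommel.Params A δ₀ l := fun {A δ₀ l} hA hδ hl hl1 => by
    rw [div_lt_iff₀ (by linarith)] at hl
    exact ⟨hA, hδ, by linarith, hl1⟩
  -- below `1 / 16` the left passage of a canard cycle lasts longer than `1`
  refine ⟨⟨1 / 16, by norm_num, fun A δ₀ hA hδ hδ1 => ⟨fun l hl hl1 => ?_, fun h => ⟨?_, ?_⟩,
    fun h => ?_⟩⟩, fun A l₁ ε hA hl₁ _ hε => Stommel.exists_relaxation hA hl₁ hε⟩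
  · have P := params hA hδ hl hl1
    exact ⟨Stommel.field_eq_zero_iff P, Stommel.isRepellingEquilibrium P,
      Stommel.exists_attracting_periodicOrbit P (by linarith)⟩
  · intro l hl hl1
    have P := params hA hδ hl hl1
    refine Stommel.isUnstableFocus P ?_
    have h1 : 0 < 2 * A * l - 1 - A := by linarith [P.hl]
    have h2 : 2 * A * l - 1 - A < 2 * √δ₀ := by nlinarith
    have h3 : √δ₀ * √δ₀ = δ₀ := Real.mul_self_sqrt hδ.le
    nlinarith
  · exact fun ε hε => Stommel.isCanardCycle hA hδ hδ1 h hε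
  · exact Stommel.superExplosion hA hδ (by linarith) h
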